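/- Let $k$ be an algebraically closed field of characteristic $3$, let $G$ be an algebraic group of type $E_7$ over $k$, and let $\mathfrak g=\mathrm{Lie}(G)$, with Chevalley basis $h_1,\dots,h_7$, $e_\alpha$ ($\alpha$ a root; simple roots $\alpha_1,\dots,\alpha_7$ in Bourbaki's numbering). Let $\mathcal O(2;\underline 1)=k[x_1,x_2]/(x_1^3,x_2^3)$ with partial derivatives $\partial_1,\partial_2$, let $W(2;\underline 1)=\mathrm{Der}\,\mathcal O(2;\underline 1)$, let $H(2;\underline 1)=\{f_1\partial_1+f_2\partial_2\in W(2;\underline 1):\partial_1(f_1)+\partial_2(f_2)=0\}$, and let $CH(2;\underline 1)=H(2;\underline 1)+k(x_1\partial_1+x_2\partial_2)$. The Lie algebra $(\mathfrak{sl}(2)\otimes\mathcal O(2;\underline 1))\rtimes(1\otimes W(2;\underline 1))$ is formed with the bracket $[x\otimes f,y\otimes g]=[x,y]\otimes fg$ and the action $D(x\otimes f)=x\otimes D(f)$. **Theorem.** Let $e$ be any element of the nilpotent orbit $\mathcal O(A_2^2+A_1)$, i.e. of the $\mathrm{Ad}(G)$-orbit of $e_{\alpha_1}+e_{\alpha_2}+e_{\alpha_3}+e_{\alpha_5}+e_{\alpha_6}$.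 Put $\mathfrak g_e=\{x\in\mathfrak g:[x,e]=0\}$ and $\mathfrak n_e=\{x\in\mathfrak g:[x,e]\in ke\}$, let $A=\mathrm{rad}(\mathfrak n_e)$ be the solvable radical of $\mathfrak n_e$, and let $\mathfrak w=N_{\mathfrak g}(A)=\{x\in\mathfrak g:[x,A]\subseteq A\}$. Then $A$ is abelian of dimension $8$; the algebras $\mathfrak g_e$ and $\mathfrak n_e$ are contained in $\mathfrak w$; and there is an ideal $I$ of $\mathfrak w$ of dimension $35$ with $A\subseteq I\subseteq\mathfrak g_e$ such that: (a) $A=\mathrm{rad}(\mathfrak g_e)$ and $\mathfrak g_e/I\cong H(2;\underline 1)$ as Lie algebras; (b) $A=\mathrm{rad}(\mathfrak n_e)$ and $\mathfrak n_e/I\cong CH(2;\underline 1)$ as Lie algebras; (c) $A=\mathrm{rad}(\mathfrak w)$, and $\mathfrak w$ is a maximal Lie subalgebra of $\mathfrak g$ (proper, and contained in no other proper subalgebra); (d) $\mathfrak w/A\cong(\mathfrak{sl}(2)\otimes\mathcal O(2;\underline 1))\rtimes(1\otimes W(2;\underline 1))$ as Lie algebras, by an isomorphism that maps $I/A$ onto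 $\mathfrak{sl}(2)\otimes\mathcal O(2;\underline 1)$. -/

import Mathlib

namespace ExcE7

/-- The root lattice of type `E₇`: integral combinations `∑ aᵢ αᵢ` of the simple roots
(Bourbaki's numbering, the node `i` is `Fin` index `i - 1`). -/
abbrev Lat : Type := Fin 7 → ℤ

/-- The invariant form of the root lattice; `(αᵢ, αⱼ)` is the Cartan matrix of type `E₇`. -/
def ip (a b : Lat) : ℤ := ∑ i, ∑ j, a i * CartanMatrix.E₇ i j * b j

/-- The roots: the vectors of norm `2` of the root lattice. -/
abbrev Root : Type := {a : Lat // ip a a = 2}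

/-- The bilinear form `b` with `b(αᵢ, αᵢ) = 1`, `b(αᵢ, αⱼ) = (αᵢ, αⱼ)` for `i < j` and
`b(αᵢ, αⱼ) = 0` for `i > j`, so that `b(x, y) + b(y, x) = (x, y)`. -/
def cocycleForm (a b : Lat) : ℤ :=
  ∑ i, ∑ j, a i * (if i = j then 1 else if i < j then CartanMatrix.E₇ i j else 0) * b j

/-- The simple root `αᵢ`. -/
def simpleRoot (i : Fin 7) : Lat := Pi.single i 1

theorem ip_add_left (a b c : Lat) : ip (a + b) c = ip a c + ip b c := by
  simp only [ip, Pi.add_apply, add_mul, Finset.sum_add_distrib]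

theorem ip_add_right (a b c : Lat) : ip a (b + c) = ip a b + ip a c := by
  simp only [ip, Pi.add_apply, mul_add, Finset.sum_add_distrib]

theorem ip_neg_left (a b : Lat) : ip (-a) b = -ip a b := by
  simp only [ip, Pi.neg_apply, neg_mul, Finset.sum_neg_distrib]

theorem ip_neg_right (a b : Lat) : ip a (-b) = -ip a b := by
  simp only [ip, Pi.neg_apply, mul_neg, Finset.sum_neg_distrib]

theorem cocycleForm_add_left (a b c : Lat) :
    cocycleForm (a + b) c = cocycleForm a c + cocycleForm b c := by
  simp only [cocycleForm, Pi.add_apply, add_mul, Finset.sum_add_distrib]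

theorem cocycleForm_add_right (a b c : Lat) :
    cocycleForm a (b + c) = cocycleForm a b + cocycleForm a c := by
  simp only [cocycleForm, Pi.add_apply, mul_add, Finset.sum_add_distrib]

theorem cocycleForm_neg_left (a b : Lat) : cocycleForm (-a) b = -cocycleForm a b := by
  simp only [cocycleForm, Pi.neg_apply, neg_mul, Finset.sum_neg_distrib]

theorem cocycleForm_neg_right (a b : Lat) : cocycleForm a (-b) = -cocycleForm a b := by
  simp only [cocycleForm, Pi.neg_apply, mul_neg, Finset.sum_neg_distrib]

theorem cocycleForm_add_swap (a b : Lat) : cocycleForm a b + cocycleForm b a = ip a b := by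
  have key : ∀ i j : Fin 7, (if i = j then (1 : ℤ) else if i < j then CartanMatrix.E₇ i j else 0)
      + (if j = i then (1 : ℤ) else if j < i then CartanMatrix.E₇ j i else 0) = CartanMatrix.E₇ i j := by
    intro i j
    fin_cases i <;> fin_cases j <;> decide
  have hs : cocycleForm b a = ∑ i, ∑ j,
      b j * (if j = i then 1 else if j < i then CartanMatrix.E₇ j i else 0) * a i := by
    rw [cocycleForm, Finset.sum_comm]
  rw [hs, cocycleForm, ip]
  simp only [← Finset.sum_add_distrib]
  refine Finset.sum_congr rfl fun i _ => Finset.sum_congr rfl fun j _ => ?_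
  linear_combination (a i * b j) * key i j

theorem ip_comm (a b : Lat) : ip a b = ip b a := by
  rw [← cocycleForm_add_swap, ← cocycleForm_add_swap, add_comm]

theorem ip_self_sum_sq (a : Lat) : 12 * ip a a =
    6 * (2 * a 0 - a 2) ^ 2 + 2 * (3 * a 2 - 2 * a 3) ^ 2 + 6 * (2 * a 1 - a 3) ^ 2
      + 6 * (2 * a 6 - a 5) ^ 2 + 2 * (3 * a 5 - 2 * a 4) ^ 2 + (4 * a 4 - 3 * a 3) ^ 2
      + a 3 ^ 2 := by
  simp [ip, Fin.sum_univ_succ, CartanMatrix.E₇]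
  ring

theorem ip_self_nonneg (a : Lat) : 0 ≤ ip a a := by
  have := ip_self_sum_sq a
  have : 0 ≤ 12 * ip a a := by rw [this]; positivity
  omega

theorem eq_zero_of_ip_self (a : Lat) (h : ip a a = 0) : a = 0 := by
  have e := ip_self_sum_sq a
  rw [h] at e
  have h1 := sq_nonneg (2 * a 0 - a 2)
  have h2 := sq_nonneg (3 * a 2 - 2 * a 3)
  have h3 := sq_nonneg (2 * a 1 - a 3)
  have h4 := sq_nonneg (2 * a 6 - a 5)
  have h5 := sq_nonneg (3 * a 5 - 2 * a 4)
  have h6 := sq_nonneg (4 * a 4 - 3 * a 3)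
  have h7 := sq_nonneg (a 3)
  have z1 : 2 * a 0 - a 2 = 0 := pow_eq_zero_iff two_ne_zero |>.1 (by linarith)
  have z2 : 3 * a 2 - 2 * a 3 = 0 := pow_eq_zero_iff two_ne_zero |>.1 (by linarith)
  have z3 : 2 * a 1 - a 3 = 0 := pow_eq_zero_iff two_ne_zero |>.1 (by linarith)
  have z4 : 2 * a 6 - a 5 = 0 := pow_eq_zero_iff two_ne_zero |>.1 (by linarith)
  have z5 : 3 * a 5 - 2 * a 4 = 0 := pow_eq_zero_iff two_ne_zero |>.1 (by linarith)
  have z6 : 4 * a 4 - 3 * a 3 = 0 := pow_eq_zero_iff two_ne_zero |>.1 (by linarith)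
  have z7 : a 3 = 0 := pow_eq_zero_iff two_ne_zero |>.1 (by linarith)
  funext i
  fin_cases i <;> simp <;> omega

section Algebra

variable (k : Type*) [Field k]

/-- The Lie algebra of type `E₇` over `k`, as a vector space: it is free on the Chevalley basis
`h₁, …, h₇` (`Sum.inl`) and `e_α`, `α` a root (`Sum.inr`). -/
def LieE7 : Type _ := (Fin 7 ⊕ Root) →₀ k

noncomputable instance : AddCommGroup (LieE7 k) :=
  inferInstanceAs (AddCommGroup ((Fin 7 ⊕ Root) →₀ k))

noncomputable instance : Module k (LieE7 k) :=
  inferInstanceAs (Module k ((Fin 7 ⊕ Root) →₀ k))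

/-- The Chevalley basis vectors. -/
noncomputable def bv (i : Fin 7 ⊕ Root) : LieE7 k := Finsupp.single i (1 : k)

/-- The Chevalley basis. -/
noncomputable def chevalleyBasis : Module.Basis (Fin 7 ⊕ Root) k (LieE7 k) :=
  Finsupp.basisSingleOne

/-- `h_v = ∑ vᵢ hᵢ`. -/
noncomputable def hvec (v : Lat) : LieE7 k := ∑ i, (v i : k) • bv k (Sum.inl i)

/-- `e_v` if `v` is a root, and `0` otherwise. -/
noncomputable def evec (v : Lat) : LieE7 k :=
  if h : ip v v = 2 then bv k (Sum.inr ⟨v, h⟩) else 0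

/-- The sign `(-1) ^ n` in `k`. -/
def sgn (n : ℤ) : k := (((Int.negOnePow n : ℤˣ) : ℤ) : k)

/-- The structure constants: `[hᵢ, hⱼ] = 0`, `[hᵢ, e_β] = ⟨β, αᵢ^∨⟩ e_β`, `[e_α, e_{-α}] = -h_α`,
`[e_α, e_β] = ± e_{α + β}` if `α + β` is a root, and `[e_α, e_β] = 0` in all other cases.
The sign `(-1) ^ b(α, β)` is the standard one for a simply laced root system; replacing `e_α` by
`-e_α` for all negative roots `α` one gets `[e_α, e_{-α}] = h_α`. -/
noncomputable def basisBracket : (Fin 7 ⊕ Root) → (Fin 7 ⊕ Root) → LieE7 k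
  | Sum.inl _, Sum.inl _ => 0
  | Sum.inl i, Sum.inr β => (ip (simpleRoot i) β.1 : k) • evec k β.1
  | Sum.inr α, Sum.inl i => -((ip (simpleRoot i) α.1 : k) • evec k α.1)
  | Sum.inr α, Sum.inr β =>
      if α.1 + β.1 = 0 then -hvec k α.1
      else sgn k (cocycleForm α.1 β.1) • evec k (α.1 + β.1)

/-- The bracket, extended bilinearly from the basis. -/
noncomputable def lieBr : LieE7 k →ₗ[k] LieE7 k →ₗ[k] LieE7 k :=
  (chevalleyBasis k).constr k fun i => (chevalleyBasis k).constr k (basisBracket k i)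

noncomputable instance : Bracket (LieE7 k) (LieE7 k) := ⟨fun x y => lieBr k x y⟩

variable {k}

theorem lieBr_bv (i j : Fin 7 ⊕ Root) : lieBr k (bv k i) (bv k j) = basisBracket k i j := by
  have hb : ∀ i, bv k i = chevalleyBasis k i := fun i =>
    (Finsupp.coe_basisSingleOne (R := k) ▸ rfl)
  simp [lieBr, hb]

theorem ind {P : LieE7 k → Prop} (h0 : P 0) (ha : ∀ x y, P x → P y → P (x + y))
    (hs : ∀ (c : k) i, P (c • bv k i)) (x : LieE7 k) : P x := by
  refine Finsupp.induction_linear (motive := P) x h0 ha fun i c => ?_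
  have : (Finsupp.single i c : (Fin 7 ⊕ Root) →₀ k) = c • Finsupp.single i (1 : k) := by simp
  rw [this]
  exact hs c i

theorem sgn_add (m n : ℤ) : sgn k (m + n) = sgn k m * sgn k n := by
  simp [sgn, Int.negOnePow_add]

theorem sgn_neg (m : ℤ) : sgn k (-m) = sgn k m := by simp [sgn]

theorem sgn_even {m : ℤ} (h : Even m) : sgn k m = 1 := by simp [sgn, Int.negOnePow_even m h]

theorem sgn_odd {m : ℤ} (h : Odd m) : sgn k m = -1 := by simp [sgn, Int.negOnePow_odd m h]

theorem sgn_odd_sub {m n : ℤ} (h : Odd (m - n)) : sgn k m = -sgn k n := by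
  have : m = (m - n) + n := by ring
  rw [this, sgn_add, sgn_odd h]; ring

theorem sgn_even_sub {m n : ℤ} (h : Even (m - n)) : sgn k m = sgn k n := by
  have : m = (m - n) + n := by ring
  rw [this, sgn_add, sgn_even h]; ring

theorem evec_root (α : Root) : evec k α.1 = bv k (Sum.inr α) := by simp [evec, α.2]

theorem evec_of_ne {v : Lat} (h : ip v v ≠ 2) : evec k v = 0 := by simp [evec, h]

theorem hvec_neg (v : Lat) : hvec k (-v) = -hvec k v := by simp [hvec, Finset.sum_neg_distrib]

theorem hvec_add (v w : Lat) : hvec k (v + w) = hvec k v + hvec k w := by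
  simp [hvec, add_smul, Finset.sum_add_distrib]

theorem lieBr_inl_evec (i : Fin 7) (v : Lat) :
    lieBr k (bv k (Sum.inl i)) (evec k v) = (ip (simpleRoot i) v : k) • evec k v := by
  by_cases h : ip v v = 2
  · rw [evec_root ⟨v, h⟩, lieBr_bv, basisBracket, evec_root ⟨v, h⟩]
  · simp [evec_of_ne h]

theorem lieBr_evec_inl (i : Fin 7) (v : Lat) :
    lieBr k (evec k v) (bv k (Sum.inl i)) = -((ip (simpleRoot i) v : k) • evec k v) := by
  by_cases h : ip v v = 2
  · rw [evec_root ⟨v, h⟩, lieBr_bv, basisBracket, evec_root ⟨v, h⟩]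
  · simp [evec_of_ne h]

theorem ip_eq_sum (v w : Lat) : ip v w = ∑ i, v i * ip (simpleRoot i) w := by
  have hw : ∀ i, ip (simpleRoot i) w = ∑ j, CartanMatrix.E₇ i j * w j := by
    intro i
    rw [ip, Finset.sum_eq_single i]
    · simp [simpleRoot]
    · intro b _ hb
      simp [simpleRoot, hb]
    · simp
  simp only [hw, Finset.mul_sum]
  simp only [ip, mul_assoc]

theorem lieBr_hvec_evec (v w : Lat) :
    lieBr k (hvec k v) (evec k w) = (ip v w : k) • evec k w := by
  rw [ip_eq_sum v w]
  simp [hvec, lieBr_inl_evec, Finset.sum_smul, smul_smul]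

theorem lieBr_evec_hvec (v w : Lat) :
    lieBr k (evec k v) (hvec k w) = -((ip w v : k) • evec k v) := by
  rw [ip_eq_sum w v]
  simp [hvec, lieBr_evec_inl, Finset.sum_smul, smul_smul]

theorem lieBr_inl_hvec (i : Fin 7) (v : Lat) :
    lieBr k (bv k (Sum.inl i)) (hvec k v) = 0 := by
  simp [hvec, lieBr_bv, basisBracket]

theorem lieBr_evec_evec {v w : Lat} (hv : ip v v = 2) (hw : ip w w = 2) :
    lieBr k (evec k v) (evec k w) =
      if v + w = 0 then -hvec k v else sgn k (cocycleForm v w) • evec k (v + w) := by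
  rw [evec_root ⟨v, hv⟩, evec_root ⟨w, hw⟩, lieBr_bv, basisBracket]

theorem ip_add_self (v w : Lat) : ip (v + w) (v + w) = ip v v + 2 * ip v w + ip w w := by
  rw [ip_add_left, ip_add_right, ip_add_right, ip_comm w v]; ring

theorem ip_ge {v w : Lat} (hv : ip v v = 2) (hw : ip w w = 2) (h : v + w ≠ 0) : -1 ≤ ip v w := by
  have h1 := ip_self_nonneg (v + w)
  have h2 : ip (v + w) (v + w) ≠ 0 := fun h' => h (eq_zero_of_ip_self _ h')
  rw [ip_add_self] at h1 h2
  omega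

theorem lieBr_skew_bv (i j : Fin 7 ⊕ Root) :
    lieBr k (bv k i) (bv k j) = -lieBr k (bv k j) (bv k i) := by
  rw [lieBr_bv, lieBr_bv]
  rcases i with i | α <;> rcases j with j | β <;> simp only [basisBracket, neg_zero, neg_neg]
  by_cases h : α.1 + β.1 = 0
  · have hβ : β.1 = -α.1 := (neg_eq_of_add_eq_zero_right h).symm
    simp [hβ, hvec_neg]
  · have h' : β.1 + α.1 ≠ 0 := by rwa [add_comm]
    rw [if_neg h, if_neg h', add_comm β.1]
    by_cases hr : ip (α.1 + β.1) (α.1 + β.1) = 2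
    · rw [sgn_odd_sub (n := cocycleForm β.1 α.1), neg_smul]
      have := cocycleForm_add_swap α.1 β.1
      rw [ip_add_self, α.2, β.2] at hr
      exact ⟨-1 - cocycleForm β.1 α.1, by omega⟩
    · simp [evec_of_ne hr]

theorem lieBr_skew (x y : LieE7 k) : lieBr k x y = -lieBr k y x := by
  induction x using ind with
  | h0 => simp
  | ha x x' h h' => simp [h, h', add_comm]
  | hs c i =>
    induction y using ind with
    | h0 => simp
    | ha y y' h h' => rw [map_add, h, h']; simp [add_comm]
    | hs d j => simp [lieBr_skew_bv i j, smul_comm c d]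

theorem lieBr_self (x : LieE7 k) : lieBr k x x = 0 := by
  induction x using ind with
  | h0 => simp
  | ha x y h h' => simp [h, h', lieBr_skew x y]
  | hs c i =>
    have : basisBracket k i i = 0 := by
      rcases i with i | α
      · rfl
      · have h2 : ip (α.1 + α.1) (α.1 + α.1) = 8 := by rw [ip_add_self, α.2]; norm_num
        have h0 : α.1 + α.1 ≠ 0 := by
          intro h
          rw [h] at h2
          simp [ip] at h2
        rw [basisBracket, if_neg h0, evec_of_ne (by omega), smul_zero]
    simp [lieBr_bv, this]

/-- The cyclic sum in the Jacobi identity. -/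
noncomputable def jac (x y z : LieE7 k) : LieE7 k :=
  lieBr k x (lieBr k y z) + lieBr k y (lieBr k z x) + lieBr k z (lieBr k x y)

theorem jac_cyc (x y z : LieE7 k) : jac x y z = jac y z x := by
  simp only [jac]; abel

theorem jac_hee (i : Fin 7) (α β : Root) :
    jac (bv k (Sum.inl i)) (evec k α.1) (evec k β.1) = 0 := by
  rw [jac, lieBr_inl_evec, lieBr_evec_inl, lieBr_evec_evec α.2 β.2]
  rw [map_smul, map_neg, map_smul, lieBr_skew (evec k β.1), lieBr_evec_evec α.2 β.2]
  by_cases h : α.1 + β.1 = 0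
  · have hβ : β.1 = -α.1 := (neg_eq_of_add_eq_zero_right h).symm
    simp [hβ, ip_neg_right, lieBr_inl_hvec]
  · rw [if_neg h, map_smul, lieBr_inl_evec, ip_add_right]
    push_cast
    module

theorem jac_neg (α β : Root) : jac (evec k α.1) (evec k β.1) (evec k (-β.1)) = 0 := by
  have hb : ip (-β.1) (-β.1) = 2 := by rw [ip_neg_left, ip_neg_right, neg_neg, β.2]
  have hba := ip_comm β.1 α.1
  have hs := cocycleForm_add_swap α.1 β.1
  have hs' := cocycleForm_add_swap β.1 β.1
  have hβ1 : cocycleForm β.1 β.1 = 1 := by have := β.2; omega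
  have hc : ip (-β.1) α.1 = -ip α.1 β.1 := by rw [ip_neg_left, hba]
  rw [jac, lieBr_evec_evec β.2 hb, lieBr_evec_evec hb α.2, lieBr_evec_evec α.2 β.2]
  rw [if_pos (add_neg_cancel β.1), map_neg, lieBr_evec_hvec, hba]
  by_cases h1 : -β.1 + α.1 = 0
  · have hα : α.1 = β.1 := (neg_add_eq_zero.1 h1).symm
    have h8 : ip (β.1 + β.1) (β.1 + β.1) = 8 := by rw [ip_add_self, β.2]; norm_num
    have h0 : β.1 + β.1 ≠ 0 := by
      intro h
      rw [h] at h8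
      simp [ip] at h8
    rw [hα, if_pos (neg_add_cancel β.1), if_neg h0, evec_of_ne (v := β.1 + β.1) (by omega), hvec_neg, neg_neg, neg_neg,
      lieBr_evec_hvec, smul_zero, map_zero, β.2]
    simp
  by_cases h2 : α.1 + β.1 = 0
  · have hα : α.1 = -β.1 := eq_neg_of_add_eq_zero_left h2
    have h8 : ip (-β.1 + -β.1) (-β.1 + -β.1) = 8 := by rw [ip_add_self, hb]; norm_num
    have h0 : -β.1 + -β.1 ≠ 0 := by
      intro h
      rw [h] at h8
      simp [ip] at h8
    rw [hα, if_pos (neg_add_cancel β.1), if_neg h0, evec_of_ne (v := -β.1 + -β.1) (by omega), hvec_neg, neg_neg, neg_neg,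
      lieBr_evec_hvec, smul_zero, map_zero, ip_neg_left, ip_neg_right, β.2]
    simp
  have hge := ip_ge α.2 β.2 h2
  have hle := ip_ge hb α.2 h1
  rw [hc] at hle
  rw [if_neg h1, if_neg h2, map_smul, map_smul]
  have hn1 := ip_add_self (-β.1) α.1
  have hn2 := ip_add_self α.1 β.1
  rw [hb, α.2, hc] at hn1
  rw [α.2, β.2] at hn2
  have e1 : β.1 + (-β.1 + α.1) = α.1 := by abel
  have e2 : -β.1 + (α.1 + β.1) = α.1 := by abel
  have hα0 : α.1 ≠ 0 := by
    intro h
    have := α.2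
    rw [h] at this
    simp [ip] at this
  have hcases : ip α.1 β.1 = -1 ∨ ip α.1 β.1 = 0 ∨ ip α.1 β.1 = 1 := by omega
  rcases hcases with h | h | h
  · rw [evec_of_ne (v := -β.1 + α.1) (by omega), lieBr_evec_evec hb (by omega), e2, if_neg hα0,
      smul_smul, ← sgn_add,
      sgn_even (m := cocycleForm α.1 β.1 + cocycleForm (-β.1) (α.1 + β.1)), h]
    · simp
    · rw [cocycleForm_add_right, cocycleForm_neg_left, cocycleForm_neg_left, hβ1]
      exact ⟨-1 - cocycleForm β.1 α.1, by omega⟩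
  · rw [evec_of_ne (v := -β.1 + α.1) (by omega), evec_of_ne (v := α.1 + β.1) (by omega), h]
    simp
  · rw [evec_of_ne (v := α.1 + β.1) (by omega), lieBr_evec_evec β.2 (by omega), e1, if_neg hα0,
      smul_smul, ← sgn_add, sgn_odd, h]
    · simp
    · rw [cocycleForm_add_right, cocycleForm_neg_left, cocycleForm_neg_right, hβ1]
      exact ⟨-1, by ring⟩

theorem lieBr_lieBr_evec (α β γ : Root) (h1 : β.1 + γ.1 ≠ 0) (h2 : α.1 + (β.1 + γ.1) ≠ 0) :
    lieBr k (evec k α.1) (lieBr k (evec k β.1) (evec k γ.1)) =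
      if ip β.1 γ.1 = -1 then
        sgn k (cocycleForm β.1 γ.1 + cocycleForm α.1 β.1 + cocycleForm α.1 γ.1) •
          evec k (α.1 + β.1 + γ.1)
      else 0 := by
  have hn := ip_add_self β.1 γ.1
  rw [β.2, γ.2] at hn
  have hge := ip_ge β.2 γ.2 h1
  rw [lieBr_evec_evec β.2 γ.2, if_neg h1, map_smul]
  split_ifs with h
  · rw [lieBr_evec_evec α.2 (by omega), if_neg h2, smul_smul, ← sgn_add, cocycleForm_add_right,
      add_assoc, add_assoc]
  · rw [evec_of_ne (v := β.1 + γ.1) (by omega)]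
    simp

theorem jac_eee (α β γ : Root) : jac (evec k α.1) (evec k β.1) (evec k γ.1) = 0 := by
  by_cases h1 : β.1 + γ.1 = 0
  · rw [← neg_eq_of_add_eq_zero_right h1]; exact jac_neg α β
  by_cases h2 : γ.1 + α.1 = 0
  · rw [jac_cyc, ← neg_eq_of_add_eq_zero_right h2]; exact jac_neg β γ
  by_cases h3 : α.1 + β.1 = 0
  · rw [jac_cyc, jac_cyc, ← neg_eq_of_add_eq_zero_right h3]; exact jac_neg γ α
  have b1 := ip_ge β.2 γ.2 h1
  have b2 := ip_ge γ.2 α.2 h2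
  have b3 := ip_ge α.2 β.2 h3
  have s1 := cocycleForm_add_swap β.1 γ.1
  have s2 := cocycleForm_add_swap γ.1 α.1
  have s3 := cocycleForm_add_swap α.1 β.1
  have hn : ip (α.1 + β.1 + γ.1) (α.1 + β.1 + γ.1) =
      6 + 2 * (ip β.1 γ.1 + ip γ.1 α.1 + ip α.1 β.1) := by
    rw [ip_add_self, ip_add_self, ip_add_left, α.2, β.2, γ.2, ip_comm α.1 γ.1]; ring
  by_cases h0 : α.1 + β.1 + γ.1 = 0
  · have hγ : γ.1 = -(α.1 + β.1) := (neg_eq_of_add_eq_zero_right h0).symm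
    have hα : α.1 = -(β.1 + γ.1) := by rw [hγ]; abel
    have hβ : β.1 = -(γ.1 + α.1) := by rw [hγ]; abel
    have z : ∀ v : Lat, ip 0 v = 0 := fun v => by simp [ip]
    rw [h0, z] at hn
    have c1 : ip β.1 γ.1 = -1 := by omega
    have c2 : ip γ.1 α.1 = -1 := by omega
    have c3 : ip α.1 β.1 = -1 := by omega
    have n1 : ip (β.1 + γ.1) (β.1 + γ.1) = 2 := by rw [ip_add_self, β.2, γ.2, c1]; norm_num
    have n2 : ip (γ.1 + α.1) (γ.1 + α.1) = 2 := by rw [ip_add_self, γ.2, α.2, c2]; norm_num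
    have n3 : ip (α.1 + β.1) (α.1 + β.1) = 2 := by rw [ip_add_self, α.2, β.2, c3]; norm_num
    have t1 : α.1 + (β.1 + γ.1) = 0 := by rw [← h0]; abel
    have t2 : β.1 + (γ.1 + α.1) = 0 := by rw [← h0]; abel
    have t3 : γ.1 + (α.1 + β.1) = 0 := by rw [← h0]; abel
    have hα1 : cocycleForm α.1 α.1 = 1 := by have := cocycleForm_add_swap α.1 α.1; have := α.2; omega
    have hβ1 : cocycleForm β.1 β.1 = 1 := by have := cocycleForm_add_swap β.1 β.1; have := β.2; omega
    have q1 : sgn k (cocycleForm β.1 γ.1) = sgn k (cocycleForm α.1 β.1) := by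
      apply sgn_even_sub
      rw [hγ, cocycleForm_neg_right, cocycleForm_add_right, hβ1]
      exact ⟨0, by omega⟩
    have q2 : sgn k (cocycleForm γ.1 α.1) = sgn k (cocycleForm α.1 β.1) := by
      apply sgn_even_sub
      rw [hγ, cocycleForm_neg_left, cocycleForm_add_left, hα1]
      exact ⟨0, by omega⟩
    rw [jac, lieBr_evec_evec β.2 γ.2, lieBr_evec_evec γ.2 α.2, lieBr_evec_evec α.2 β.2,
      if_neg h1, if_neg h2, if_neg h3, map_smul, map_smul, map_smul, lieBr_evec_evec α.2 n1,
      lieBr_evec_evec β.2 n2, lieBr_evec_evec γ.2 n3, if_pos t1, if_pos t2, if_pos t3, q1, q2,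
      ← smul_add, ← smul_add, ← neg_add, ← neg_add, ← hvec_add, ← hvec_add, h0]
    simp [hvec]
  · have t1 : α.1 + (β.1 + γ.1) ≠ 0 := by rwa [← add_assoc]
    have t2 : β.1 + (γ.1 + α.1) ≠ 0 := by
      intro h; apply h0; rw [← h]; abel
    have t3 : γ.1 + (α.1 + β.1) ≠ 0 := by
      intro h; apply h0; rw [← h]; abel
    have u2 : β.1 + γ.1 + α.1 = α.1 + β.1 + γ.1 := by abel
    have u3 : γ.1 + α.1 + β.1 = α.1 + β.1 + γ.1 := by abel
    rw [jac, lieBr_lieBr_evec α β γ h1 t1, lieBr_lieBr_evec β γ α h2 t2,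
      lieBr_lieBr_evec γ α β h3 t3, u2, u3]
    by_cases hr : ip (α.1 + β.1 + γ.1) (α.1 + β.1 + γ.1) = 2
    · have hc : (ip β.1 γ.1 = -1 ∧ ip γ.1 α.1 = -1 ∧ ip α.1 β.1 = 0) ∨
          (ip β.1 γ.1 = -1 ∧ ip γ.1 α.1 = 0 ∧ ip α.1 β.1 = -1) ∨
          (ip β.1 γ.1 = 0 ∧ ip γ.1 α.1 = -1 ∧ ip α.1 β.1 = -1) := by omega
      rcases hc with ⟨c1, c2, c3⟩ | ⟨c1, c2, c3⟩ | ⟨c1, c2, c3⟩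
      · rw [if_pos c1, if_pos c2, if_neg (by omega), sgn_odd_sub (n := cocycleForm γ.1 α.1 +
          cocycleForm β.1 γ.1 + cocycleForm β.1 α.1)]
        · simp
        · rw [Int.odd_iff]; omega
      · rw [if_pos c1, if_neg (by omega), if_pos c3, sgn_odd_sub (n := cocycleForm α.1 β.1 +
          cocycleForm γ.1 α.1 + cocycleForm γ.1 β.1)]
        · simp
        · rw [Int.odd_iff]; omega
      · rw [if_neg (by omega), if_pos c2, if_pos c3, sgn_odd_sub (m := cocycleForm γ.1 α.1 +
          cocycleForm β.1 γ.1 + cocycleForm β.1 α.1) (n := cocycleForm α.1 β.1 +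
          cocycleForm γ.1 α.1 + cocycleForm γ.1 β.1)]
        · simp
        · rw [Int.odd_iff]; omega
    · simp [evec_of_ne hr]

theorem jac_bv (i j l : Fin 7 ⊕ Root) : jac (bv k i) (bv k j) (bv k l) = 0 := by
  have hhh : ∀ i j l, jac (bv k (.inl i)) (bv k (.inl j)) (bv k (.inl l)) = 0 := by
    intro i j l
    simp [jac, lieBr_bv, basisBracket]
  have hhe : ∀ i j (α : Root), jac (bv k (.inl i)) (bv k (.inl j)) (evec k α.1) = 0 := by
    intro i j α
    have : lieBr k (bv k (.inl i)) (bv k (.inl j)) = 0 := by rw [lieBr_bv, basisBracket]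
    rw [jac, this]
    simp only [lieBr_inl_evec, lieBr_evec_inl, map_smul, map_neg, map_zero]
    module
  rcases i with i | α <;> rcases j with j | β <;> rcases l with l | γ <;>
    try simp only [← evec_root]
  · exact hhh i j l
  · exact hhe i j γ
  · rw [jac_cyc, jac_cyc]; exact hhe l i β
  · exact jac_hee i β γ
  · rw [jac_cyc]; exact hhe j l α
  · rw [jac_cyc]; exact jac_hee j γ α
  · rw [jac_cyc, jac_cyc]; exact jac_hee l α β
  · exact jac_eee α β γ

theorem jac_eq_zero (x y z : LieE7 k) : jac x y z = 0 := by
  have hl : ∀ x x' y z : LieE7 k, jac (x + x') y z = jac x y z + jac x' y z := by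
    intro x x' y z
    simp only [jac, map_add, LinearMap.add_apply]; abel
  have hs : ∀ (c : k) (x y z : LieE7 k), jac (c • x) y z = c • jac x y z := by
    intro c x y z
    simp only [jac, map_smul, LinearMap.smul_apply, smul_add]
  have hz : ∀ y z : LieE7 k, jac 0 y z = 0 := by
    intro y z
    simp [jac]
  induction x using ind with
  | h0 => exact hz _ _
  | ha x x' h h' => rw [hl, h, h', add_zero]
  | hs c i =>
    rw [hs, jac_cyc]
    induction y using ind with
    | h0 => rw [hz, smul_zero]
    | ha y y' h h' => rw [hl, smul_add, h, h', add_zero]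
    | hs d j =>
      rw [hs, jac_cyc]
      induction z using ind with
      | h0 => rw [hz, smul_zero, smul_zero]
      | ha z z' h h' => rw [hl, smul_add, smul_add, h, h', add_zero]
      | hs f l => rw [hs, jac_cyc, jac_bv, smul_zero, smul_zero, smul_zero]

noncomputable instance : LieRing (LieE7 k) where
  add_lie x y z := by simp [Bracket.bracket]
  lie_add x y z := by simp [Bracket.bracket]
  lie_self x := lieBr_self x
  leibniz_lie x y z := by
    have h := jac_eq_zero x y z
    rw [jac, lieBr_skew z x, lieBr_skew z, map_neg] at h
    change lieBr k x (lieBr k y z) = lieBr k (lieBr k x y) z + lieBr k y (lieBr k x z)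
    rw [← sub_eq_zero, ← h]
    abel

noncomputable instance : LieAlgebra k (LieE7 k) where
  lie_smul c x y := (lieBr k x).map_smul c y

theorem lie_evec_lie_evec (α : Root) (x : LieE7 k) :
    ∃ c : k, ⁅evec k α.1, ⁅evec k α.1, x⁆⁆ = c • evec k α.1 := by
  change ∃ c : k, lieBr k (evec k α.1) (lieBr k (evec k α.1) x) = c • evec k α.1
  induction x using ind with
  | h0 => exact ⟨0, by simp⟩
  | ha x y h h' =>
    obtain ⟨c, hc⟩ := h
    obtain ⟨d, hd⟩ := h'
    exact ⟨c + d, by rw [map_add, map_add, hc, hd, add_smul]⟩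
  | hs c i =>
    suffices h : ∃ d : k, lieBr k (evec k α.1) (lieBr k (evec k α.1) (bv k i)) =
        d • evec k α.1 by
      obtain ⟨d, hd⟩ := h
      exact ⟨c * d, by rw [map_smul, map_smul, hd, smul_smul]⟩
    rcases i with i | β
    · exact ⟨0, by rw [lieBr_evec_inl, map_neg, map_smul, lieBr_self, smul_zero, neg_zero,
        zero_smul]⟩
    · rw [← evec_root, lieBr_evec_evec α.2 β.2]
      split_ifs with h
      · exact ⟨2, by rw [map_neg, lieBr_evec_hvec, α.2, neg_neg]; simp⟩
      · have hge := ip_ge α.2 β.2 h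
        have hn := ip_add_self α.1 β.1
        rw [α.2, β.2] at hn
        have hn2 := ip_add_self α.1 (α.1 + β.1)
        rw [α.2, ip_add_right α.1 α.1 β.1, α.2] at hn2
        refine ⟨0, ?_⟩
        rw [map_smul]
        by_cases hr : ip (α.1 + β.1) (α.1 + β.1) = 2
        · have h0 : α.1 + (α.1 + β.1) ≠ 0 := by
            intro h'
            have hz : ip (α.1 + (α.1 + β.1)) (α.1 + (α.1 + β.1)) = 0 := by rw [h']; simp [ip]
            omega
          rw [lieBr_evec_evec α.2 hr, if_neg h0, evec_of_ne (v := α.1 + (α.1 + β.1)) (by omega)]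
          simp
        · rw [evec_of_ne hr]
          simp

/-- The linear map `exp (t ad e_α) = 1 + t ad e_α + (t² / 2) (ad e_α)²`; note `(ad e_α)³ = 0`. -/
noncomputable def rootMap (α : Root) (t : k) : LieE7 k →ₗ[k] LieE7 k :=
  LinearMap.id + t • lieBr k (evec k α.1) +
    (t ^ 2 / 2) • (lieBr k (evec k α.1) ∘ₗ lieBr k (evec k α.1))

theorem rootMap_apply (α : Root) (t : k) (x : LieE7 k) :
    rootMap α t x = x + t • ⁅evec k α.1, x⁆ + (t ^ 2 / 2) • ⁅evec k α.1, ⁅evec k α.1, x⁆⁆ := rfl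

theorem rootMap_neg (α : Root) (t : k) (h2 : (2 : k) ≠ 0) (x : LieE7 k) :
    rootMap α (-t) (rootMap α t x) = x := by
  obtain ⟨c, hc⟩ := lie_evec_lie_evec α x
  simp only [rootMap_apply, lie_add, lie_smul, hc, lie_self, smul_zero, add_zero]
  match_scalars <;> field_simp <;> ring

theorem rootMap_lie (α : Root) (t : k) (h2 : (2 : k) ≠ 0) (x y : LieE7 k) :
    rootMap α t ⁅x, y⁆ = ⁅rootMap α t x, rootMap α t y⁆ := by
  obtain ⟨c, hc⟩ := lie_evec_lie_evec α x
  obtain ⟨d, hd⟩ := lie_evec_lie_evec α y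
  have e1 : ⁅evec k α.1, ⁅x, y⁆⁆ = ⁅⁅evec k α.1, x⁆, y⁆ + ⁅x, ⁅evec k α.1, y⁆⁆ := leibniz_lie _ _ _
  have e2 : ⁅evec k α.1, ⁅evec k α.1, ⁅x, y⁆⁆⁆ = c • ⁅evec k α.1, y⁆ +
      (2 : k) • ⁅⁅evec k α.1, x⁆, ⁅evec k α.1, y⁆⁆ + d • ⁅x, evec k α.1⁆ := by
    rw [e1, lie_add, leibniz_lie (evec k α.1) ⁅evec k α.1, x⁆ y, leibniz_lie (evec k α.1) x, hc, hd,
      smul_lie, lie_smul]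
    module
  have e3 : ⁅⁅evec k α.1, x⁆, evec k α.1⁆ = -(c • evec k α.1) := by rw [← lie_skew, hc]
  rw [rootMap_apply, e2, e1]
  simp only [rootMap_apply, hc, hd, lie_add, add_lie, lie_smul, smul_lie, lie_self,
    smul_zero, e3]
  match_scalars <;> field_simp <;> ring

/-- The root element `x_α(t) = exp (t ad e_α)`, an automorphism of the Lie algebra (if `2 ≠ 0`). -/
noncomputable def rootElement (h2 : (2 : k) ≠ 0) (α : Root) (t : k) : LieE7 k ≃ₗ⁅k⁆ LieE7 k where
  __ := rootMap α t
  map_lie' := rootMap_lie α t h2 _ _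
  invFun := rootMap α (-t)
  left_inv := rootMap_neg α t h2
  right_inv x := by
    have := rootMap_neg α (-t) h2 x
    rwa [neg_neg] at this

end Algebra

section Cartan

open scoped TensorProduct

variable (k : Type*) [Field k]

/-- The truncated polynomial ring `O(2;1) = k[x₁, x₂] / (x₁³, x₂³)`. In characteristic `3` it is the
span of the divided powers `x₁^(a) x₂^(b)`, `0 ≤ a, b < 3`, where `xᵢ^(a) = xᵢ^a / a!`. -/
def TruncPoly : Type _ :=
  MvPolynomial (Fin 2) k ⧸
    Ideal.span (Set.range fun i : Fin 2 => (MvPolynomial.X i : MvPolynomial (Fin 2) k) ^ 3)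

noncomputable instance : CommRing (TruncPoly k) :=
  inferInstanceAs (CommRing (MvPolynomial (Fin 2) k ⧸
    Ideal.span (Set.range fun i : Fin 2 => (MvPolynomial.X i : MvPolynomial (Fin 2) k) ^ 3)))

noncomputable instance : Algebra k (TruncPoly k) :=
  inferInstanceAs (Algebra k (MvPolynomial (Fin 2) k ⧸
    Ideal.span (Set.range fun i : Fin 2 => (MvPolynomial.X i : MvPolynomial (Fin 2) k) ^ 3)))

/-- The quotient map `k[x₁, x₂] → O(2;1)`. -/
noncomputable def tmk : MvPolynomial (Fin 2) k →ₐ[k] TruncPoly k :=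
  Ideal.Quotient.mkₐ k
    (Ideal.span (Set.range fun i : Fin 2 => (MvPolynomial.X i : MvPolynomial (Fin 2) k) ^ 3))

theorem tmk_surjective : Function.Surjective (tmk k) := Ideal.Quotient.mkₐ_surjective k _

variable {k} in
theorem tmk_eq_zero {f : MvPolynomial (Fin 2) k} : tmk k f = 0 ↔
    f ∈ Ideal.span (Set.range fun i : Fin 2 => (MvPolynomial.X i : MvPolynomial (Fin 2) k) ^ 3) :=
  Ideal.Quotient.eq_zero_iff_mem

/-- The generators `xᵢ` of `O(2;1)`. -/
noncomputable def tx (i : Fin 2) : TruncPoly k := tmk k (MvPolynomial.X i)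

/-- The Witt algebra `W(2;1) = Der O(2;1)`; every element is `f₁ ∂₁ + f₂ ∂₂` with `fᵢ = D(xᵢ)`,
see `witt_apply`. -/
abbrev Witt : Type _ := Derivation k (TruncPoly k) (TruncPoly k)

/-- The Lie algebra `sl(2) ⊗ O(2;1)` with bracket `[f ⊗ x, g ⊗ y] = f g ⊗ [x, y]` (the factor
`O(2;1)` is written on the left). -/
abbrev SlTrunc : Type _ := TruncPoly k ⊗[k] LieAlgebra.SpecialLinear.sl (Fin 2) k

variable {k} in
/-- For a commutative algebra `A` and a Lie algebra `L`, the algebra `Der A` acts on `A ⊗ L` by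
derivations, `D (f ⊗ x) = D(f) ⊗ x`. -/
noncomputable def derAction (A L : Type*) [CommRing A] [Algebra k A] [LieRing L] [LieAlgebra k L] :
    Derivation k A A →ₗ⁅k⁆ LieDerivation k (A ⊗[k] L) (A ⊗[k] L) where
  toFun D :=
    { toLinearMap := LinearMap.rTensor L (D : A →ₗ[k] A)
      leibniz' := by
        intro a b
        induction a using TensorProduct.induction_on with
        | zero => simp only [map_zero, zero_lie, lie_zero, sub_zero]
        | add a a' h h' =>
          rw [add_lie, map_add, map_add, add_lie, lie_add, h, h']
          abel
        | tmul f x =>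
          induction b using TensorProduct.induction_on with
          | zero => simp only [map_zero, zero_lie, lie_zero, sub_zero]
          | add b b' h h' =>
            rw [lie_add, map_add, map_add, add_lie, lie_add, h, h']
            abel
          | tmul g y =>
            simp only [LieAlgebra.ExtendScalars.bracket_tmul, LinearMap.rTensor_tmul,
              Derivation.coeFn_coe, Derivation.leibniz, smul_eq_mul, TensorProduct.add_tmul]
            rw [← lie_skew x y, TensorProduct.tmul_neg, TensorProduct.tmul_neg]
            abel }
  map_add' D E := by
    ext a
    simp [LinearMap.rTensor_add]
  map_smul' c D := by
    ext a
    simp [LinearMap.rTensor_smul]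
  map_lie' {D E} := by
    ext a
    induction a using TensorProduct.induction_on with
    | zero => simp only [map_zero]
    | add a a' h h' => rw [map_add, map_add, h, h']
    | tmul f x => 
      change ⁅D, E⁆ f ⊗ₜ[k] x = D (E f) ⊗ₜ[k] x - E (D f) ⊗ₜ[k] x
      rw [Derivation.commutator_apply, TensorProduct.sub_tmul]

/-- The action of `1 ⊗ W(2;1)` on `sl(2) ⊗ O(2;1)`, `D (f ⊗ x) = D(f) ⊗ x`. -/
noncomputable def wittAction : Witt k →ₗ⁅k⁆ LieDerivation k (SlTrunc k) (SlTrunc k) :=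
  derAction (TruncPoly k) (LieAlgebra.SpecialLinear.sl (Fin 2) k)

/-- The semidirect product `(sl(2) ⊗ O(2;1)) ⋊ (1 ⊗ W(2;1))`. -/
abbrev SlTruncWitt : Type _ := LieAlgebra.SemiDirectSum (SlTrunc k) (Witt k) (wittAction k)

variable [CharP k 3]

variable {k} in
theorem pderiv_mem (i : Fin 2) (x : MvPolynomial (Fin 2) k) (hx : tmk k x = 0) :
    tmk k (MvPolynomial.pderiv i x) = 0 := by
  have h3 : ((3 : ℕ) : MvPolynomial (Fin 2) k) = 0 := by
    rw [← map_natCast (algebraMap k (MvPolynomial (Fin 2) k)), CharP.cast_eq_zero, map_zero]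
  rw [tmk_eq_zero] at hx ⊢
  induction hx using Submodule.span_induction with
  | mem x hx =>
    obtain ⟨j, rfl⟩ := hx
    simp only [Derivation.leibniz_pow, nsmul_eq_mul, h3, zero_mul, Submodule.zero_mem]
  | zero => simp
  | add x y _ _ hx hy => rw [map_add]; exact add_mem hx hy
  | smul a x hx' hx =>
    rw [smul_eq_mul, Derivation.leibniz, smul_eq_mul, smul_eq_mul]
    exact add_mem (Ideal.mul_mem_left _ _ hx) (Ideal.mul_mem_right _ _ hx')

/-- The partial derivatives `∂ᵢ` of `O(2;1)`. -/
noncomputable def pd (i : Fin 2) : Witt k :=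
  Derivation.liftOfSurjective (f := tmk k) (tmk_surjective k) (d := MvPolynomial.pderiv i)
    (pderiv_mem i)

variable {k}

theorem pd_mk (i : Fin 2) (f : MvPolynomial (Fin 2) k) :
    pd k i (tmk k f) = tmk k (MvPolynomial.pderiv i f) :=
  Derivation.liftOfSurjective_apply (f := tmk k) (tmk_surjective k) (pderiv_mem i) f

theorem pd_tx (i j : Fin 2) : pd k i (tx k j) = if i = j then 1 else 0 := by
  rw [tx, pd_mk, MvPolynomial.pderiv_X]
  by_cases h : i = j
  · simp [h]
  · rw [Pi.single_eq_of_ne (Ne.symm h), if_neg h, map_zero]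

theorem pd_comm (i j : Fin 2) (f : TruncPoly k) : pd k i (pd k j f) = pd k j (pd k i f) := by
  obtain ⟨f, rfl⟩ := tmk_surjective k f
  let d (l : Fin 2) : Derivation k (MvPolynomial (Fin 2) k) (MvPolynomial (Fin 2) k) :=
    MvPolynomial.pderiv l
  have h : ⁅d i, d j⁆ = 0 := by
    refine MvPolynomial.derivation_ext fun l => ?_
    have hc : ∀ a b : Fin 2, d a (d b (MvPolynomial.X l)) = 0 := by
      intro a b
      simp only [d, MvPolynomial.pderiv_X]
      by_cases h1 : l = b
      · simp [h1]
      · rw [Pi.single_eq_of_ne h1, map_zero]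
    rw [Derivation.commutator_apply, hc, hc, sub_zero, Derivation.zero_apply]
  have h' : tmk k (⁅d i, d j⁆ f) = 0 := by rw [h, Derivation.zero_apply, map_zero]
  rw [Derivation.commutator_apply, map_sub] at h'
  simp only [pd_mk]
  exact sub_eq_zero.1 h'

theorem witt_apply (D : Witt k) (f : TruncPoly k) :
    D f = D (tx k 0) * pd k 0 f + D (tx k 1) * pd k 1 f := by
  obtain ⟨f, rfl⟩ := tmk_surjective k f
  induction f using MvPolynomial.induction_on with
  | C a =>
    have : tmk k (MvPolynomial.C a) = algebraMap k _ a := (tmk k).commutes a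
    simp [this]
  | add f g hf hg =>
    simp only [map_add, hf, hg]
    ring
  | mul_X f i hf =>
    have hi : D (tx k i) = D (tx k 0) * pd k 0 (tx k i) + D (tx k 1) * pd k 1 (tx k i) := by
      fin_cases i <;> simp [pd_tx]
    rw [map_mul]
    change D (_ * tx k i) = _ * pd k 0 (_ * tx k i) + _ * pd k 1 (_ * tx k i)
    simp only [Derivation.leibniz, smul_eq_mul, hf]
    rw [hi]
    ring

/-- The index `i'` (interchanging `1` and `2`). -/
def conj (i : Fin 2) : Fin 2 := Fin.rev i

variable (k) in
/-- The sign `σ(1) = 1`, `σ(2) = -1`. -/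
def hsgn (i : Fin 2) : k := if i = 0 then 1 else -1

theorem ham_iff (D : Witt k) :
    (∀ i j : Fin 2, hsgn k (conj j) • pd k i (D (tx k (conj j))) =
      hsgn k (conj i) • pd k j (D (tx k (conj i)))) ↔
    pd k 0 (D (tx k 0)) + pd k 1 (D (tx k 1)) = 0 := by
  have r0 : conj 0 = 1 := rfl
  have r1 : conj 1 = 0 := rfl
  simp only [Fin.forall_fin_two, r0, r1, hsgn, one_ne_zero, if_true, if_false, one_smul, neg_smul,
    true_and, and_true]
  constructor
  · rintro ⟨h, -⟩
    rw [h]; ring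
  · intro h
    rw [eq_neg_of_add_eq_zero_left h]
    simp

theorem div_lie (D E : Witt k) :
    pd k 0 (⁅D, E⁆ (tx k 0)) + pd k 1 (⁅D, E⁆ (tx k 1)) =
      D (pd k 0 (E (tx k 0)) + pd k 1 (E (tx k 1))) -
        E (pd k 0 (D (tx k 0)) + pd k 1 (D (tx k 1))) := by
  have hD := witt_apply D
  have hE := witt_apply E
  have c0 : ⁅D, E⁆ (tx k 0) = D (E (tx k 0)) - E (D (tx k 0)) :=
    Derivation.commutator_apply _
  have c1 : ⁅D, E⁆ (tx k 1) = D (E (tx k 1)) - E (D (tx k 1)) :=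
    Derivation.commutator_apply _
  rw [c0, c1]
  generalize D (tx k 0) = d0 at *
  generalize D (tx k 1) = d1 at *
  generalize E (tx k 0) = e0 at *
  generalize E (tx k 1) = e1 at *
  simp only [hD, hE, map_add, map_sub, Derivation.leibniz, smul_eq_mul, pd_comm 1 0]
  ring

variable (k) in
/-- The Hamiltonian algebra `H(2;1)`: the `D = f₁ ∂₁ + f₂ ∂₂` in `W(2;1)` with
`σ(j') ∂ᵢ(f_{j'}) = σ(i') ∂ⱼ(f_{i'})` for all `i, j`. -/
noncomputable def ham : LieSubalgebra k (Witt k) where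
  carrier := {D | ∀ i j : Fin 2, hsgn k (conj j) • pd k i (D (tx k (conj j))) =
    hsgn k (conj i) • pd k j (D (tx k (conj i)))}
  add_mem' {D E} hD hE i j := by
    simp only [Derivation.add_apply, map_add, smul_add, hD i j, hE i j]
  zero_mem' i j := by simp
  smul_mem' c D hD i j := by
    simp only [Derivation.smul_apply, Derivation.map_smul, smul_comm _ c, hD i j]
  lie_mem' {D E} hD hE := by
    have hD' := (ham_iff D).1 hD
    have hE' := (ham_iff E).1 hE
    refine (ham_iff ⁅D, E⁆).2 ?_
    rw [div_lie, hD', hE', map_zero, map_zero, sub_zero]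

variable (k) in
/-- The degree derivation `x₁ ∂₁ + x₂ ∂₂`. -/
noncomputable def degDer : Witt k := tx k 0 • pd k 0 + tx k 1 • pd k 1

theorem mem_ham (D : Witt k) : D ∈ ham k ↔ pd k 0 (D (tx k 0)) + pd k 1 (D (tx k 1)) = 0 :=
  ham_iff D

theorem degDer_lie {E : Witt k} (hE : E ∈ ham k) : ⁅degDer k, E⁆ ∈ ham k := by
  rw [mem_ham] at hE ⊢
  rw [div_lie, hE]
  simp [degDer, pd_tx]

variable (k) in
/-- `CH(2;1)`, obtained from `H(2;1)` by adjoining the degree derivation. -/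
noncomputable def confHam : LieSubalgebra k (Witt k) where
  carrier := {D | ∃ E ∈ ham k, ∃ c : k, D = E + c • degDer k}
  add_mem' := by
    rintro _ _ ⟨E, hE, c, rfl⟩ ⟨F, hF, d, rfl⟩
    exact ⟨E + F, add_mem hE hF, c + d, by module⟩
  zero_mem' := ⟨0, zero_mem _, 0, by simp⟩
  smul_mem' := by
    rintro a _ ⟨E, hE, c, rfl⟩
    exact ⟨a • E, (ham k).smul_mem a hE, a * c, by module⟩
  lie_mem' := by
    rintro _ _ ⟨E, hE, c, rfl⟩ ⟨F, hF, d, rfl⟩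
    refine ⟨⁅E, F⁆ + c • ⁅degDer k, F⁆ - d • ⁅degDer k, E⁆, ?_, 0, ?_⟩
    · exact sub_mem (add_mem ((ham k).lie_mem hE hF) ((ham k).smul_mem c (degDer_lie hF)))
        ((ham k).smul_mem d (degDer_lie hE))
    · have h1 : ⁅E, d • degDer k⁆ = d • ⁅E, degDer k⁆ := lie_smul d E (degDer k)
      have h2 : ⁅c • degDer k, F⁆ = c • ⁅degDer k, F⁆ := smul_lie c (degDer k) F
      have h3 : ⁅c • degDer k, d • degDer k⁆ = 0 := by
        have h4 : ⁅c • degDer k, d • degDer k⁆ = d • ⁅c • degDer k, degDer k⁆ :=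
          lie_smul d (c • degDer k) (degDer k)
        rw [h4, smul_lie, lie_self, smul_zero, smul_zero]
      rw [add_lie, lie_add, lie_add, h1, h2, h3, ← lie_skew E (degDer k)]
      module

end Cartan

section Subalgebras

variable {k L : Type*} [Field k] [LieRing L] [LieAlgebra k L]

/-- The centraliser `{x | [x, e] = 0}` of an element `e`. -/
def elemCentralizer (e : L) : LieSubalgebra k L where
  carrier := {x | ⁅x, e⁆ = 0}
  add_mem' {x y} hx hy := by
    change ⁅x + y, e⁆ = 0
    rw [add_lie, hx, hy, add_zero]
  zero_mem' := zero_lie e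
  smul_mem' c x hx := by
    change ⁅c • x, e⁆ = 0
    rw [smul_lie, hx, smul_zero]
  lie_mem' {x y} hx hy := by
    change ⁅⁅x, y⁆, e⁆ = 0
    rw [lie_lie, hx, hy, lie_zero, lie_zero, sub_zero]

/-- The normaliser `{x | [x, e] ∈ k e}` of (the line spanned by) an element `e`. -/
def elemNormalizer (e : L) : LieSubalgebra k L where
  carrier := {x | ∃ c : k, ⁅x, e⁆ = c • e}
  add_mem' := by
    rintro x y ⟨c, hc⟩ ⟨d, hd⟩
    exact ⟨c + d, by rw [add_lie, hc, hd, add_smul]⟩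
  zero_mem' := ⟨0, by rw [zero_lie, zero_smul]⟩
  smul_mem' := by
    rintro a x ⟨c, hc⟩
    exact ⟨a * c, by rw [smul_lie, hc, smul_smul]⟩
  lie_mem' := by
    rintro x y ⟨c, hc⟩ ⟨d, hd⟩
    refine ⟨0, ?_⟩
    rw [lie_lie, hc, hd, lie_smul, lie_smul, hc, hd]
    module

/-- The solvable radical of a subalgebra `H`, as a subalgebra of the ambient Lie algebra. -/
def radicalOf (H : LieSubalgebra k L) : LieSubalgebra k L :=
  ((LieAlgebra.radical k H).toLieSubalgebra k H).map H.incl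

/-- A subalgebra `A`, as an ideal of its normaliser `N(A)`. -/
def idealOfNormalizer (A : LieSubalgebra k L) : LieIdeal k A.normalizer where
  carrier := {x | (x : L) ∈ A}
  add_mem' hx hy := A.add_mem hx hy
  zero_mem' := A.zero_mem
  smul_mem' c _ hx := A.smul_mem c hx
  lie_mem {x m} hm := (A.mem_normalizer_iff (x : L)).1 x.2 m hm

end Subalgebras

section Orbit

variable (k : Type*) [Field k] [CharP k 3]

theorem two_ne_zero_of_char_three : (2 : k) ≠ 0 := by
  have h : ((2 : ℕ) : k) ≠ 0 := by
    rw [Ne, CharP.cast_eq_zero_iff k 3]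
    decide
  exact_mod_cast h

/-- The group of automorphisms of the Lie algebra of type `E₇` generated by all root elements
`x_α(t) = exp (t ad e_α)`. For `k` algebraically closed this is the image `Ad(G)` of an algebraic
group `G` of type `E₇` in the adjoint representation. -/
noncomputable def adjointGroup : Subgroup (LieE7 k ≃ₗ[k] LieE7 k) :=
  Subgroup.closure (Set.range fun p : Root × k =>
    (rootElement (two_ne_zero_of_char_three k) p.1 p.2).toLinearEquiv)

/-- The representative `e_{α₁} + e_{α₂} + e_{α₃} + e_{α₅} + e_{α₆}` of the nilpotent orbit
`O(A₂² + A₁)`: it is regular in the Levi subalgebra with simple roots `α₁, α₃ | α₅, α₆ | α₂`. -/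
noncomputable def nilRep : LieE7 k :=
  evec k (simpleRoot 0) + evec k (simpleRoot 1) + evec k (simpleRoot 2) + evec k (simpleRoot 4) +
    evec k (simpleRoot 5)

/-- The nilpotent orbit `O(A₂² + A₁)` under the adjoint action. -/
noncomputable def nilOrbit : Set (LieE7 k) := {x | ∃ g ∈ adjointGroup k, x = g (nilRep k)}

variable {k}

/-- `A`, the radical of `n_e`. -/
noncomputable def radA (e : LieE7 k) : LieSubalgebra k (LieE7 k) := radicalOf (elemNormalizer e)

/-- `w = N_g(A)`. -/
noncomputable abbrev wE7 (e : LieE7 k) : LieSubalgebra k (LieE7 k) := (radA e).normalizer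

end Orbit

end ExcE7

/-! Write `O` for `O(2;1)` and `S` for the semidirect product of `sl(2) ⊗ O` with `W(2;1)`. Around
the representative `e` the whole of `g` is described by four explicit linear maps: `amap` on `O`,
`psi` and `U` on `S`, and `T` on `(sl(2) ⊗ O) × O`. The operator `[·, e]` sends `T (s, f)` to `U (s
+ H_f)` with `H_f` the Hamiltonian field of `f`, sends `U X` to `psi X`, sends `psi (s + D)` to
`amap (div D)`, and kills the image of `amap`. Moreover `e = amap 1`, the image `A` of `amap` is
abelian with `ker amap = k x₁² x₂²`, and `psi` is a homomorphism modulo `A` that normalises `A`. The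
structure `WittData` records this.

The sources have total dimension `45 + 9 + 45 + 27 + 9 = 135` and there are only two relations,
`amap (x₁² x₂²) = 0` and `T (0, 1) = 0`; since `dim g ≤ 133`, the maps span `g`
(`total_surjective`). Hence `[x, e] ∈ A` forces `x ∈ psi S + A`. As `e ∈ A`, this space is the
normaliser `w` of `A`, and `w / A ≅ S`. A divergence never involves `x₁² x₂²`, so `psi (s + D)`
centralises `e` exactly when `div D = 0`, and normalises the line `ke` exactly when `div D` is
constant. This yields `H(2;1)` and `CH(2;1)`; the ideal `I` is the part of `w` lying over `sl(2) ⊗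
O`.

Radicals and maximality rest on `inl_mem_of_stable`: a nonzero subspace of `S` stable under `sl(2) ⊗
O` and `H(2;1)` contains `sl(2) ⊗ O`. A radical larger than `A` would therefore contain lifts of `1
⊗ sl(2)` and could not be solvable. A subalgebra `M` larger than `w` contains some `U X` with `X ≠
0`; since `ad (psi Y)` commutes with `ad e` for `Y` over `H(2;1)`, the subspace `U⁻¹(M)` is stable,
so `M` contains `U (sl(2) ⊗ O)`, and this generates `g` together with `w`.

The four maps are given by tables of root vectors, and their identities are verified on bases in an
integer model of the Chevalley basis reduced modulo `3`. Automorphisms carry the data to every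
element of the orbit. -/

namespace ExcE7

open scoped TensorProduct

/-! ### The truncated polynomial ring: monomial basis and partial derivatives. -/

section TruncBasis

variable (k : Type*) [Field k]

/-- The monomial `x₁ ^ i x₂ ^ j` of `O(2;1)`. -/
noncomputable def tmon (i j : ℕ) : TruncPoly k := tx k 0 ^ i * tx k 1 ^ j

variable {k}

/-- The ideal is generated by monomials, so membership is decided monomial by monomial. -/
theorem tmk_eq_zero_iff_support {f : MvPolynomial (Fin 2) k} :
    tmk k f = 0 ↔ ∀ m ∈ f.support, ∃ i, 3 ≤ m i := by
  have h : (Set.range fun i : Fin 2 => (MvPolynomial.X i : MvPolynomial (Fin 2) k) ^ 3) =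
      (fun s => MvPolynomial.monomial s (1 : k)) '' Set.range fun i => Finsupp.single i 3 := by
    rw [← Set.range_comp]
    congr 1
    funext i
    simp [MvPolynomial.X_pow_eq_monomial]
  rw [tmk_eq_zero, h, MvPolynomial.mem_ideal_span_monomial_image]
  simp

theorem tx_pow_three (i : Fin 2) : tx k i ^ 3 = 0 := by
  rw [tx, ← map_pow, tmk_eq_zero]
  exact Ideal.subset_span ⟨i, rfl⟩

theorem tmon_eq_zero_left {i : ℕ} (h : 3 ≤ i) (j : ℕ) : tmon k i j = 0 := by
  rw [tmon, pow_eq_zero_of_le h (tx_pow_three 0), zero_mul]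

theorem tmon_eq_zero_right (i : ℕ) {j : ℕ} (h : 3 ≤ j) : tmon k i j = 0 := by
  rw [tmon, pow_eq_zero_of_le h (tx_pow_three 1), mul_zero]

theorem tmon_mul (i j p q : ℕ) : tmon k i j * tmon k p q = tmon k (i + p) (j + q) := by
  simp only [tmon]; ring

theorem tmon_zero : tmon k 0 0 = 1 := by simp [tmon]

/-- The exponent vector of `x₁ ^ i x₂ ^ j`. -/
noncomputable def expo (p : Fin 3 × Fin 3) : Fin 2 →₀ ℕ :=
  Finsupp.equivFunOnFinite.symm ![p.1, p.2]

theorem tmk_monomial (m : Fin 2 →₀ ℕ) (c : k) :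
    tmk k (MvPolynomial.monomial m c) = c • tmon k (m 0) (m 1) := by
  rw [MvPolynomial.monomial_eq, map_mul, Finsupp.prod_fintype _ _ (by simp)]
  simp only [Fin.prod_univ_two, map_mul, map_pow]
  rw [Algebra.smul_def]
  congr 1

theorem expo_injective : Function.Injective expo := by
  rintro ⟨i, j⟩ ⟨p, q⟩ h
  have h0 := DFunLike.congr_fun h 0
  have h1 := DFunLike.congr_fun h 1
  simp [expo] at h0 h1
  ext <;> simp [h0, h1]

theorem tmon_eq_tmk (p : Fin 3 × Fin 3) :
    tmon k p.1 p.2 = tmk k (MvPolynomial.monomial (expo p) 1) := by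
  rw [tmk_monomial]; simp [expo]

theorem linearIndependent_tmon :
    LinearIndependent k fun p : Fin 3 × Fin 3 => tmon k p.1 p.2 := by
  rw [Fintype.linearIndependent_iff]
  intro g hg p
  simp only [tmon_eq_tmk] at hg
  simp only [← map_smul, ← map_sum] at hg
  rw [tmk_eq_zero_iff_support] at hg
  by_contra hp
  obtain ⟨i, hi⟩ := hg (expo p) (by
    rw [MvPolynomial.mem_support_iff, MvPolynomial.coeff_sum, Finset.sum_eq_single p]
    · simpa using hp
    · intro q _ hq
      rw [MvPolynomial.coeff_monomial, if_neg fun h => hq (expo_injective h)]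
    · simp)
  have h1 := p.1.2
  have h2 := p.2.2
  fin_cases i <;> simp [expo] at hi <;> omega

theorem span_tmon :
    ⊤ ≤ Submodule.span k (Set.range fun p : Fin 3 × Fin 3 => tmon k p.1 p.2) := by
  rintro f -
  obtain ⟨f, rfl⟩ := tmk_surjective k f
  induction f using MvPolynomial.induction_on' with
  | monomial m c =>
    rw [tmk_monomial]
    refine Submodule.smul_mem _ _ ?_
    by_cases h0 : 3 ≤ m 0
    · rw [tmon_eq_zero_left h0]; exact zero_mem _
    by_cases h1 : 3 ≤ m 1
    · rw [tmon_eq_zero_right _ h1]; exact zero_mem _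
    exact Submodule.subset_span ⟨(⟨m 0, by omega⟩, ⟨m 1, by omega⟩), rfl⟩
  | add f g hf hg => rw [map_add]; exact add_mem hf hg

variable (k) in
/-- The monomial basis of `O(2;1)`. -/
noncomputable def tmonBasis : Module.Basis (Fin 3 × Fin 3) k (TruncPoly k) :=
  Module.Basis.mk linearIndependent_tmon span_tmon

theorem tmonBasis_apply (p : Fin 3 × Fin 3) : tmonBasis k p = tmon k p.1 p.2 := by
  simp [tmonBasis]

instance : FiniteDimensional k (TruncPoly k) := (tmonBasis k).finiteDimensional_of_finite

theorem finrank_truncPoly : Module.finrank k (TruncPoly k) = 9 := by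
  rw [Module.finrank_eq_card_basis (tmonBasis k)]; rfl

theorem finrank_span_tmon_top : Module.finrank k (Submodule.span k {tmon k 2 2}) = 1 := by
  refine finrank_span_singleton ?_
  have h : tmon k 2 2 = tmonBasis k (2, 2) := (tmonBasis_apply (2, 2)).symm
  rw [h]
  exact (tmonBasis k).ne_zero _

variable [CharP k 3]

theorem pd_tmon_zero (i j : ℕ) : pd k 0 (tmon k i j) = (i : k) • tmon k (i - 1) j := by
  simp [tmon, Derivation.leibniz, Derivation.leibniz_pow, pd_tx, ← Nat.cast_smul_eq_nsmul k, mul_comm]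

theorem pd_tmon_one (i j : ℕ) : pd k 1 (tmon k i j) = (j : k) • tmon k i (j - 1) := by
  simp [tmon, Derivation.leibniz, Derivation.leibniz_pow, pd_tx, ← Nat.cast_smul_eq_nsmul k]

/-- Differentiation lowers an exponent that is at most `2`, so the top monomial is never reached.
This matters because the top monomial spans the kernel of `amap`. -/
theorem coord_top_pd (c : Fin 2) (f : TruncPoly k) :
    (tmonBasis k).coord (2, 2) (pd k c f) = 0 := by
  have h : ((tmonBasis k).coord (2, 2)) ∘ₗ (pd k c : TruncPoly k →ₗ[k] TruncPoly k) = 0 := by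
    refine (tmonBasis k).ext fun p => ?_
    obtain ⟨i, j⟩ := p
    have hne : ∀ (a b : ℕ) (ha : a < 3) (hb : b < 3), (a ≠ 2 ∨ b ≠ 2) →
        (tmonBasis k).coord (2, 2) (tmon k a b) = 0 := by
      intro a b ha hb hab
      have := tmonBasis_apply (k := k) (⟨a, ha⟩, ⟨b, hb⟩)
      rw [← this]
      simp only [Module.Basis.coord_apply, Module.Basis.repr_self]
      rw [Finsupp.single_apply, if_neg]
      simp only [Prod.mk.injEq, Fin.ext_iff, not_and_or]
      exact hab
    rw [tmonBasis_apply, LinearMap.comp_apply]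
    have hi := i.2
    have hj := j.2
    fin_cases c
    · change (tmonBasis k).coord (2, 2) (pd k 0 (tmon k i j)) = 0
      rw [pd_tmon_zero, map_smul, hne _ _ (by omega) hj (Or.inl (by omega)), smul_zero]
    · change (tmonBasis k).coord (2, 2) (pd k 1 (tmon k i j)) = 0
      rw [pd_tmon_one, map_smul, hne _ _ hi (by omega) (Or.inr (by omega)), smul_zero]
  exact LinearMap.congr_fun h f

/-- Exponents stay below `3`, so the factors `1` and `2` produced by differentiation are invertible
and every nonconstant coefficient is detected. -/
theorem eq_smul_one_of_pd_eq_zero {f : TruncPoly k} (h0 : pd k 0 f = 0) (h1 : pd k 1 f = 0) :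
    ∃ c : k, f = c • 1 := by
  have e := (tmonBasis k).sum_repr f
  set c := (tmonBasis k).repr f
  have h2 : (2 : k) ≠ 0 := two_ne_zero_of_char_three k
  have li := Fintype.linearIndependent_iff.1 (linearIndependent_tmon (k := k))
  simp only [tmonBasis_apply, Fintype.sum_prod_type, Fin.sum_univ_three] at e
  rw [← e] at h0 h1
  simp only [map_add, Derivation.map_smul, pd_tmon_zero, pd_tmon_one] at h0 h1
  -- The coefficients of `∂₁ f`: those of `f` shifted by one in the first exponent and multiplied by
  -- that exponent.
  have z0 := li (fun p => match p with
    | (0, j) => c (1, j) | (1, j) => 2 * c (2, j) | (2, _) => 0) (by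
      rw [← h0]; simp [Fintype.sum_prod_type, Fin.sum_univ_three]; module)
  have z1 := li (fun p => match p with
    | (i, 0) => c (i, 1) | (i, 1) => 2 * c (i, 2) | (_, 2) => 0) (by
      rw [← h1]; simp [Fintype.sum_prod_type, Fin.sum_univ_three]; module)
  have a1 : ∀ j, c (1, j) = 0 := fun j => z0 (0, j)
  have a2 : ∀ j, c (2, j) = 0 := fun j => (mul_eq_zero.1 (z0 (1, j))).resolve_left h2
  have b1 : c (0, 1) = 0 := z1 (0, 0)
  have b2 : c (0, 2) = 0 := (mul_eq_zero.1 (z1 (0, 1))).resolve_left h2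
  refine ⟨c (0, 0), ?_⟩
  rw [← e]
  simp [a1, a2, b1, b2, tmon_zero]

theorem pd_pd_pd (c : Fin 2) (f : TruncPoly k) : pd k c (pd k c (pd k c f)) = 0 := by
  have h : (pd k c : TruncPoly k →ₗ[k] TruncPoly k) ∘ₗ (pd k c : TruncPoly k →ₗ[k] TruncPoly k) ∘ₗ
      (pd k c : TruncPoly k →ₗ[k] TruncPoly k) = 0 := by
    refine (tmonBasis k).ext fun p => ?_
    obtain ⟨i, j⟩ := p
    rw [tmonBasis_apply]
    fin_cases c
    · change pd k 0 (pd k 0 (pd k 0 (tmon k i j))) = 0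
      fin_cases i <;> simp [pd_tmon_zero]
    · change pd k 1 (pd k 1 (pd k 1 (tmon k i j))) = 0
      fin_cases j <;> simp [pd_tmon_one]
  exact LinearMap.congr_fun h f

/-- A nilpotent operator on a nonzero invariant subspace has a kernel; here the cube is already
zero. -/
theorem exists_ne_zero_pd_eq_zero (c : Fin 2) (P : Submodule k (TruncPoly k))
    (hP : ∀ f ∈ P, pd k c f ∈ P) {f : TruncPoly k} (hf : f ∈ P) (h0 : f ≠ 0) :
    ∃ g ∈ P, g ≠ 0 ∧ pd k c g = 0 := by
  by_cases h1 : pd k c f = 0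
  · exact ⟨f, hf, h0, h1⟩
  by_cases h2 : pd k c (pd k c f) = 0
  · exact ⟨_, hP _ hf, h1, h2⟩
  · exact ⟨_, hP _ (hP _ hf), h2, pd_pd_pd c f⟩

/-- Two commuting nilpotent operators have a common null vector in any nonzero stable subspace, and
the common null vectors of `∂₁`, `∂₂` are the constants. -/
theorem one_mem_of_pd_mem (P : Submodule k (TruncPoly k)) (hP : ∀ c, ∀ f ∈ P, pd k c f ∈ P)
    {f : TruncPoly k} (hf : f ∈ P) (h0 : f ≠ 0) : (1 : TruncPoly k) ∈ P := by
  obtain ⟨g, hg, hg0, hg1⟩ := exists_ne_zero_pd_eq_zero 0 P (hP 0) hf h0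
  obtain ⟨h, hh, hh0, hh1⟩ := exists_ne_zero_pd_eq_zero 1
    (P ⊓ LinearMap.ker (pd k 0 : TruncPoly k →ₗ[k] TruncPoly k)) (by
      rintro f ⟨hf, hf'⟩
      refine ⟨hP 1 f hf, ?_⟩
      have hf'' : pd k 0 f = 0 := hf'
      change pd k 0 (pd k 1 f) = 0
      rw [pd_comm, hf'', map_zero]) ⟨hg, hg1⟩ hg0
  obtain ⟨c, hc⟩ := eq_smul_one_of_pd_eq_zero hh.2 hh1
  have hc0 : c ≠ 0 := by
    rintro rfl
    exact hh0 (by rw [hc, zero_smul])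
  have := P.smul_mem c⁻¹ hh.1
  rwa [hc, smul_smul, inv_mul_cancel₀ hc0, one_smul] at this

end TruncBasis


/-! ### Structure constants of `sl(2)` and the dimension of `sl(2) ⊗ O(2;1)`. -/

section SlBasis

variable (k : Type*) [Field k]

/-- The standard basis `e`, `h`, `f` of `sl(2)`. -/
noncomputable def slBasis : Module.Basis (Fin 3) k (LieAlgebra.SpecialLinear.sl (Fin 2) k) :=
  Module.Basis.ofEquivFun
    { toFun := fun A => ![A.1 0 1, A.1 0 0, A.1 1 0]
      map_add' := fun A B => by
        funext i; fin_cases i <;> rfl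
      map_smul' := fun c A => by
        funext i; fin_cases i <;> rfl
      invFun := fun v => ⟨!![v 1, v 0; v 2, -v 1], by
        change Matrix.trace (!![v 1, v 0; v 2, -v 1] : Matrix (Fin 2) (Fin 2) k) = 0
        simp [Matrix.trace_fin_two]⟩
      left_inv := fun A => by
        have h : Matrix.trace A.1 = 0 := A.2
        rw [Matrix.trace_fin_two] at h
        ext i j
        fin_cases i <;> fin_cases j <;> simp
        linear_combination -h
      right_inv := fun v => by
        funext i; fin_cases i <;> rfl }

theorem slBasis_val (i : Fin 3) : (slBasis k i).1 =
    ![!![0, 1; 0, 0], !![1, 0; 0, -1], !![0, 0; 1, 0]] i := by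
  ext a b
  fin_cases i <;> fin_cases a <;> fin_cases b <;> simp [slBasis]

/-- The structure constant `c` in `[sᵢ, sⱼ] = c s_{i + j - 1}` for the basis `s = (e, h, f)`. -/
def slConst : ℕ → ℕ → ℤ
  | 0, 1 => -2
  | 1, 0 => 2
  | 0, 2 => 1
  | 2, 0 => -1
  | 1, 2 => -2
  | 2, 1 => 2
  | _, _ => 0

/-- `e`, `h`, `f` for the indices `0`, `1`, `2`. -/
noncomputable def slGen (i : ℕ) : LieAlgebra.SpecialLinear.sl (Fin 2) k :=
  if h : i < 3 then slBasis k ⟨i, h⟩ else 0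

/-- Index minus one grades `sl(2)`, which explains `i + j - 1`. The truncated subtraction at `i = j
= 0` and the index `3` at `i = j = 2` are harmless, as the constant is zero there. -/
theorem slGen_lie {i j : ℕ} (hi : i < 3) (hj : j < 3) :
    ⁅slGen k i, slGen k j⁆ = (slConst i j : k) • slGen k (i + j - 1) := by
  apply Subtype.ext
  rw [LieAlgebra.SpecialLinear.sl_bracket]
  interval_cases i <;> interval_cases j <;> ext a b <;> fin_cases a <;> fin_cases b <;>
    simp [slGen, slBasis_val, slConst] <;> norm_num

theorem finrank_slTrunc : Module.finrank k (SlTrunc k) = 27 := by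
  rw [Module.finrank_eq_card_basis ((tmonBasis k).tensorProduct (slBasis k))]; rfl

instance : FiniteDimensional k (SlTrunc k) :=
  ((tmonBasis k).tensorProduct (slBasis k)).finiteDimensional_of_finite

variable {k} in
theorem wittAction_tmul (D : Witt k) (f : TruncPoly k)
    (s : LieAlgebra.SpecialLinear.sl (Fin 2) k) : wittAction k D (f ⊗ₜ s) = D f ⊗ₜ s := rfl

end SlBasis

/-! ### A basis of the semidirect product with its multiplication table. -/

section Model

variable (k : Type*) [Field k] [CharP k 3]

/-- The basis elements of `(sl(2) ⊗ O(2;1)) ⋊ W(2;1)`: `x₁ ^ i x₂ ^ j ⊗ s` with `s = e, h, f` for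
`g = 0, 1, 2`, and `x₁ ^ i x₂ ^ j ∂` with `∂ = ∂₁, ∂₂` for `g = 3, 4`. -/
noncomputable def el (g i j : ℕ) : SlTruncWitt k :=
  if g < 3 then ⟨tmon k i j ⊗ₜ slGen k g, 0⟩
  else if g = 3 then ⟨0, tmon k i j • pd k 0⟩ else ⟨0, tmon k i j • pd k 1⟩

/-- Derivations of `O(2;1)` are determined by the images of the generators. -/
noncomputable def wittEquiv : Witt k ≃ₗ[k] (Fin 2 → TruncPoly k) where
  toFun D c := D (tx k c)
  map_add' _ _ := rfl
  map_smul' _ _ := rfl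
  invFun v := v 0 • pd k 0 + v 1 • pd k 1
  left_inv D := by
    ext f
    simp only [Derivation.add_apply, Derivation.smul_apply, smul_eq_mul]
    exact (witt_apply D f).symm
  right_inv v := by
    funext c
    fin_cases c <;> simp [pd_tx]

/-- The basis `el` of `(sl(2) ⊗ O(2;1)) ⋊ W(2;1)`. -/
noncomputable def elBasis : Module.Basis (Fin 5 × Fin 3 × Fin 3) k (SlTruncWitt k) :=
  (((((slBasis k).tensorProduct (tmonBasis k)).map (TensorProduct.comm k _ _)).prod
    ((Pi.basis fun _ : Fin 2 => tmonBasis k).map (wittEquiv k).symm)).map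
      (LieAlgebra.SemiDirectSum.toProdl (R := k) (wittAction k)).symm).reindex
    (((Equiv.refl (Fin 3 × (Fin 3 × Fin 3))).sumCongr
      (Equiv.sigmaEquivProd (Fin 2) (Fin 3 × Fin 3))).trans
    ((Equiv.sumProdDistrib (Fin 3) (Fin 2) (Fin 3 × Fin 3)).symm.trans
      ((finSumFinEquiv (m := 3) (n := 2)).prodCongr (Equiv.refl (Fin 3 × Fin 3)))))

theorem elBasis_apply (p : Fin 5 × Fin 3 × Fin 3) :
    elBasis k p = el k p.1 p.2.1 p.2.2 := by
  obtain ⟨g, m⟩ := p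
  obtain ⟨g, rfl⟩ := (finSumFinEquiv (m := 3) (n := 2)).surjective g
  rcases g with g | g
  · have : elBasis k (finSumFinEquiv (m := 3) (n := 2) (Sum.inl g), m) =
        (LieAlgebra.SemiDirectSum.toProdl (R := k) (wittAction k)).symm
          (tmonBasis k m ⊗ₜ slBasis k g, 0) := by
      simp [elBasis]
    have hg : (finSumFinEquiv (m := 3) (n := 2) (Sum.inl g)).val = g.val := rfl
    rw [this, tmonBasis_apply]
    simp only [el, slGen, hg, g.2, if_true, dif_pos]
    rfl
  · have : elBasis k (finSumFinEquiv (m := 3) (n := 2) (Sum.inr g), m) =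
        (LieAlgebra.SemiDirectSum.toProdl (R := k) (wittAction k)).symm
          (0, (wittEquiv k).symm (Pi.single g (tmonBasis k m))) := by
      simp [elBasis]
    rw [this, tmonBasis_apply]
    fin_cases g <;> simp [el, wittEquiv] <;> rfl

instance : FiniteDimensional k (SlTruncWitt k) := (elBasis k).finiteDimensional_of_finite

theorem finrank_slTruncWitt : Module.finrank k (SlTruncWitt k) = 45 := by
  rw [Module.finrank_eq_card_basis (elBasis k)]; rfl

variable {k}

theorem el_eq_zero {i j : ℕ} (g : ℕ) (h : 3 ≤ i ∨ 3 ≤ j) : el k g i j = 0 := by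
  have : tmon k i j = 0 := h.elim (fun h => tmon_eq_zero_left h _) (tmon_eq_zero_right _)
  simp [el, this]

/-- The effect of `∂₁` (for `c = 3`) or `∂₂` (for `c = 4`), multiplied by `x₁ ^ i x₂ ^ j`, on
`x₁ ^ p x₂ ^ q`: a coefficient and the exponents. -/
def monDer (c i j p q : ℕ) : ℤ × ℕ × ℕ :=
  if c = 3 then (p, i + p - 1, j + q) else (q, i + p, j + q - 1)

/-- The bracket `[el g i j, el h p q]`, as a list of coefficients and basis elements. -/
def elBr (g i j h p q : ℕ) : List (ℤ × ℕ × ℕ × ℕ) :=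
  (if g < 3 then if h < 3 then [(slConst g h, g + h - 1, i + p, j + q)] else [] else
    [((monDer g i j p q).1, h, (monDer g i j p q).2)]) ++
  (if h < 3 then [] else [(-(monDer h p q i j).1, g, (monDer h p q i j).2)])

/-- The truncated exponent `i + p - 1` is wrong only for `i = p = 0`, where the coefficient `p`
vanishes. -/
theorem tmon_mul_pd_zero (i j p q : ℕ) :
    tmon k i j * pd k 0 (tmon k p q) = (p : k) • tmon k (i + p - 1) (j + q) := by
  rcases p with _ | p
  · simp [pd_tmon_zero]
  · rw [pd_tmon_zero, mul_smul_comm, tmon_mul]; rfl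

theorem tmon_mul_pd_one (i j p q : ℕ) :
    tmon k i j * pd k 1 (tmon k p q) = (q : k) • tmon k (i + p) (j + q - 1) := by
  rcases q with _ | q
  · simp [pd_tmon_one]
  · rw [pd_tmon_one, mul_smul_comm, tmon_mul]; rfl

theorem smul_pd_lie (f g : TruncPoly k) (c d : Fin 2) :
    ⁅f • pd k c, g • pd k d⁆ = (f * pd k c g) • pd k d - (g * pd k d f) • pd k c := by
  ext h
  rw [Derivation.commutator_apply]
  simp only [Derivation.smul_apply, Derivation.sub_apply, smul_eq_mul, Derivation.leibniz,
    pd_comm d c]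
  ring

theorem el_lt {g : ℕ} (hg : g < 3) (i j : ℕ) : el k g i j = ⟨tmon k i j ⊗ₜ slGen k g, 0⟩ :=
  if_pos hg

theorem el_three (i j : ℕ) : el k 3 i j = ⟨0, tmon k i j • pd k 0⟩ := rfl

theorem el_four (i j : ℕ) : el k 4 i j = ⟨0, tmon k i j • pd k 1⟩ := rfl

theorem el_lie_lt_lt {g h : ℕ} (hg : g < 3) (hh : h < 3) (i j p q : ℕ) :
    ⁅el k g i j, el k h p q⁆ = (slConst g h : k) • el k (g + h - 1) (i + p) (j + q) := by
  rw [el_lt hg, el_lt hh, LieAlgebra.SemiDirectSum.lie_eq_mk]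
  by_cases h3 : g + h - 1 < 3
  · rw [el_lt h3, LieAlgebra.SemiDirectSum.smul_eq_mk]
    simp [LieAlgebra.ExtendScalars.bracket_tmul, slGen_lie k hg hh, tmon_mul]
  -- The index `3` would denote a derivation in `el`; it arises only from `[f, f]`, whose constant
  -- is zero.
  · have h0 : slConst g h = 0 := by
      have h2 : g = 2 ∧ h = 2 := by omega
      rw [h2.1, h2.2]; rfl
    simp [LieAlgebra.ExtendScalars.bracket_tmul, slGen_lie k hg hh, h0]

theorem el_lie_ge_lt {g h : ℕ} (hg : 3 ≤ g) (hg' : g < 5) (hh : h < 3) (i j p q : ℕ) :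
    ⁅el k g i j, el k h p q⁆ =
      ((monDer g i j p q).1 : k) • el k h (monDer g i j p q).2.1 (monDer g i j p q).2.2 := by
  rw [el_lt hh, el_lt hh]
  interval_cases g
  · rw [el_three, LieAlgebra.SemiDirectSum.lie_eq_mk, LieAlgebra.SemiDirectSum.smul_eq_mk]
    simp [wittAction_tmul, tmon_mul_pd_zero, monDer, TensorProduct.smul_tmul']
  · rw [el_four, LieAlgebra.SemiDirectSum.lie_eq_mk, LieAlgebra.SemiDirectSum.smul_eq_mk]
    simp [wittAction_tmul, tmon_mul_pd_one, monDer, TensorProduct.smul_tmul']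

theorem el_lie_ge_ge {g h : ℕ} (hg : 3 ≤ g) (hg' : g < 5) (hh : 3 ≤ h) (hh' : h < 5)
    (i j p q : ℕ) : ⁅el k g i j, el k h p q⁆ =
      ((monDer g i j p q).1 : k) • el k h (monDer g i j p q).2.1 (monDer g i j p q).2.2 -
      ((monDer h p q i j).1 : k) • el k g (monDer h p q i j).2.1 (monDer h p q i j).2.2 := by
  interval_cases g <;> interval_cases h <;> simp only [el_three, el_four] <;>
    rw [LieAlgebra.SemiDirectSum.lie_eq_mk, LieAlgebra.SemiDirectSum.smul_eq_mk,
      LieAlgebra.SemiDirectSum.smul_eq_mk, LieAlgebra.SemiDirectSum.sub_eq_mk] <;>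
    rw [smul_pd_lie] <;>
    simp [tmon_mul_pd_zero, tmon_mul_pd_one, monDer, smul_assoc]

theorem el_lie {g h : ℕ} (hg : g < 5) (hh : h < 5) (i j p q : ℕ) :
    ⁅el k g i j, el k h p q⁆ =
      ((elBr g i j h p q).map fun t => (t.1 : k) • el k t.2.1 t.2.2.1 t.2.2.2).sum := by
  by_cases g3 : g < 3 <;> by_cases h3 : h < 3
  · rw [el_lie_lt_lt g3 h3]
    simp [elBr, g3, h3]
  · rw [← lie_skew, el_lie_ge_lt (by omega) hh g3]
    simp [elBr, g3, h3]
  · rw [el_lie_ge_lt (by omega) hg h3]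
    simp [elBr, g3, h3]
  · rw [el_lie_ge_ge (by omega) hg (by omega) hh]
    simp [elBr, g3, h3, sub_eq_add_neg]

end Model


/-! ### Stable subspaces of the semidirect product, and the divergence. -/

section Ideals

theorem extendScalars_lie_add {R A L : Type*} [CommRing R] [CommRing A] [Algebra R A] [LieRing L]
    [LieAlgebra R L] (x y z : A ⊗[R] L) : ⁅x, y + z⁆ = ⁅x, y⁆ + ⁅x, z⁆ := lie_add x y z

theorem extendScalars_lie_zero {R A L : Type*} [CommRing R] [CommRing A] [Algebra R A] [LieRing L]
    [LieAlgebra R L] (x : A ⊗[R] L) : ⁅x, (0 : A ⊗[R] L)⁆ = 0 := lie_zero x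

variable {k : Type*} [Field k]

/-- By base change, `e`, `h`, `f` form a basis of `sl(2) ⊗ O(2;1)` over `O(2;1)`; `tmul_eq_zero` is
the matching independence. -/
theorem exists_eq_tmul (s : SlTrunc k) : ∃ p q r : TruncPoly k,
    s = p ⊗ₜ slGen k 0 + q ⊗ₜ slGen k 1 + r ⊗ₜ slGen k 2 := by
  let B := Algebra.TensorProduct.basis (TruncPoly k) (slBasis k)
  refine ⟨B.repr s 0, B.repr s 1, B.repr s 2, ?_⟩
  conv_lhs => rw [← B.sum_repr s]
  simp only [Fin.sum_univ_three, B, Algebra.TensorProduct.basis_apply, TensorProduct.smul_tmul',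
    smul_eq_mul, mul_one]
  rfl

theorem tmul_eq_zero {p q r : TruncPoly k}
    (h : p ⊗ₜ[k] slGen k 0 + q ⊗ₜ slGen k 1 + r ⊗ₜ slGen k 2 = 0) : p = 0 ∧ q = 0 ∧ r = 0 := by
  let B := Algebra.TensorProduct.basis (TruncPoly k) (slBasis k)
  have li := Fintype.linearIndependent_iff.1 B.linearIndependent ![p, q, r] (by
    rw [← h]
    simp only [Fin.sum_univ_three, B, Algebra.TensorProduct.basis_apply, TensorProduct.smul_tmul',
      smul_eq_mul]
    simp [slGen])
  exact ⟨li 0, li 1, li 2⟩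

theorem tmul_slGen_lie (f : TruncPoly k) {a : ℕ} (ha : a < 3) (p q r : TruncPoly k) :
    ⁅f ⊗ₜ[k] slGen k a, p ⊗ₜ[k] slGen k 0 + q ⊗ₜ slGen k 1 + r ⊗ₜ slGen k 2⁆ =
      (slConst a 0 : k) • (f * p) ⊗ₜ[k] slGen k (a + 0 - 1) +
      (slConst a 1 : k) • (f * q) ⊗ₜ[k] slGen k (a + 1 - 1) +
      (slConst a 2 : k) • (f * r) ⊗ₜ[k] slGen k (a + 2 - 1) := by
  simp only [extendScalars_lie_add, LieAlgebra.ExtendScalars.bracket_tmul, slGen_lie k ha (show 0 < 3 by omega),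
    slGen_lie k ha (show 1 < 3 by omega), slGen_lie k ha (show 2 < 3 by omega),
    TensorProduct.tmul_smul]

theorem inl_lie (s : SlTrunc k) (X : SlTruncWitt k) :
    ⁅(⟨s, 0⟩ : SlTruncWitt k), X⁆ = ⟨⁅s, X.left⁆ - wittAction k X.right s, 0⟩ := by
  rw [LieAlgebra.SemiDirectSum.lie_eq_mk]
  simp

theorem inr_lie_inl (D : Witt k) (s : SlTrunc k) :
    ⁅(⟨0, D⟩ : SlTruncWitt k), (⟨s, 0⟩ : SlTruncWitt k)⁆ = ⟨wittAction k D s, 0⟩ := by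
  rw [LieAlgebra.SemiDirectSum.lie_eq_mk]
  simp

variable [CharP k 3]

/-- Bracketing `1 ⊗ e` with `g ⊗ f` gives `g ⊗ h` up to sign, and bracketing `1 ⊗ h` with `g ⊗ e`
and `g ⊗ f` gives the rest, since `2` is invertible. -/
theorem inl_mem_of_tmul_mem {K : Submodule k (SlTruncWitt k)}
    (hK : ∀ s : SlTrunc k, ∀ X ∈ K, ⁅(⟨s, 0⟩ : SlTruncWitt k), X⁆ ∈ K)
    (h1 : (⟨1 ⊗ₜ slGen k 0, 0⟩ : SlTruncWitt k) ∈ K) (s : SlTrunc k) :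
    (⟨s, 0⟩ : SlTruncWitt k) ∈ K := by
  have h2 : (2 : k) ≠ 0 := two_ne_zero_of_char_three k
  have smem : ∀ {c : k} {t : SlTrunc k}, c ≠ 0 → (⟨c • t, 0⟩ : SlTruncWitt k) ∈ K →
      (⟨t, 0⟩ : SlTruncWitt k) ∈ K := by
    intro c t hc ht
    have := K.smul_mem c⁻¹ ht
    rwa [LieAlgebra.SemiDirectSum.smul_eq_mk, smul_smul, inv_mul_cancel₀ hc, one_smul,
      smul_zero] at this
  have step : ∀ (g : TruncPoly k) {a b : ℕ}, a < 3 → b < 3 → (slConst a b : k) ≠ 0 →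
      (⟨1 ⊗ₜ slGen k b, 0⟩ : SlTruncWitt k) ∈ K →
      (⟨g ⊗ₜ slGen k (a + b - 1), 0⟩ : SlTruncWitt k) ∈ K := by
    intro g a b ha hb hc h
    have := hK (g ⊗ₜ slGen k a) _ h
    rw [inl_lie, LieAlgebra.ExtendScalars.bracket_tmul, slGen_lie k ha hb, mul_one,
      TensorProduct.tmul_smul] at this
    simp only [map_zero, LieDerivation.coe_zero, Pi.zero_apply, sub_zero] at this
    exact smem hc this
  have hh : ∀ g : TruncPoly k, (⟨g ⊗ₜ slGen k 1, 0⟩ : SlTruncWitt k) ∈ K := fun g =>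
    step g (a := 2) (b := 0) (by omega) (by omega) (by simp [slConst]) h1
  have he : ∀ g : TruncPoly k, (⟨g ⊗ₜ slGen k 0, 0⟩ : SlTruncWitt k) ∈ K := fun g =>
    step g (a := 0) (b := 1) (by omega) (by omega) (by simpa [slConst] using h2) (hh 1)
  have hf : ∀ g : TruncPoly k, (⟨g ⊗ₜ slGen k 2, 0⟩ : SlTruncWitt k) ∈ K := fun g =>
    step g (a := 2) (b := 1) (by omega) (by omega) (by simpa [slConst] using h2) (hh 1)
  obtain ⟨p, q, r, rfl⟩ := exists_eq_tmul s
  have := K.add_mem (K.add_mem (he p) (hh q)) (hf r)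
  simpa using this

theorem pd_mem_ham (c : Fin 2) : pd k c ∈ ham k := by
  rw [mem_ham]
  fin_cases c <;> simp [pd_tx]

/-- Brackets with the ideal `sl(2) ⊗ O(2;1)` land in that ideal, and the ideal has trivial
centraliser, so some bracket with a given nonzero `X` is nonzero. -/
theorem exists_inl_mem {K : Submodule k (SlTruncWitt k)}
    (hK : ∀ s : SlTrunc k, ∀ X ∈ K, ⁅(⟨s, 0⟩ : SlTruncWitt k), X⁆ ∈ K) (hne : K ≠ ⊥) :
    ∃ s ≠ 0, (⟨s, 0⟩ : SlTruncWitt k) ∈ K := by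
  have h2 : (2 : k) ≠ 0 := two_ne_zero_of_char_three k
  obtain ⟨X, hX, h0⟩ := Submodule.exists_mem_ne_zero_of_ne_bot hne
  by_contra! hcon
  have key : ∀ s : SlTrunc k, ⁅s, X.left⁆ - wittAction k X.right s = 0 := by
    intro s
    have h := hK s X hX
    rw [inl_lie] at h
    by_contra h'
    exact hcon _ h' h
  apply h0
  have hl : X.left = 0 := by
    obtain ⟨p, q, r, hs⟩ := exists_eq_tmul X.left
    -- Derivations kill `1`, so testing against `1 ⊗ e` and `1 ⊗ f` isolates the `sl(2)` component
    -- of `X`.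
    have k0 := key (1 ⊗ₜ slGen k 0)
    have k2 := key (1 ⊗ₜ slGen k 2)
    rw [wittAction_tmul, Derivation.map_one_eq_zero, TensorProduct.zero_tmul, sub_zero, hs,
      tmul_slGen_lie _ (by omega)] at k0 k2
    have z0 := tmul_eq_zero (p := (-2 : k) • q) (q := r) (r := 0) (by
      rw [← k0]
      simp [slConst, TensorProduct.smul_tmul'])
    have z2 := tmul_eq_zero (p := 0) (q := -p) (r := (2 : k) • q) (by
      rw [← k2]
      simp [slConst, TensorProduct.smul_tmul', TensorProduct.neg_tmul])
    have hp : p = 0 := neg_eq_zero.1 z2.2.1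
    have hq : q = 0 := (smul_eq_zero.1 z2.2.2).resolve_left h2
    rw [hs, hp, hq, z0.2.1]
    simp
  have hr : X.right = 0 := by
    ext f
    have := key (f ⊗ₜ slGen k 0)
    rw [hl, extendScalars_lie_zero, zero_sub, neg_eq_zero, wittAction_tmul] at this
    exact (tmul_eq_zero (p := X.right f) (q := 0) (r := 0) (by simpa using this)).1
  exact LieAlgebra.SemiDirectSum.ext hl hr

/-- A nonzero subspace of `(sl(2) ⊗ O(2;1)) ⋊ W(2;1)` that is stable under `sl(2) ⊗ O(2;1)` and
`H(2;1)` contains `sl(2) ⊗ O(2;1)`. -/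
theorem inl_mem_of_stable {K : Submodule k (SlTruncWitt k)}
    (hK : ∀ Y : SlTruncWitt k, Y.right ∈ ham k → ∀ X ∈ K, ⁅Y, X⁆ ∈ K) (hne : K ≠ ⊥)
    (s : SlTrunc k) : (⟨s, 0⟩ : SlTruncWitt k) ∈ K := by
  have h2 : (2 : k) ≠ 0 := two_ne_zero_of_char_three k
  have hS : ∀ s : SlTrunc k, ∀ X ∈ K, ⁅(⟨s, 0⟩ : SlTruncWitt k), X⁆ ∈ K :=
    fun s => hK ⟨s, 0⟩ (zero_mem _)
  refine inl_mem_of_tmul_mem hS ?_ s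
  -- The coefficients `p` with `p ⊗ e` in `K`. Both `∂₁` and `∂₂` have divergence zero and preserve
  -- `P`, so `P` contains `1` as soon as it is nonzero.
  let P : Submodule k (TruncPoly k) :=
    { carrier := {p | (⟨p ⊗ₜ slGen k 0, 0⟩ : SlTruncWitt k) ∈ K}
      add_mem' := fun {a b} ha hb => by
        have := K.add_mem ha hb
        simpa [TensorProduct.add_tmul] using this
      zero_mem' := by
        have := K.zero_mem
        simpa using this
      smul_mem' := fun c a ha => by
        have := K.smul_mem c ha
        simpa [TensorProduct.smul_tmul'] using this }
  have hP : ∀ c, ∀ f ∈ P, pd k c f ∈ P := by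
    intro c f hf
    have := hK ⟨0, pd k c⟩ (pd_mem_ham c) _ hf
    rw [inr_lie_inl, wittAction_tmul] at this
    exact this
  suffices h : ∃ f ∈ P, f ≠ 0 by
    obtain ⟨f, hf, h0⟩ := h
    exact one_mem_of_pd_mem P hP hf h0
  obtain ⟨t, ht0, ht⟩ := exists_inl_mem hS hne
  have hE : ∀ {t : SlTrunc k}, (⟨t, 0⟩ : SlTruncWitt k) ∈ K →
      (⟨⁅(1 : TruncPoly k) ⊗ₜ[k] slGen k 0, t⁆, 0⟩ : SlTruncWitt k) ∈ K := by
    intro t ht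
    have := hS (1 ⊗ₜ slGen k 0) _ ht
    rwa [inl_lie, map_zero, LieDerivation.coe_zero, Pi.zero_apply, sub_zero] at this
  obtain ⟨p, q, r, rfl⟩ := exists_eq_tmul t
  have e1 : ∀ p q r : TruncPoly k, ⁅(1 : TruncPoly k) ⊗ₜ[k] slGen k 0,
      p ⊗ₜ[k] slGen k 0 + q ⊗ₜ slGen k 1 + r ⊗ₜ slGen k 2⁆ =
      ((-2 : k) • q) ⊗ₜ[k] slGen k 0 + r ⊗ₜ slGen k 1 + 0 ⊗ₜ slGen k 2 := by
    intro p q r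
    rw [tmul_slGen_lie _ (by omega)]
    simp [slConst, TensorProduct.smul_tmul']
  -- Applying `ad (1 ⊗ e)` zero, one or two times leaves a nonzero coefficient at `e` alone: `p`,
  -- `-2q` or `-2r`, according to the last nonzero coefficient.
  by_cases hr : r = 0
  · by_cases hq : q = 0
    · refine ⟨p, ?_, ?_⟩
      · simpa [hr, hq, P] using ht
      · rintro rfl
        simp [hr, hq] at ht0
    · have := hE ht
      rw [e1, hr] at this
      refine ⟨(-2 : k) • q, ?_, smul_ne_zero (neg_ne_zero.2 h2) hq⟩
      change (⟨_, _⟩ : SlTruncWitt k) ∈ K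
      simpa only [TensorProduct.zero_tmul, add_zero] using this
  · have := hE (hE ht)
    rw [e1, e1] at this
    refine ⟨(-2 : k) • r, ?_, smul_ne_zero (neg_ne_zero.2 h2) hr⟩
    change (⟨_, _⟩ : SlTruncWitt k) ∈ K
    simpa only [TensorProduct.zero_tmul, add_zero] using this

variable (k) in
/-- The divergence `f₁ ∂₁ + f₂ ∂₂ ↦ ∂₁(f₁) + ∂₂(f₂)`. -/
noncomputable def divergence : Witt k →ₗ[k] TruncPoly k where
  toFun D := pd k 0 (D (tx k 0)) + pd k 1 (D (tx k 1))
  map_add' D E := by simp only [Derivation.add_apply, map_add]; abel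
  map_smul' c D := by simp only [Derivation.smul_apply, Derivation.map_smul, smul_add]; rfl

theorem mem_ham_iff_divergence (D : Witt k) : D ∈ ham k ↔ divergence k D = 0 := mem_ham D

theorem divergence_degDer : divergence k (degDer k) = (2 : k) • 1 := by
  simp [divergence, degDer, pd_tx, two_smul, one_add_one_eq_two]

/-- The degree derivation has divergence `2`, which is invertible, so a constant divergence can be
removed by subtracting a multiple of it. -/
theorem mem_confHam_iff_divergence (D : Witt k) :
    D ∈ confHam k ↔ ∃ c : k, divergence k D = c • 1 := by
  have h2 : (2 : k) ≠ 0 := two_ne_zero_of_char_three k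
  constructor
  · rintro ⟨E, hE, c, rfl⟩
    rw [mem_ham_iff_divergence] at hE
    exact ⟨c * 2, by rw [map_add, map_smul, hE, zero_add, divergence_degDer, smul_smul]⟩
  · rintro ⟨c, hc⟩
    refine ⟨D - (c / 2) • degDer k, ?_, c / 2, by abel⟩
    rw [mem_ham_iff_divergence, map_sub, map_smul, hc, divergence_degDer, smul_smul,
      div_mul_cancel₀ _ h2, sub_self]

/-- Ensures that composing the divergence with `amap`, whose kernel is this line, does not enlarge
the kernel. -/
theorem divergence_eq_zero_of_mem_span {D : Witt k}
    (h : divergence k D ∈ Submodule.span k {tmon k 2 2}) : divergence k D = 0 := by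
  obtain ⟨c, hc⟩ := Submodule.mem_span_singleton.1 h
  have h1 : (tmonBasis k).coord (2, 2) (divergence k D) = 0 := by
    change (tmonBasis k).coord (2, 2) (pd k 0 (D (tx k 0)) + pd k 1 (D (tx k 1))) = 0
    rw [map_add, coord_top_pd, coord_top_pd, add_zero]
  have h3 : tmon k 2 2 = tmonBasis k (2, 2) := (tmonBasis_apply (2, 2)).symm
  rw [← hc, map_smul, h3, Module.Basis.coord_apply, Module.Basis.repr_self,
    Finsupp.single_eq_same, smul_eq_mul, mul_one] at h1
  rw [← hc, h1, zero_smul]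

end Ideals


/-! ### The abstract data around `e`, and the normaliser of `A`. -/

section WittData

variable (k : Type*) {L : Type*} [Field k] [CharP k 3]

/-- The Hamiltonian vector field `∂₂(f) ∂₁ - ∂₁(f) ∂₂` of `f`. -/
noncomputable def hamField : TruncPoly k →ₗ[k] Witt k where
  toFun f := pd k 1 f • pd k 0 - pd k 0 f • pd k 1
  map_add' f g := by simp only [map_add, add_smul]; abel
  map_smul' c f := by
    simp only [Derivation.map_smul, smul_assoc, smul_sub, RingHom.id_apply]

variable [LieRing L] [LieAlgebra k L]

/-- A parametrisation of a Lie algebra `L` around an element `e`: the subspace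
`psi (SlTruncWitt k) + amap (TruncPoly k)` is a subalgebra with abelian ideal
`amap (TruncPoly k)`, the element `e` is `amap 1`, and `ad e` maps `T` to `U` to `psi`. -/
structure WittData (e : L) where
  /-- A section of the quotient map onto `(sl(2) ⊗ O(2;1)) ⋊ W(2;1)`. -/
  psi : SlTruncWitt k →ₗ[k] L
  /-- A partial inverse image of `psi` under `ad e`. -/
  U : SlTruncWitt k →ₗ[k] L
  /-- The parametrisation of the abelian ideal. -/
  amap : TruncPoly k →ₗ[k] L
  /-- A partial inverse image of `U` under `ad e`. -/
  T : SlTrunc k × TruncPoly k →ₗ[k] L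
  amap_one : amap 1 = e
  amap_top : amap (tmon k 2 2) = 0
  amap_ker : ∀ f, amap f = 0 → f ∈ Submodule.span k {tmon k 2 2}
  lie_amap : ∀ f g, ⁅amap f, amap g⁆ = 0
  lie_psi_amap : ∀ X f, ⁅psi X, amap f⁆ ∈ LinearMap.range amap
  lie_psi : ∀ X Y, ⁅psi X, psi Y⁆ - psi ⁅X, Y⁆ ∈ LinearMap.range amap
  lie_psi_e : ∀ X, ⁅psi X, e⁆ = amap (divergence k X.right)
  -- One vector suffices: by `inl_mem_of_stable` a nonzero preimage of `A` under `psi` would contain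
  -- `1 ⊗ e`.
  psi_notMem : psi ⟨1 ⊗ₜ slGen k 0, 0⟩ ∉ LinearMap.range amap
  lie_U : ∀ X, ⁅U X, e⁆ = psi X
  lie_T : ∀ z, ⁅T z, e⁆ = U ⟨z.1, hamField k z.2⟩
  T_one : T (0, 1) = 0
  -- Here `133 = 135 - 2`: the dimension of the four sources minus the two relations `amap_top` and
  -- `T_one`.
  finrank_le : Module.finrank k L ≤ 133
  eq_top : ∀ M : LieSubalgebra k L, (∀ X, psi X ∈ M) → (∀ f, amap f ∈ M) →
    (∀ s, U ⟨s, 0⟩ ∈ M) → M = ⊤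

variable {k} {L' : Type*} [LieRing L'] [LieAlgebra k L'] {e : L}

/-- All conditions are invariant under isomorphism, so it is enough to construct the data at one
point of an orbit. -/
theorem WittData.nonempty_map (D : WittData k e) (g : L ≃ₗ⁅k⁆ L') :
    Nonempty (WittData k (g e)) := by
  have hm : ∀ (f : TruncPoly k →ₗ[k] L) (x : L), x ∈ LinearMap.range f →
      g x ∈ LinearMap.range ((g : L →ₗ[k] L') ∘ₗ f) := by
    rintro f _ ⟨y, rfl⟩
    exact ⟨y, rfl⟩
  refine ⟨⟨(g : L →ₗ[k] L') ∘ₗ D.psi, (g : L →ₗ[k] L') ∘ₗ D.U, (g : L →ₗ[k] L') ∘ₗ D.amap,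
    (g : L →ₗ[k] L') ∘ₗ D.T, ?_, ?_, ?_, ?_, ?_, ?_, ?_, ?_, ?_, ?_, ?_, ?_, ?_⟩⟩
  · exact congrArg g D.amap_one
  · exact (congrArg g D.amap_top).trans g.map_zero
  · intro f hf
    exact D.amap_ker f (g.injective (hf.trans g.map_zero.symm))
  · intro f h
    change ⁅g (D.amap f), g (D.amap h)⁆ = 0
    rw [← g.map_lie, D.lie_amap, map_zero]
  · intro X f
    change ⁅g (D.psi X), g (D.amap f)⁆ ∈ _
    rw [← g.map_lie]
    exact hm _ _ (D.lie_psi_amap X f)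
  · intro X Y
    change ⁅g (D.psi X), g (D.psi Y)⁆ - g (D.psi ⁅X, Y⁆) ∈ _
    rw [← g.map_lie, ← map_sub]
    exact hm _ _ (D.lie_psi X Y)
  · intro X
    change ⁅g (D.psi X), g e⁆ = g (D.amap _)
    rw [← g.map_lie, D.lie_psi_e]
  · rintro ⟨f, hf⟩
    exact D.psi_notMem ⟨f, g.injective hf⟩
  · intro X
    change ⁅g (D.U X), g e⁆ = g (D.psi X)
    rw [← g.map_lie, D.lie_U]
  · intro z
    change ⁅g (D.T z), g e⁆ = g (D.U _)
    rw [← g.map_lie, D.lie_T]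
  · exact (congrArg g D.T_one).trans g.map_zero
  · rw [← g.toLinearEquiv.finrank_eq]
    exact D.finrank_le
  · intro M h1 h2 h3
    have h := D.eq_top (M.comap g.toLieHom) h1 h2 h3
    rw [eq_top_iff]
    intro x _
    obtain ⟨y, rfl⟩ := g.surjective x
    have hy : y ∈ M.comap g.toLieHom := by rw [h]; trivial
    exact hy

/-- The values of the field at `x₁` and `x₂` are `∂₂ f` and `-∂₁ f`. -/
theorem hamField_eq_zero {f : TruncPoly k} (h : hamField k f = 0) : ∃ c : k, f = c • 1 := by
  have h0 := DFunLike.congr_fun h (tx k 0)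
  have h1 := DFunLike.congr_fun h (tx k 1)
  simp only [hamField, LinearMap.coe_mk, AddHom.coe_mk, Derivation.sub_apply,
    Derivation.smul_apply, pd_tx, smul_eq_mul, Derivation.zero_apply] at h0 h1
  refine eq_smul_one_of_pd_eq_zero ?_ ?_
  · simpa using h1
  · simpa using h0

namespace WittData

variable (D : WittData k e)

/-- The abelian subalgebra `A`. -/
noncomputable def A : LieSubalgebra k L where
  __ := LinearMap.range D.amap
  lie_mem' := by
    rintro _ _ ⟨f, rfl⟩ ⟨g, rfl⟩
    change ⁅D.amap f, D.amap g⁆ ∈ LinearMap.range D.amap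
    rw [D.lie_amap]
    exact zero_mem _

theorem amap_mem (f : TruncPoly k) : D.amap f ∈ D.A := ⟨f, rfl⟩

theorem e_mem : e ∈ D.A := ⟨1, D.amap_one⟩

theorem lie_A {x y : L} (hx : x ∈ D.A) (hy : y ∈ D.A) : ⁅x, y⁆ = 0 := by
  obtain ⟨f, rfl⟩ := hx
  obtain ⟨g, rfl⟩ := hy
  exact D.lie_amap f g

theorem lie_psi_mem (X : SlTruncWitt k) {x : L} (hx : x ∈ D.A) : ⁅D.psi X, x⁆ ∈ D.A := by
  obtain ⟨f, rfl⟩ := hx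
  exact D.lie_psi_amap X f

theorem lie_psi_sub (X : SlTruncWitt k) {x : L} {Y : SlTruncWitt k} (hx : x - D.psi Y ∈ D.A) :
    ⁅D.psi X, x⁆ - D.psi ⁅X, Y⁆ ∈ D.A := by
  have h : ⁅D.psi X, x⁆ - D.psi ⁅X, Y⁆ =
      ⁅D.psi X, x - D.psi Y⁆ + (⁅D.psi X, D.psi Y⁆ - D.psi ⁅X, Y⁆) := by
    rw [lie_sub]; abel
  rw [h]
  exact D.A.add_mem (D.lie_psi_mem X hx) (D.lie_psi X Y)

/-- The errors of `x` and `y` lie in `A`; they commute with each other, and their brackets with the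
image of `psi` stay in `A`. -/
theorem lie_sub_mem {x y : L} {X Y : SlTruncWitt k} (hx : x - D.psi X ∈ D.A)
    (hy : y - D.psi Y ∈ D.A) : ⁅x, y⁆ - D.psi ⁅X, Y⁆ ∈ D.A := by
  have h : ⁅x, y⁆ - D.psi ⁅X, Y⁆ = (⁅D.psi X, y⁆ - D.psi ⁅X, Y⁆) +
      (⁅x - D.psi X, y - D.psi Y⁆ - ⁅D.psi Y, x - D.psi X⁆) := by
    rw [← lie_skew (D.psi Y)]
    simp only [sub_lie, lie_sub]; abel
  rw [h, D.lie_A hx hy, zero_sub]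
  exact D.A.add_mem (D.lie_psi_sub X hy) (D.A.neg_mem_iff.2 (D.lie_psi_mem Y hx))

/-- The preimage of `A` under `psi` is an ideal; if nonzero it would contain `1 ⊗ e`, against
`psi_notMem`. -/
theorem psi_eq_zero {X : SlTruncWitt k} (hX : D.psi X ∈ D.A) : X = 0 := by
  let K : Submodule k (SlTruncWitt k) := D.A.toSubmodule.comap D.psi
  have hK : K = ⊥ := by
    by_contra hne
    refine D.psi_notMem (inl_mem_of_stable (K := K) ?_ hne _)
    intro Y _ X hX
    have h0 : D.psi X - D.psi 0 ∈ D.A := by rwa [map_zero, sub_zero]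
    -- The element `psi X` represents both `0` and `X` modulo `A`; comparing the two resulting
    -- brackets puts `psi ⁅Y, X⁆` in `A`.
    have h := D.lie_psi_sub Y h0
    have h' := D.lie_psi_sub Y (x := D.psi X) (Y := X) (by rw [sub_self]; exact D.A.zero_mem)
    rw [lie_zero, map_zero, sub_zero] at h
    have := D.A.sub_mem h h'
    rwa [sub_sub_cancel] at this
  have h : X ∈ K := hX
  rwa [hK] at h

/-- The linear map with components `psi`, `amap`, `U` and `T`. -/
noncomputable def total :
    (SlTruncWitt k × TruncPoly k) × (SlTruncWitt k × (SlTrunc k × TruncPoly k)) →ₗ[k] L :=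
  (D.psi.coprod D.amap).coprod (D.U.coprod D.T)

theorem total_apply (X f Y z) :
    D.total ((X, f), (Y, z)) = D.psi X + D.amap f + (D.U Y + D.T z) := rfl

theorem lie_total (X f Y z) : ⁅D.total ((X, f), (Y, z)), e⁆ =
    D.amap (divergence k X.right) + (D.psi Y + D.U ⟨z.1, hamField k z.2⟩) := by
  rw [D.total_apply]
  simp only [add_lie, D.lie_psi_e, D.lie_A (D.amap_mem f) D.e_mem, D.lie_U, D.lie_T, add_zero]

/-- A second bracket with `e` gives zero and turns the `T` component into an element of `psi` lying
in `A`, which must vanish by `psi_eq_zero`. Then `psi Y` is in `A` as well, so `Y = 0`. Only the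
constants of `z.2` survive, being the kernel of `hamField`. -/
theorem eq_zero_of_lie_total {X f Y z} (h : ⁅D.total ((X, f), (Y, z)), e⁆ ∈ D.A) :
    Y = 0 ∧ ∃ c : k, z = c • ((0 : SlTrunc k), (1 : TruncPoly k)) := by
  rw [D.lie_total] at h
  have h1 := D.lie_A h D.e_mem
  simp only [add_lie, D.lie_A (D.amap_mem _) D.e_mem, D.lie_psi_e, D.lie_U, zero_add] at h1
  have h2 : (⟨z.1, hamField k z.2⟩ : SlTruncWitt k) = 0 := by
    apply D.psi_eq_zero
    rw [eq_neg_of_add_eq_zero_right h1]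
    exact D.A.neg_mem_iff.2 (D.amap_mem _)
  rw [h2, map_zero, add_zero] at h
  have h3 : D.psi Y ∈ D.A := by
    have := D.A.sub_mem h (D.amap_mem (divergence k X.right))
    rwa [add_sub_cancel_left] at this
  have h4 : z.1 = 0 := congrArg LieAlgebra.SemiDirectSum.left h2
  obtain ⟨c, hc⟩ := hamField_eq_zero (congrArg LieAlgebra.SemiDirectSum.right h2)
  exact ⟨D.psi_eq_zero h3, c, Prod.ext (by rw [h4, Prod.smul_mk, smul_zero]) hc⟩

theorem ker_total_le : LinearMap.ker D.total ≤ Submodule.span k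
    {((0, tmon k 2 2), (0, 0)), ((0, 0), (0, (0, 1)))} := by
  rintro ⟨⟨X, f⟩, ⟨Y, z⟩⟩ h
  rw [LinearMap.mem_ker] at h
  obtain ⟨rfl, c, rfl⟩ := D.eq_zero_of_lie_total (X := X) (f := f) (Y := Y) (z := z) (by
    rw [h, zero_lie]; exact D.A.zero_mem)
  rw [D.total_apply, map_zero, map_smul, D.T_one, smul_zero, add_zero, add_zero] at h
  have hX : X = 0 := D.psi_eq_zero (by
    rw [eq_neg_of_add_eq_zero_left h]; exact D.A.neg_mem_iff.2 (D.amap_mem _))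
  rw [hX, map_zero, zero_add] at h
  obtain ⟨d, rfl⟩ := Submodule.mem_span_singleton.1 (D.amap_ker f h)
  rw [Submodule.mem_span_pair]
  refine ⟨d, c, ?_⟩
  rw [hX]
  simp

/-- The source has dimension `135` and the kernel at most `2`, while `L` has dimension at most
`133`. -/
theorem total_surjective [FiniteDimensional k L] : Function.Surjective D.total := by
  have h1 := LinearMap.finrank_range_add_finrank_ker D.total
  have h2 : Module.finrank k (LinearMap.ker D.total) ≤ 2 := by
    refine (Submodule.finrank_mono D.ker_total_le).trans ?_
    classical
    have h := finrank_span_finset_le_card (R := k) ({((0, tmon k 2 2), (0, 0)),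
      ((0, 0), (0, (0, 1)))} : Finset ((SlTruncWitt k × TruncPoly k) ×
        (SlTruncWitt k × (SlTrunc k × TruncPoly k))))
    rw [Finset.coe_pair] at h
    exact h.trans Finset.card_le_two
  simp only [Module.finrank_prod, finrank_slTruncWitt, finrank_truncPoly, finrank_slTrunc] at h1
  have h3 := D.finrank_le
  rw [← LinearMap.range_eq_top]
  exact Submodule.eq_top_of_finrank_eq
    (le_antisymm (Submodule.finrank_le _) (by omega))

theorem exists_eq_of_lie_mem [FiniteDimensional k L] {x : L} (h : ⁅x, e⁆ ∈ D.A) :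
    ∃ X, x - D.psi X ∈ D.A := by
  obtain ⟨⟨⟨X, f⟩, ⟨Y, z⟩⟩, rfl⟩ := D.total_surjective x
  obtain ⟨rfl, c, rfl⟩ := D.eq_zero_of_lie_total h
  refine ⟨X, f, ?_⟩
  rw [D.total_apply, map_zero, map_smul, D.T_one]
  simp

/-- Since `e ∈ A`, a normalising `x` satisfies `[x, e] ∈ A`, and this single condition already
determines the shape of `x`. -/
theorem mem_normalizer [FiniteDimensional k L] {x : L} :
    x ∈ D.A.normalizer ↔ ∃ X, x - D.psi X ∈ D.A := by
  constructor
  · intro h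
    exact D.exists_eq_of_lie_mem ((D.A.mem_normalizer_iff x).1 h e D.e_mem)
  · rintro ⟨X, hX⟩
    refine (D.A.mem_normalizer_iff x).2 fun y hy => ?_
    have h : ⁅x, y⁆ = ⁅x - D.psi X, y⁆ + ⁅D.psi X, y⁆ := by rw [sub_lie]; abel
    rw [h, D.lie_A hX hy, zero_add]
    exact D.lie_psi_mem X hy

end WittData

end WittData


/-! ### The first isomorphism theorem with an explicit formula. -/

section QuotientEquiv

variable {k M N : Type*} [Field k] [LieRing M] [LieAlgebra k M] [LieRing N] [LieAlgebra k N]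

theorem exists_quotient_equiv (f : M →ₗ⁅k⁆ N) (hf : Function.Surjective f) (I : LieIdeal k M)
    (h : ∀ x, x ∈ I ↔ f x = 0) :
    ∃ φ : (M ⧸ I) ≃ₗ⁅k⁆ N, ∀ x, φ (LieSubmodule.Quotient.mk x) = f x := by
  have hI : I = f.ker := by
    ext x
    rw [h, LieHom.mem_ker]
  subst hI
  have ht : f.range = ⊤ := (LieHom.range_eq_top f).2 hf
  refine ⟨f.quotKerEquivRange.trans ((LieEquiv.ofEq _ _ (congrArg _ ht)).trans
    LieSubalgebra.topEquiv), fun x => rfl⟩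

end QuotientEquiv

/-! ### Centraliser, line normaliser, radicals, maximality and the ideal `I`. -/

namespace WittData

variable {k L : Type*} [Field k] [CharP k 3] [LieRing L] [LieAlgebra k L] [FiniteDimensional k L]
  {e : L} (D : WittData k e)

theorem eq_of_sub_psi_mem {x : L} {X Y : SlTruncWitt k} (hX : x - D.psi X ∈ D.A)
    (hY : x - D.psi Y ∈ D.A) : X = Y := by
  rw [← sub_eq_zero]
  apply D.psi_eq_zero
  have := D.A.sub_mem hY hX
  rwa [sub_sub_sub_cancel_left, ← map_sub] at this

theorem psi_mem_normalizer (X : SlTruncWitt k) : D.psi X ∈ D.A.normalizer :=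
  D.mem_normalizer.2 ⟨X, by rw [sub_self]; exact D.A.zero_mem⟩

/-- The homomorphism of the normaliser of `A` onto `(sl(2) ⊗ O(2;1)) ⋊ W(2;1)`. -/
noncomputable def phi : D.A.normalizer →ₗ⁅k⁆ SlTruncWitt k where
  -- The chosen element is unique by `eq_of_sub_psi_mem`, so each law follows by exhibiting a second
  -- representative.
  toFun x := (D.mem_normalizer.1 x.2).choose
  map_add' x y := by
    refine D.eq_of_sub_psi_mem (D.mem_normalizer.1 (x + y).2).choose_spec ?_
    rw [map_add, AddMemClass.coe_add, add_sub_add_comm]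
    exact D.A.add_mem (D.mem_normalizer.1 x.2).choose_spec (D.mem_normalizer.1 y.2).choose_spec
  map_smul' c x := by
    refine D.eq_of_sub_psi_mem (D.mem_normalizer.1 (c • x).2).choose_spec ?_
    rw [map_smul, SetLike.val_smul, RingHom.id_apply, ← smul_sub]
    exact D.A.smul_mem c (D.mem_normalizer.1 x.2).choose_spec
  map_lie' {x y} := by
    refine D.eq_of_sub_psi_mem (D.mem_normalizer.1 ⁅x, y⁆.2).choose_spec ?_
    exact D.lie_sub_mem (D.mem_normalizer.1 x.2).choose_spec (D.mem_normalizer.1 y.2).choose_spec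

theorem sub_psi_phi_mem (x : D.A.normalizer) : (x : L) - D.psi (D.phi x) ∈ D.A :=
  (D.mem_normalizer.1 x.2).choose_spec

theorem phi_eq {x : D.A.normalizer} {X : SlTruncWitt k} (h : (x : L) - D.psi X ∈ D.A) :
    D.phi x = X :=
  D.eq_of_sub_psi_mem (D.sub_psi_phi_mem x) h

theorem phi_psi (X : SlTruncWitt k) : D.phi ⟨D.psi X, D.psi_mem_normalizer X⟩ = X :=
  D.phi_eq (by rw [sub_self]; exact D.A.zero_mem)

theorem phi_surjective : Function.Surjective D.phi := fun X => ⟨_, D.phi_psi X⟩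

theorem phi_eq_zero_iff (x : D.A.normalizer) : D.phi x = 0 ↔ (x : L) ∈ D.A := by
  have h := D.sub_psi_phi_mem x
  constructor
  · intro h0
    rwa [h0, map_zero, sub_zero] at h
  · intro hx
    exact D.phi_eq (by rwa [map_zero, sub_zero])

theorem lie_e (x : D.A.normalizer) : ⁅(x : L), e⁆ = D.amap (divergence k (D.phi x).right) := by
  have h := D.lie_A (D.sub_psi_phi_mem x) D.e_mem
  rw [sub_lie, sub_eq_zero] at h
  rw [h, D.lie_psi_e]

theorem amap_divergence_eq_zero {E : Witt k} (h : D.amap (divergence k E) = 0) :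
    divergence k E = 0 :=
  divergence_eq_zero_of_mem_span (D.amap_ker _ h)

theorem elemCentralizer_le : elemCentralizer e ≤ D.A.normalizer := by
  intro x (hx : ⁅x, e⁆ = 0)
  exact D.mem_normalizer.2 (D.exists_eq_of_lie_mem (by rw [hx]; exact D.A.zero_mem))

theorem elemNormalizer_le : elemNormalizer e ≤ D.A.normalizer := by
  rintro x ⟨c, hx⟩
  exact D.mem_normalizer.2 (D.exists_eq_of_lie_mem (by rw [hx]; exact D.A.smul_mem c D.e_mem))

theorem mem_elemCentralizer_iff (x : D.A.normalizer) :
    (x : L) ∈ elemCentralizer (k := k) e ↔ (D.phi x).right ∈ ham k := by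
  rw [mem_ham_iff_divergence]
  change ⁅(x : L), e⁆ = 0 ↔ _
  rw [D.lie_e]
  exact ⟨D.amap_divergence_eq_zero, fun h => by rw [h, map_zero]⟩

theorem mem_elemNormalizer_iff (x : D.A.normalizer) :
    (x : L) ∈ elemNormalizer (k := k) e ↔ (D.phi x).right ∈ confHam k := by
  have h2 : (2 : k) ≠ 0 := two_ne_zero_of_char_three k
  rw [mem_confHam_iff_divergence]
  change (∃ c : k, ⁅(x : L), e⁆ = c • e) ↔ _
  rw [D.lie_e]
  refine exists_congr fun c => ⟨fun h => ?_, fun h => by rw [h, map_smul, D.amap_one]⟩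
  -- The constant `c` is itself the divergence of `(c / 2) • degDer k`; this reduces the claim to a
  -- divergence killed by `amap`.
  have h' : D.amap (divergence k ((D.phi x).right - (c / 2) • degDer k)) = 0 := by
    rw [map_sub, map_smul, divergence_degDer, smul_smul, div_mul_cancel₀ _ h2, map_sub, h,
      map_smul, D.amap_one, sub_self]
  have := D.amap_divergence_eq_zero h'
  rwa [map_sub, map_smul, divergence_degDer, smul_smul, div_mul_cancel₀ _ h2, sub_eq_zero] at this

theorem elemCentralizer_le_elemNormalizer : elemCentralizer (k := k) e ≤ elemNormalizer e := by
  intro x (hx : ⁅x, e⁆ = 0)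
  exact ⟨0, by rw [hx, zero_smul]⟩

theorem A_le_elemCentralizer : D.A ≤ elemCentralizer e := fun _ hx => D.lie_A hx D.e_mem

theorem A_le_normalizer : D.A ≤ D.A.normalizer := D.A_le_elemCentralizer.trans D.elemCentralizer_le

theorem isLieAbelian : IsLieAbelian D.A :=
  ⟨fun x y => Subtype.ext (D.lie_A x.2 y.2)⟩

theorem finrank_A : Module.finrank k D.A = 8 := by
  have h := LinearMap.finrank_range_add_finrank_ker D.amap
  have hk : LinearMap.ker D.amap = Submodule.span k {tmon k 2 2} := by
    refine le_antisymm (fun f hf => D.amap_ker f hf) ?_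
    rw [Submodule.span_singleton_le_iff_mem]
    exact D.amap_top
  rw [hk, finrank_span_tmon_top, finrank_truncPoly] at h
  change Module.finrank k (LinearMap.range D.amap) = 8
  omega

theorem one_tmul_lie_mem {H : LieSubalgebra k L} {R : LieIdeal k H} {a b : ℕ} (ha : a < 3)
    (hb : b < 3) (hc : (slConst a b : k) ≠ 0)
    (h : ∀ a, a < 3 → ∃ y ∈ R, (y : L) - D.psi ⟨1 ⊗ₜ slGen k a, 0⟩ ∈ D.A) :
    ∃ y ∈ ⁅R, R⁆, (y : L) - D.psi ⟨1 ⊗ₜ slGen k (a + b - 1), 0⟩ ∈ D.A := by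
  obtain ⟨y, hy, hy'⟩ := h a ha
  obtain ⟨z, hz, hz'⟩ := h b hb
  refine ⟨(slConst a b : k)⁻¹ • ⁅y, z⁆,
    SMulMemClass.smul_mem _ (LieSubmodule.lie_mem_lie hy hz), ?_⟩
  have h1 := D.lie_sub_mem hy' hz'
  rw [inl_lie, LieAlgebra.ExtendScalars.bracket_tmul, slGen_lie k ha hb, mul_one,
    map_zero, LieDerivation.coe_zero, Pi.zero_apply, sub_zero, TensorProduct.tmul_smul] at h1
  have h2 : (⟨(slConst a b : k) • (1 : TruncPoly k) ⊗ₜ[k] slGen k (a + b - 1), 0⟩ : SlTruncWitt k) =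
      (slConst a b : k) • ⟨(1 : TruncPoly k) ⊗ₜ[k] slGen k (a + b - 1), 0⟩ := by
    rw [LieAlgebra.SemiDirectSum.smul_eq_mk, smul_zero]
  rw [h2, map_smul] at h1
  have h3 := D.A.smul_mem (slConst a b : k)⁻¹ h1
  rwa [smul_sub, smul_smul, inv_mul_cancel₀ hc, one_smul] at h3

/-- As `2` is invertible, `sl(2)` is perfect, so every term of the derived series still contains
lifts of `1 ⊗ sl(2)` modulo `A`; the lift of `1 ⊗ e` is not zero. -/
theorem not_isSolvable {H : LieSubalgebra k L} {R : LieIdeal k H}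
    (h : ∀ a, a < 3 → ∃ y ∈ R, (y : L) - D.psi ⟨1 ⊗ₜ slGen k a, 0⟩ ∈ D.A) :
    ¬ LieAlgebra.IsSolvable R := by
  have h2 : (2 : k) ≠ 0 := two_ne_zero_of_char_three k
  intro hs
  obtain ⟨n, hn⟩ := LieAlgebra.IsSolvable.solvable k R
  rw [LieIdeal.derivedSeries_eq_bot_iff] at hn
  have key : ∀ n, ∀ a, a < 3 → ∃ y ∈ LieAlgebra.derivedSeriesOfIdeal k H n R,
      (y : L) - D.psi ⟨1 ⊗ₜ slGen k a, 0⟩ ∈ D.A := by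
    intro n
    induction n with
    | zero => exact h
    | succ n ih =>
      intro a ha
      rw [LieAlgebra.derivedSeriesOfIdeal_succ]
      interval_cases a
      -- Up to invertible constants, `e`, `h`, `f` are recovered as `[e, h]`, `[f, e]`, `[f, h]`.
      · exact D.one_tmul_lie_mem (a := 0) (b := 1) (by omega) (by omega)
          (by simpa [slConst] using h2) ih
      · exact D.one_tmul_lie_mem (a := 2) (b := 0) (by omega) (by omega)
          (by simp [slConst]) ih
      · exact D.one_tmul_lie_mem (a := 2) (b := 1) (by omega) (by omega)
          (by simpa [slConst] using h2) ih
  obtain ⟨y, hy, hy'⟩ := key n 0 (by omega)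
  rw [hn, LieSubmodule.mem_bot] at hy
  rw [hy, ZeroMemClass.coe_zero, zero_sub] at hy'
  exact D.psi_notMem (D.A.neg_mem_iff.1 hy')

/-- One argument serves the centraliser, the line normaliser and `w`. The image of the radical in
the semidirect product is stable under `sl(2) ⊗ O(2;1)` and `H(2;1)`; if nonzero it contains `sl(2)
⊗ O(2;1)`, which contradicts solvability. Conversely `A` is an abelian ideal. -/
theorem radicalOf_eq {H : LieSubalgebra k L} (hA : D.A ≤ H) (hN : H ≤ D.A.normalizer)
    (hH : ∀ X : SlTruncWitt k, X.right ∈ ham k → D.psi X ∈ H) : radicalOf H = D.A := by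
  apply le_antisymm
  · rintro _ ⟨y, hy, rfl⟩
    have hy : y ∈ LieAlgebra.radical k H := hy
    change (y : L) ∈ D.A
    by_contra hyA
    let K : Submodule k (SlTruncWitt k) :=
      { carrier := {X | ∃ y ∈ LieAlgebra.radical k H, (y : L) - D.psi X ∈ D.A}
        add_mem' := by
          rintro X Y ⟨x, hx, hx'⟩ ⟨y, hy, hy'⟩
          refine ⟨x + y, add_mem hx hy, ?_⟩
          rw [map_add, AddMemClass.coe_add, add_sub_add_comm]
          exact D.A.add_mem hx' hy'
        zero_mem' := ⟨0, zero_mem _, by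
          rw [map_zero, sub_zero]; exact D.A.zero_mem⟩
        smul_mem' := by
          rintro c X ⟨x, hx, hx'⟩
          refine ⟨c • x, SMulMemClass.smul_mem c hx, ?_⟩
          rw [map_smul, SetLike.val_smul, ← smul_sub]
          exact D.A.smul_mem c hx' }
    have hne : K ≠ ⊥ := by
      intro hK
      have hm : D.phi ⟨y, hN y.2⟩ ∈ K := ⟨y, hy, D.sub_psi_phi_mem ⟨y, hN y.2⟩⟩
      rw [hK, Submodule.mem_bot, D.phi_eq_zero_iff] at hm
      exact hyA hm
    have hK : ∀ Y : SlTruncWitt k, Y.right ∈ ham k → ∀ X ∈ K, ⁅Y, X⁆ ∈ K := by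
      rintro Y hY X ⟨x, hx, hx'⟩
      exact ⟨⁅(⟨D.psi Y, hH Y hY⟩ : H), x⁆, lie_mem_right k H _ _ _ hx, D.lie_psi_sub Y hx'⟩
    exact D.not_isSolvable (fun a _ => inl_mem_of_stable hK hne (1 ⊗ₜ slGen k a)) inferInstance
  · let J : LieIdeal k H :=
      { carrier := {x | (x : L) ∈ D.A}
        add_mem' := fun hx hy => D.A.add_mem hx hy
        zero_mem' := D.A.zero_mem
        smul_mem' := fun c _ hx => D.A.smul_mem c hx
        lie_mem := fun {x m} hm => (D.A.mem_normalizer_iff (x : L)).1 (hN x.2) m hm }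
    have hJ : IsLieAbelian J := ⟨fun x y => Subtype.ext (Subtype.ext (D.lie_A x.2 y.2))⟩
    have hle : J ≤ LieAlgebra.radical k H := (LieAlgebra.LieIdeal.solvable_iff_le_radical k H J).1 inferInstance
    intro x hx
    exact ⟨⟨x, hA hx⟩, hle (show (⟨x, hA hx⟩ : H) ∈ J from hx), rfl⟩

theorem psi_mem_elemCentralizer {X : SlTruncWitt k} (hX : X.right ∈ ham k) :
    D.psi X ∈ elemCentralizer (k := k) e := by
  refine (D.mem_elemCentralizer_iff ⟨D.psi X, D.psi_mem_normalizer X⟩).2 ?_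
  rwa [D.phi_psi]

theorem radicalOf_elemCentralizer : radicalOf (elemCentralizer e) = D.A :=
  D.radicalOf_eq D.A_le_elemCentralizer D.elemCentralizer_le fun _ => D.psi_mem_elemCentralizer

theorem radicalOf_elemNormalizer : radicalOf (elemNormalizer e) = D.A :=
  D.radicalOf_eq (D.A_le_elemCentralizer.trans elemCentralizer_le_elemNormalizer)
    D.elemNormalizer_le fun _ hX => elemCentralizer_le_elemNormalizer (D.psi_mem_elemCentralizer hX)

theorem radicalOf_normalizer : radicalOf D.A.normalizer = D.A :=
  D.radicalOf_eq D.A_le_normalizer le_rfl fun X _ => D.psi_mem_normalizer X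

/-- Two brackets with `e` carry all of `L` into `w`, so for `x ∈ M` outside `w` one of `x`, `[x, e]`
is a `y` outside `w` with `[y, e] ∈ w`. If `[y, e]` is `psi X` modulo `A`, then `y - U X` lies in
`w`, hence in `M`. -/
theorem exists_U_mem {M : LieSubalgebra k L} (hM : D.A.normalizer < M) :
    ∃ X ≠ 0, D.U X ∈ M := by
  have hsub : ∀ y ∈ M, y ∉ D.A.normalizer → ⁅y, e⁆ ∈ D.A.normalizer → ∃ X ≠ 0, D.U X ∈ M := by
    intro y hy hyN hye
    obtain ⟨X, hX⟩ := D.mem_normalizer.1 hye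
    have h1 : y - D.U X ∈ D.A.normalizer := by
      refine D.mem_normalizer.2 (D.exists_eq_of_lie_mem ?_)
      rwa [sub_lie, D.lie_U]
    refine ⟨X, ?_, ?_⟩
    · rintro rfl
      rw [map_zero, sub_zero] at h1
      exact hyN h1
    · have := M.sub_mem hy (hM.le h1)
      rwa [sub_sub_cancel] at this
  obtain ⟨x, hxM, hxN⟩ := SetLike.exists_of_lt hM
  have heM : e ∈ M := hM.le (D.A_le_normalizer D.e_mem)
  by_cases h1 : ⁅x, e⁆ ∈ D.A.normalizer
  · exact hsub x hxM hxN h1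
  refine hsub ⁅x, e⁆ (M.lie_mem hxM heM) h1 ?_
  obtain ⟨⟨⟨X, f⟩, ⟨Y, z⟩⟩, rfl⟩ := D.total_surjective x
  rw [D.lie_total, add_lie, add_lie, D.lie_A (D.amap_mem _) D.e_mem, D.lie_psi_e, D.lie_U]
  exact D.A.normalizer.add_mem (D.A.normalizer.zero_mem)
    (D.A.normalizer.add_mem (D.A_le_normalizer (D.amap_mem _)) (D.psi_mem_normalizer _))

/-- For `Y` over `H(2;1)` the element `psi Y` centralises `e`, so bracketing with `e` turns the
claim into the homomorphism property of `psi` modulo `A`. -/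
theorem lie_psi_U {Y : SlTruncWitt k} (hY : Y.right ∈ ham k) (X : SlTruncWitt k) :
    ⁅D.psi Y, D.U X⁆ - D.U ⁅Y, X⁆ ∈ D.A.normalizer := by
  refine D.mem_normalizer.2 (D.exists_eq_of_lie_mem ?_)
  have h0 : ⁅D.psi Y, e⁆ = 0 := D.psi_mem_elemCentralizer hY
  rw [sub_lie, lie_lie, D.lie_U, D.lie_U, h0, lie_zero, sub_zero]
  exact D.lie_psi Y X

/-- For `M` above `w`, the subspace `U⁻¹(M)` is nonzero and stable, hence contains `sl(2) ⊗ O(2;1)`,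
and `eq_top` applies. Properness holds because `U (1 ⊗ e)` sends `e` to `psi (1 ⊗ e)`, outside `A`.
-/
theorem isCoatom_normalizer : IsCoatom D.A.normalizer := by
  constructor
  · intro h
    have hU : D.U ⟨1 ⊗ₜ slGen k 0, 0⟩ ∈ D.A.normalizer := by rw [h]; trivial
    have := (D.A.mem_normalizer_iff _).1 hU e D.e_mem
    rw [D.lie_U] at this
    exact D.psi_notMem this
  · intro M hM
    obtain ⟨X, hX0, hX⟩ := D.exists_U_mem hM
    let K : Submodule k (SlTruncWitt k) := M.toSubmodule.comap D.U
    have hXK : X ∈ K := hX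
    have hne : K ≠ ⊥ := by
      intro h
      rw [h] at hXK
      exact hX0 hXK
    have hK : ∀ Y : SlTruncWitt k, Y.right ∈ ham k → ∀ X ∈ K, ⁅Y, X⁆ ∈ K := by
      intro Y hY X hX
      have hX : D.U X ∈ M := hX
      have h1 := M.lie_mem (hM.le (D.psi_mem_normalizer Y)) hX
      have := M.sub_mem h1 (hM.le (D.lie_psi_U hY X))
      rwa [sub_sub_cancel] at this
    exact D.eq_top M (fun X => hM.le (D.psi_mem_normalizer X))
      (fun f => hM.le (D.A_le_normalizer (D.amap_mem f))) fun s => inl_mem_of_stable hK hne s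

/-- The ideal `I` of the normaliser of `A`. -/
noncomputable def ideal : LieIdeal k D.A.normalizer :=
  ((LieAlgebra.SemiDirectSum.projr (wittAction k)).comp D.phi).ker

theorem mem_ideal (x : D.A.normalizer) : x ∈ D.ideal ↔ (D.phi x).right = 0 := Iff.rfl

/-- The map `(a, s) ↦ a + psi s` identifies `A × (sl(2) ⊗ O(2;1))` with the ideal, so the dimension
is `8 + 27`. -/
theorem finrank_ideal : Module.finrank k D.ideal = 35 := by
  have hm : ∀ p : D.A × SlTrunc k, (p.1 : L) + D.psi ⟨p.2, 0⟩ ∈ D.A.normalizer := fun p =>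
    D.A.normalizer.add_mem (D.A_le_normalizer p.1.2) (D.psi_mem_normalizer _)
  have hphi : ∀ p : D.A × SlTrunc k, D.phi ⟨_, hm p⟩ = ⟨p.2, 0⟩ := fun p =>
    D.phi_eq (by
      change (p.1 : L) + D.psi ⟨p.2, 0⟩ - D.psi ⟨p.2, 0⟩ ∈ D.A
      rw [add_sub_cancel_right]
      exact p.1.2)
  let G : D.A × SlTrunc k →ₗ[k] D.ideal :=
    { toFun := fun p => ⟨⟨_, hm p⟩, by rw [mem_ideal, hphi]⟩
      map_add' := fun p q => by
        apply Subtype.ext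
        apply Subtype.ext
        change ((p.1 + q.1 : D.A) : L) + D.psi ⟨p.2 + q.2, 0⟩ =
          (p.1 : L) + D.psi ⟨p.2, 0⟩ + ((q.1 : L) + D.psi ⟨q.2, 0⟩)
        have : (⟨p.2 + q.2, 0⟩ : SlTruncWitt k) = ⟨p.2, 0⟩ + ⟨q.2, 0⟩ := by
          rw [LieAlgebra.SemiDirectSum.add_eq_mk, add_zero]
        rw [this, map_add, AddMemClass.coe_add]
        abel
      map_smul' := fun c p => by
        apply Subtype.ext
        apply Subtype.ext
        change ((c • p.1 : D.A) : L) + D.psi ⟨c • p.2, 0⟩ = c • ((p.1 : L) + D.psi ⟨p.2, 0⟩)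
        have : (⟨c • p.2, 0⟩ : SlTruncWitt k) = c • ⟨p.2, 0⟩ := by
          rw [LieAlgebra.SemiDirectSum.smul_eq_mk, smul_zero]
        rw [this, map_smul, SetLike.val_smul, smul_add] }
  have hG : Function.Bijective G := by
    constructor
    · rw [← LinearMap.ker_eq_bot, LinearMap.ker_eq_bot']
      intro p hp
      have h1 : (p.1 : L) + D.psi ⟨p.2, 0⟩ = 0 :=
        congrArg (fun x : D.ideal => ((x : D.A.normalizer) : L)) hp
      have h2 : (⟨p.2, 0⟩ : SlTruncWitt k) = 0 := by
        apply D.psi_eq_zero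
        rw [eq_neg_of_add_eq_zero_right h1]
        exact D.A.neg_mem_iff.2 p.1.2
      rw [h2, map_zero, add_zero] at h1
      exact Prod.ext (Subtype.ext h1) (congrArg LieAlgebra.SemiDirectSum.left h2)
    · rintro ⟨x, hx⟩
      have h := D.sub_psi_phi_mem x
      refine ⟨(⟨_, h⟩, (D.phi x).left), ?_⟩
      apply Subtype.ext
      apply Subtype.ext
      change (x : L) - D.psi (D.phi x) + D.psi ⟨(D.phi x).left, 0⟩ = x
      have hx' : (⟨(D.phi x).left, 0⟩ : SlTruncWitt k) = D.phi x :=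
        LieAlgebra.SemiDirectSum.ext rfl ((D.mem_ideal x).1 hx).symm
      rw [hx', sub_add_cancel]
  rw [← (LinearEquiv.ofBijective G hG).finrank_eq, Module.finrank_prod, D.finrank_A,
    finrank_slTrunc]

/-- Projecting to `W(2;1)` maps `H` onto `P` with kernel the part of the ideal in `H`. It is used
for the centraliser with `ham` and for the line normaliser with `confHam`. -/
theorem nonempty_quotient_equiv {H : LieSubalgebra k L} (hN : H ≤ D.A.normalizer)
    (P : LieSubalgebra k (Witt k))
    (hP : ∀ x : D.A.normalizer, (x : L) ∈ H ↔ (D.phi x).right ∈ P) :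
    Nonempty ((H ⧸ D.ideal.comap (LieSubalgebra.inclusion hN)) ≃ₗ⁅k⁆ P) := by
  let g : H →ₗ⁅k⁆ Witt k := (LieAlgebra.SemiDirectSum.projr (wittAction k)).comp
    (D.phi.comp (LieSubalgebra.inclusion hN))
  let f : H →ₗ⁅k⁆ P :=
    { toFun := fun x => ⟨g x, (hP (LieSubalgebra.inclusion hN x)).1 x.2⟩
      map_add' := fun x y => Subtype.ext (g.map_add x y)
      map_smul' := fun c x => Subtype.ext (g.map_smul c x)
      map_lie' := fun {x y} => Subtype.ext (g.map_lie x y) }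
  obtain ⟨φ, -⟩ := exists_quotient_equiv f (by
    rintro ⟨E, hE⟩
    have h1 := D.phi_psi ⟨0, E⟩
    refine ⟨⟨D.psi ⟨0, E⟩, (hP ⟨_, D.psi_mem_normalizer _⟩).2 (by rw [h1]; exact hE)⟩, ?_⟩
    exact Subtype.ext (congrArg LieAlgebra.SemiDirectSum.right h1))
    (D.ideal.comap (LieSubalgebra.inclusion hN)) (by
      intro x
      rw [LieIdeal.mem_comap, mem_ideal]
      exact (Subtype.ext_iff (a1 := f x) (a2 := 0)).symm)
  exact ⟨φ⟩

end WittData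


/-! ### A computable integer model of the Lie algebra of type `E₇`. -/

section Computation

/-- An element of the root lattice by its seven coordinates. -/
structure R7 where
  /-- The coefficient of `α₁`. -/
  a0 : ℤ
  /-- The coefficient of `α₂`. -/
  a1 : ℤ
  /-- The coefficient of `α₃`. -/
  a2 : ℤ
  /-- The coefficient of `α₄`. -/
  a3 : ℤ
  /-- The coefficient of `α₅`. -/
  a4 : ℤ
  /-- The coefficient of `α₆`. -/
  a5 : ℤ
  /-- The coefficient of `α₇`. -/
  a6 : ℤ

namespace R7

/-- The element of the root lattice with given coordinates. -/
def toLat (r : R7) : Lat := ![r.a0, r.a1, r.a2, r.a3, r.a4, r.a5, r.a6]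

/-- The sum. -/
def add (r s : R7) : R7 :=
  ⟨r.a0 + s.a0, r.a1 + s.a1, r.a2 + s.a2, r.a3 + s.a3, r.a4 + s.a4, r.a5 + s.a5, r.a6 + s.a6⟩

/-- An integral multiple. -/
def smul (c : ℤ) (r : R7) : R7 :=
  ⟨c * r.a0, c * r.a1, c * r.a2, c * r.a3, c * r.a4, c * r.a5, c * r.a6⟩

/-- The zero vector. -/
def zero : R7 := ⟨0, 0, 0, 0, 0, 0, 0⟩

/-- Equality as a Boolean. -/
def beq (r s : R7) : Bool :=
  r.a0 == s.a0 && r.a1 == s.a1 && r.a2 == s.a2 && r.a3 == s.a3 && r.a4 == s.a4 && r.a5 == s.a5 &&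
    r.a6 == s.a6

/-- The invariant form. -/
def form (r s : R7) : ℤ :=
  r.a0 * (2 * s.a0 - s.a2) + r.a1 * (2 * s.a1 - s.a3) + r.a2 * (2 * s.a2 - s.a0 - s.a3) +
    r.a3 * (2 * s.a3 - s.a1 - s.a2 - s.a4) + r.a4 * (2 * s.a4 - s.a3 - s.a5) +
    r.a5 * (2 * s.a5 - s.a4 - s.a6) + r.a6 * (2 * s.a6 - s.a5)

/-- The form that defines the signs. -/
def coc (r s : R7) : ℤ :=
  r.a0 * (s.a0 - s.a2) + r.a1 * (s.a1 - s.a3) + r.a2 * (s.a2 - s.a3) + r.a3 * (s.a3 - s.a4) +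
    r.a4 * (s.a4 - s.a5) + r.a5 * (s.a5 - s.a6) + r.a6 * s.a6

/-- The vector whose coordinates are the decimal digits of a natural number. -/
def ofDigits (n : ℕ) : R7 :=
  ⟨(n / 1000000 : ℕ), (n / 100000 % 10 : ℕ), (n / 10000 % 10 : ℕ), (n / 1000 % 10 : ℕ),
    (n / 100 % 10 : ℕ), (n / 10 % 10 : ℕ), (n % 10 : ℕ)⟩

/-- The vector encoded by an integer: the digits of the absolute value, with the sign. -/
def ofInt (n : ℤ) : R7 :=
  -- The coordinates of a root of `E₇` share a sign and have absolute value at most `4`, so one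
  -- signed decimal number encodes a root.
  if n < 0 then smul (-1) (ofDigits n.natAbs) else ofDigits n.natAbs

theorem toLat_add (r s : R7) : (r.add s).toLat = r.toLat + s.toLat := by
  funext i; fin_cases i <;> rfl

theorem toLat_smul (c : ℤ) (r : R7) : (smul c r).toLat = c • r.toLat := by
  funext i; fin_cases i <;> rfl

theorem toLat_zero : zero.toLat = 0 := by
  funext i; fin_cases i <;> rfl

theorem eq_of_beq {r s : R7} (h : r.beq s = true) : r = s := by
  simp only [beq, Bool.and_eq_true, beq_iff_eq] at h
  obtain ⟨⟨⟨⟨⟨⟨h0, h1⟩, h2⟩, h3⟩, h4⟩, h5⟩, h6⟩ := h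
  cases r; cases s
  simp_all

theorem ip_toLat (r s : R7) : ip r.toLat s.toLat = form r s := by
  simp [ip, toLat, form, Fin.sum_univ_succ, CartanMatrix.E₇]
  ring

theorem cocycleForm_toLat (r s : R7) : cocycleForm r.toLat s.toLat = coc r s := by
  simp [cocycleForm, toLat, coc, Fin.sum_univ_succ, CartanMatrix.E₇]
  ring

end R7

/-- A vector of the Lie algebra: an element `h_v` of the Cartan subalgebra and a linear combination
of root vectors. -/
structure Vec where
  /-- The part in the Cartan subalgebra. -/
  h : R7
  /-- The coefficients and roots. -/
  es : List (ℤ × R7)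

namespace Vec

/-- The sum. -/
def add (u v : Vec) : Vec := ⟨u.h.add v.h, u.es ++ v.es⟩

/-- An integral multiple. -/
def smul (c : ℤ) (v : Vec) : Vec := ⟨R7.smul c v.h, v.es.map fun p => (c * p.1, p.2)⟩

/-- The zero vector. -/
def zero : Vec := ⟨R7.zero, []⟩

/-- A linear combination. -/
def comb : List (ℤ × Vec) → Vec
  | [] => zero
  | p :: l => (smul p.1 p.2).add (comb l)

/-- Add a multiple of a root vector to a normalised list. -/
def insertTerm (p : ℤ × R7) : List (ℤ × R7) → List (ℤ × R7)
  | [] => [p]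
  | q :: l => if p.2.beq q.2 then (p.1 + q.1, q.2) :: l else q :: insertTerm p l

/-- Whether the coefficient is divisible by `3`. -/
def div3 (c : ℤ) : Bool := c % 3 == 0

/-- Whether a vector vanishes modulo `3`. -/
def isZero (v : Vec) : Bool :=
  div3 v.h.a0 && div3 v.h.a1 && div3 v.h.a2 && div3 v.h.a3 && div3 v.h.a4 && div3 v.h.a5 &&
    div3 v.h.a6 && (v.es.foldr insertTerm []).all fun p => div3 p.1

/-- Whether only roots occur. -/
def valid (v : Vec) : Bool := v.es.all fun p => R7.form p.2 p.2 == 2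

/-- The bracket of two multiples of root vectors. -/
def brTerm (p q : ℤ × R7) : Vec :=
  if R7.form p.2 q.2 = -2 then ⟨R7.smul (-(p.1 * q.1)) p.2, []⟩
  else if R7.form p.2 q.2 = -1 then
    ⟨R7.zero, [(if R7.coc p.2 q.2 % 2 = 0 then p.1 * q.1 else -(p.1 * q.1), p.2.add q.2)]⟩
  else zero

/-- The sum of a list of vectors. -/
def sum : List Vec → Vec
  | [] => zero
  | v :: l => v.add (sum l)

/-- The bracket. -/
def br (u v : Vec) : Vec :=
  (sum (u.es.map fun p => sum (v.es.map fun q => brTerm p q))).add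
    ⟨R7.zero, (v.es.map fun q => (q.1 * R7.form u.h q.2, q.2)) ++
      u.es.map fun p => (-(p.1 * R7.form v.h p.2), p.2)⟩

variable (k : Type*) [Field k]

/-- The vector of the Lie algebra that is described by lists. -/
noncomputable def den (v : Vec) : LieE7 k :=
  hvec k v.h.toLat + (v.es.map fun p => (p.1 : k) • evec k p.2.toLat).sum

variable {k}

theorem hvec_smul (c : ℤ) (v : Lat) : hvec k (c • v) = (c : k) • hvec k v := by
  simp [hvec, Finset.smul_sum, smul_smul]

theorem hvec_zero : hvec k 0 = 0 := by simp [hvec]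

theorem den_zero : den k zero = 0 := by simp [den, zero, R7.toLat_zero, hvec_zero]

theorem den_add (u v : Vec) : den k (u.add v) = den k u + den k v := by
  simp only [den, add, R7.toLat_add, hvec_add, List.map_append, List.sum_append]
  abel

theorem den_smul (c : ℤ) (v : Vec) : den k (smul c v) = (c : k) • den k v := by
  simp only [den, smul, R7.toLat_smul, hvec_smul, smul_add, List.smul_sum, List.map_map]
  congr 3
  funext p
  simp [mul_smul]

theorem den_comb (l : List (ℤ × Vec)) :
    den k (comb l) = (l.map fun p => (p.1 : k) • den k p.2).sum := by
  induction l with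
  | nil => simp [comb, den_zero]
  | cons p l ih => simp [comb, den_add, den_smul, ih]

theorem sum_insertTerm (p : ℤ × R7) (l : List (ℤ × R7)) :
    ((insertTerm p l).map fun p => (p.1 : k) • evec k p.2.toLat).sum =
      (p.1 : k) • evec k p.2.toLat + (l.map fun p => (p.1 : k) • evec k p.2.toLat).sum := by
  induction l with
  | nil => simp [insertTerm]
  | cons q l ih =>
    rw [insertTerm]
    split_ifs with h
    · rw [R7.eq_of_beq h]
      simp [add_smul, add_assoc]
    · simp only [List.map_cons, List.sum_cons, ih]
      abel

theorem sum_foldr_insertTerm (l : List (ℤ × R7)) :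
    ((l.foldr insertTerm []).map fun p => (p.1 : k) • evec k p.2.toLat).sum =
      (l.map fun p => (p.1 : k) • evec k p.2.toLat).sum := by
  induction l with
  | nil => rfl
  | cons p l ih => simp [sum_insertTerm, ih]

theorem lie_den_eq (u v : Vec) : ⁅den k u, den k v⁆ = lieBr k (den k u) (den k v) := rfl

theorem lieBr_hvec_hvec (v w : Lat) : lieBr k (hvec k v) (hvec k w) = 0 := by
  conv_lhs => rw [hvec]
  simp [lieBr_inl_hvec]

/-- The sum of two roots has norm `4 + 2 (p, q)`: it vanishes exactly when the product is `-2` and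
is a root exactly when it is `-1`. -/
theorem den_brTerm {p q : ℤ × R7} (hp : R7.form p.2 p.2 = 2) (hq : R7.form q.2 q.2 = 2) :
    den k (brTerm p q) =
      lieBr k ((p.1 : k) • evec k p.2.toLat) ((q.1 : k) • evec k q.2.toLat) := by
  have hpq := ip_add_self p.2.toLat q.2.toLat
  rw [R7.ip_toLat p.2 p.2, R7.ip_toLat q.2 q.2, R7.ip_toLat p.2 q.2, hp, hq] at hpq
  rw [map_smul, map_smul, LinearMap.smul_apply, lieBr_evec_evec (by rw [R7.ip_toLat, hp])
    (by rw [R7.ip_toLat, hq]), brTerm]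
  by_cases h0 : p.2.toLat + q.2.toLat = 0
  · have h1 : R7.form p.2 q.2 = -2 := by
      rw [h0] at hpq
      simp [ip] at hpq
      omega
    rw [if_pos h1, if_pos h0]
    simp only [den, R7.toLat_smul, hvec_smul, List.map_nil, List.sum_nil, add_zero]
    push_cast
    module
  · have h1 : R7.form p.2 q.2 ≠ -2 := fun h => h0 (eq_zero_of_ip_self _ (by omega))
    rw [if_neg h1, if_neg h0]
    by_cases h2 : R7.form p.2 q.2 = -1
    · rw [if_pos h2, R7.cocycleForm_toLat]
      by_cases h3 : R7.coc p.2 q.2 % 2 = 0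
      · rw [if_pos h3, sgn_even (Int.even_iff.2 h3)]
        simp [den, R7.toLat_zero, hvec_zero, R7.toLat_add, smul_smul, mul_comm]
      · rw [if_neg h3, sgn_odd (Int.odd_iff.2 (by omega))]
        simp [den, R7.toLat_zero, hvec_zero, R7.toLat_add, smul_smul, mul_comm]
    · rw [if_neg h2, evec_of_ne (by omega), den_zero]
      simp

theorem den_brTerm_sum {p : ℤ × R7} (hp : R7.form p.2 p.2 = 2) (l : List (ℤ × R7))
    (hl : ∀ q ∈ l, R7.form q.2 q.2 = 2) : den k (sum (l.map fun q => brTerm p q)) =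
      lieBr k ((p.1 : k) • evec k p.2.toLat)
        (l.map fun q => (q.1 : k) • evec k q.2.toLat).sum := by
  induction l with
  | nil => simp [sum, den_zero]
  | cons q l ih =>
    simp only [List.map_cons, sum, den_add, List.sum_cons, map_add]
    rw [ih fun q hq => hl q (List.mem_cons_of_mem _ hq), den_brTerm hp (hl q List.mem_cons_self)]

theorem den_brTerm_sum_sum (l m : List (ℤ × R7)) (hl : ∀ q ∈ l, R7.form q.2 q.2 = 2)
    (hm : ∀ q ∈ m, R7.form q.2 q.2 = 2) :
    den k (sum (l.map fun p => sum (m.map fun q => brTerm p q))) =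
      lieBr k (l.map fun q => (q.1 : k) • evec k q.2.toLat).sum
        (m.map fun q => (q.1 : k) • evec k q.2.toLat).sum := by
  induction l with
  | nil => simp [sum, den_zero]
  | cons q l ih =>
    simp only [List.map_cons, sum, den_add, List.sum_cons, map_add, LinearMap.add_apply]
    rw [ih fun q hq => hl q (List.mem_cons_of_mem _ hq),
      den_brTerm_sum (hl q List.mem_cons_self) m hm]

theorem lieBr_hvec_sum (h : R7) (l : List (ℤ × R7)) :
    lieBr k (hvec k h.toLat) (l.map fun q => (q.1 : k) • evec k q.2.toLat).sum =
      ((l.map fun q => (q.1 * R7.form h q.2, q.2)).map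
        fun q => (q.1 : k) • evec k q.2.toLat).sum := by
  induction l with
  | nil => simp
  | cons q l ih =>
    simp only [List.map_cons, List.sum_cons, map_add, ih, map_smul, lieBr_hvec_evec, R7.ip_toLat,
      smul_smul, Int.cast_mul]

theorem lieBr_sum_hvec (h : R7) (l : List (ℤ × R7)) :
    lieBr k (l.map fun q => (q.1 : k) • evec k q.2.toLat).sum (hvec k h.toLat) =
      ((l.map fun q => (-(q.1 * R7.form h q.2), q.2)).map
        fun q => (q.1 : k) • evec k q.2.toLat).sum := by
  induction l with
  | nil => simp
  | cons q l ih =>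
    simp only [List.map_cons, List.sum_cons, map_add, LinearMap.add_apply, ih, map_smul,
      LinearMap.smul_apply, lieBr_evec_hvec, R7.ip_toLat, smul_smul, Int.cast_mul, Int.cast_neg,
      smul_neg, neg_smul]

theorem den_br {u v : Vec} (hu : u.valid = true) (hv : v.valid = true) :
    den k (br u v) = ⁅den k u, den k v⁆ := by
  have hu' : ∀ q ∈ u.es, R7.form q.2 q.2 = 2 := by simpa [valid] using hu
  have hv' : ∀ q ∈ v.es, R7.form q.2 q.2 = 2 := by simpa [valid] using hv
  rw [lie_den_eq, br, den_add, den_brTerm_sum_sum _ _ hu' hv']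
  simp only [den, map_add, LinearMap.add_apply, lieBr_hvec_hvec, lieBr_hvec_sum, lieBr_sum_hvec,
    List.map_append, List.sum_append, R7.toLat_zero, hvec_zero]
  abel

variable [CharP k 3]

theorem intCast_eq_zero_of_div3 {c : ℤ} (h : div3 c = true) : (c : k) = 0 := by
  rw [CharP.intCast_eq_zero_iff k 3]
  exact Int.dvd_of_emod_eq_zero (by simpa [div3] using h)

theorem den_eq_zero {v : Vec} (h : v.isZero = true) : den k v = 0 := by
  simp only [isZero, Bool.and_eq_true, List.all_eq_true] at h
  obtain ⟨⟨⟨⟨⟨⟨⟨h0, h1⟩, h2⟩, h3⟩, h4⟩, h5⟩, h6⟩, hl⟩ := h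
  rw [den, ← sum_foldr_insertTerm, List.sum_eq_zero, add_zero]
  · rw [hvec]
    refine Finset.sum_eq_zero fun i _ => ?_
    have : ((v.h.toLat i : ℤ) : k) = 0 := by
      fin_cases i <;> exact intCast_eq_zero_of_div3 ‹_›
    rw [this, zero_smul]
  · simp only [List.mem_map]
    rintro _ ⟨p, hp, rfl⟩
    rw [intCast_eq_zero_of_div3 (hl p hp), zero_smul]

/-- Whether two vectors agree modulo `3`. -/
def eqv (u v : Vec) : Bool := (u.add (smul (-1) v)).isZero

theorem den_eq_of_eqv {u v : Vec} (h : eqv u v = true) : den k u = den k v := by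
  have := den_eq_zero (k := k) h
  rw [den_add, den_smul] at this
  simpa [sub_eq_zero, ← sub_eq_add_neg] using this

end Vec

end Computation


/-! ### The explicit maps, and their identities verified by evaluation. -/

section Tables

/-- The vector with Cartan part `h` and coefficients `1` and `-1` at the given roots. -/
def mk (h : ℤ) (p n : List ℤ) : Vec :=
  ⟨R7.ofInt h, (p.map fun r => (1, R7.ofInt r)) ++ n.map fun r => (-1, R7.ofInt r)⟩

/-- The images of the basis elements `el g i j` under `psi`. -/
def psiTable : List Vec := [
  mk 0 [112221, 1112211, 1122111] [],
  mk 0 [111111] [1011111],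
  mk 0 [] [111],
  mk 0 [1223221] [1123321],
  mk 0 [] [1112221, 1122211],
  mk 0 [1111111] [],
  mk 0 [2234321] [],
  mk 0 [1223321] [],
  mk 0 [1122221] [],
  mk 2010210 [] [],
  mk 0 [-1011000] [-111000, -101100, -1110],
  mk 0 [-1112100, -112110] [],
  mk 0 [101110] [11110, 1011100, 1111000],
  mk 0 [10000, 1000000] [10, 100],
  mk 0 [] [-11000, -1100],
  mk 0 [1112210, 1122110] [],
  mk 0 [] [111110, 1111100],
  mk 0 [110, 1010000] [],
  mk 0 [] [-1122111, -1112211, -112221],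
  mk 0 [-1123221] [-1223211],
  mk 0 [] [-1224321],
  mk 0 [-11111] [-101111],
  mk 0 [-1112111, -112211] [],
  mk 0 [-1123211] [],
  mk 0 [-1] [],
  mk 0 [-1111] [],
  mk 0 [] [-112111],
  mk 0 [-11110] [-1111000, -1011100, -111100, -101110],
  mk 0 [-1122100, -1112110, -112210] [],
  mk 0 [-1123210] [],
  mk 2200020 [] [],
  mk 0 [-1011000, -111000, -1110] [-101100],
  mk 0 [-1112100] [-112110],
  mk 0 [11110] [111100, 1011100],
  mk 0 [100, 10000] [],
  mk 0 [-101000] [],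
  mk 0 [1110, 11100, 101100, 1011000] [111000],
  mk 220200 [] [],
  mk 0 [-101100, -11100] [-111000],
  mk 0 [] [112210, 1112110, 1122100],
  mk 0 [1011100] [11110, 101110, 1111000],
  mk 0 [] [10, 1000000],
  mk 0 [] [1223210],
  mk 0 [1122110] [1112210],
  mk 0 [] [1011110]]

/-- The images of the basis elements `el g i j` under `U`. -/
def uTable : List Vec := [
  mk 0 [1112111] [112211],
  mk 0 [] [11111, 101111],
  mk 0 [] [11],
  mk 0 [1123221, 1223211] [],
  mk 0 [1112211] [1122111],
  mk 0 [111111] [],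
  mk 0 [] [1234321],
  mk 0 [] [1223221],
  mk 0 [1112221] [],
  mk 0 [-10000, -10] [-1000000, -100],
  mk 0 [-1011100, -101110] [-111100],
  mk 0 [-1122100] [-1112110],
  mk 0 [11100] [101100, 1011000],
  mk 20010 [] [],
  mk 0 [-11100] [-1011000],
  mk 0 [1122100] [1112110],
  mk 0 [111100] [1111000],
  mk 0 [10, 10000] [],
  mk 0 [-1112221] [-1122211],
  mk 0 [] [-1223221, -1123321],
  mk 0 [] [-1234321],
  mk 0 [-1011111, -111111] [],
  mk 0 [-1122111] [-1112211],
  mk 0 [-1123221] [],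
  mk 0 [] [-11],
  mk 0 [] [-11111],
  mk 0 [-1112111] [],
  mk 0 [-1011110, -111110] [-1111100],
  mk 0 [-1122110] [-1112210],
  mk 0 [-1223210] [],
  mk 0 [] [-1000000, -100000, -10],
  mk 0 [] [-1111000, -101110],
  mk 0 [-1112110] [],
  mk 0 [] [11100],
  mk 102000 [] [],
  mk 0 [-101100, -1110] [],
  mk 0 [11000, 101000] [1100],
  mk 0 [] [-100000, -10000, -100],
  mk 0 [] [-111100],
  mk 0 [112110] [1112100],
  mk 0 [] [1110, 1011000],
  mk 112010 [] [],
  mk 0 [1123210] [],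
  mk 0 [1112110] [],
  mk 0 [1011100, 1111000] []]

/-- The images of the monomials under `amap`. -/
def aTable : List Vec := [
  mk 0 [10, 100, 10000, 100000, 1000000] [],
  mk 0 [-101000, -11000] [-1100],
  mk 0 [-112100] [],
  mk 0 [111110, 1011110] [1111100],
  mk 0 [110] [1010000],
  mk 0 [-1000] [],
  mk 0 [1122210] [],
  mk 0 [1111110] [],
  mk 0 [] []]

/-- The images of `x₁ ^ i x₂ ^ j ⊗ s` under `T`. -/
def tTable : List Vec := [
  mk 0 [112111] [],
  mk 0 [] [1111],
  mk 0 [] [1],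
  mk 0 [] [1123211],
  mk 0 [] [1112111],
  mk 0 [101111] [],
  mk 0 [1224321] [],
  mk 0 [1223211] [],
  mk 0 [112221] [],
  mk 0 [] [-1010000, -110],
  mk 0 [-1011110] [-111110],
  mk 0 [-1122110] [],
  mk 0 [101000] [11000],
  mk 0 [-10] [-10000],
  mk 0 [] [-1011100],
  mk 0 [1112100] [],
  mk 0 [] [111000],
  mk 102011 [] [],
  mk 0 [] [-1122221],
  mk 0 [] [-1223321],
  mk 0 [] [-2234321],
  mk 0 [] [-1111111],
  mk 0 [-1122211] [],
  mk 0 [-1123321] [],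
  mk 0 [-111] [],
  mk 0 [-1011111] [],
  mk 0 [] [-1122111]]

/-- The images of the monomials under `T`. -/
def tFunTable : List Vec := [
  mk 0 [] [],
  mk 0 [] [-1111110],
  mk 0 [] [-1122210],
  mk 0 [] [1000],
  mk 0 [-110] [-1010000],
  mk 0 [-1111100, -1011110] [-111110],
  mk 0 [] [112100],
  mk 0 [1100, 101000] [11000],
  mk 0 [-10000, -10] []]

/-- For each monomial except `x₁² x₂²`, a root that occurs in its image under `amap`, with its
    sign. -/
def aPivots : List (ℤ × ℤ) := [(1, 1000000), (-1, -1100), (1, -112100), (1, 1011110), (1, 110),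
    (1, -1000), (1, 1122210), (1, 1111110)]

/-- The roots. -/
def rootTable : List R7 := List.map R7.ofInt [-1224321, 111, -1123211, 1111111, -1, 2234321,
    -1111, 1223321, -112111, 1122221, -1123210, -101000, 1223210, 1011110, -112100, -1000,
    1122210, 1111110, -1234321, 11, -1123221, 111111, -11, 1234321, -11111, 1223221, -1112111,
    1112221, 112111, 110, 1010000, 100000, 1000000, -11000, 10, -1100, 1111100, 111110, 100,
    111100, 10000, -11100, -1112100, 1112210, -1112210, -1011100, 112110, 111000, 11111, 1123221,
    -1122210, -1011110, 112100, 101000, -1000000, 112221, 1122111, 1112111, 101111, 1223211,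
    112211, 1224321, -1112211, -101100, -1112221, -1123321, -112210, -1110, -1112110, -1011111,
    -1011000, 101110, 11110, -1122211, 1122110, 1112110, 112210, 1111000, -1223210, 11100,
    1011111, 1122211, 1123321, -111100, 1123210, -1122221, -2234321, -1122100, -11110, -1122110,
    -10000, 101100, 1122100, 1112100, 1112211, -112211, -100, -101111, 11000, -112221, -110,
    -112110, 1, -1223211, -1111100, -1122111, -1010000, -111, -1223221, -111000, -1111110, 1111,
    -1111000, 1011100, 1123211, -101110, -1111111, 1110, -111111, 1000, -1223321, -100000,
    1011000, -111110, -10, 1100]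

/-- Root vectors, up to sign, among the images of `psi`, `amap` and `U`: the number of the table,
the position in the table, and the sign. -/
def initTable : List (ℕ × ℕ × ℤ) := [(0, 20, -1), (0, 2, -1), (0, 23, 1), (0, 5, 1), (0, 24, 1),
    (0, 6, 1), (0, 25, 1), (0, 7, 1), (0, 26, -1), (0, 8, 1), (0, 29, 1), (0, 35, 1), (0, 42, -1),
    (0, 44, -1), (1, 2, 1), (1, 5, 1), (1, 6, 1), (1, 7, 1), (2, 20, -1), (2, 2, -1), (2, 23, 1),
    (2, 5, 1), (2, 24, -1), (2, 6, -1), (2, 25, -1), (2, 7, -1), (2, 26, 1), (2, 8, 1)]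

/-- The positions in `rootTable` of two roots whose sum is the next root. -/
def stepTable : List (ℕ × ℕ) := [(4, 1), (5, 0), (12, 10), (18, 5), (18, 7), (19, 4), (19, 6),
    (20, 5), (21, 4), (22, 1), (22, 21), (23, 0), (24, 19), (26, 19), (27, 22), (28, 0), (28, 2),
    (28, 4), (28, 6), (28, 11), (28, 13), (28, 18), (28, 20), (28, 22), (28, 24), (28, 26), (29,
    28), (30, 28), (32, 28), (33, 28), (36, 28), (38, 28), (43, 28), (44, 4), (44, 13), (44, 22),
    (44, 24), (44, 32), (44, 36), (44, 38), (45, 22), (45, 38), (45, 43), (46, 11), (46, 18), (46,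
    30), (46, 32), (46, 38), (47, 32), (48, 18), (48, 22), (48, 32), (48, 36), (48, 43), (49, 18),
    (49, 22), (50, 22), (50, 26), (50, 29), (50, 36), (50, 38), (50, 43), (51, 43), (52, 30), (52,
    32), (57, 38), (62, 32), (62, 57), (63, 22), (63, 52), (64, 32), (64, 57), (66, 38), (66, 60),
    (72, 18), (72, 50), (73, 38), (73, 60), (75, 64), (78, 22), (78, 43), (78, 52), (78, 61), (78,
    76), (79, 32), (79, 57), (79, 66), (79, 73), (82, 73), (83, 22), (83, 52), (83, 64), (83, 79),
    (84, 66), (85, 80), (85, 81), (85, 82)]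

/-- The entry of a table for `g` and the monomial `x₁ ^ i x₂ ^ j`. -/
def entry (t : List Vec) (g i j : ℕ) : Vec :=
  -- The zero default for exponents from `3` on matches the vanishing of these monomials.
  if i < 3 ∧ j < 3 then t.getD (9 * g + 3 * i + j) Vec.zero else Vec.zero

/-- The coefficient of a root vector. -/
def Vec.coeff (v : Vec) (r : R7) : ℤ := (v.es.map fun p => if p.2.beq r then p.1 else 0).sum

/-- The sign and the root in `aPivots`. -/
def pivot (m : ℕ) : ℤ × R7 := ((aPivots.getD m (0, 0)).1, R7.ofInt (aPivots.getD m (0, 0)).2)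

/-- The combination of images of monomials under `amap` with the same coefficients at `aPivots`. -/
def aPart (v : Vec) : Vec :=
  Vec.comb ((List.range 8).map fun m =>
    ((pivot m).1 * v.coeff (pivot m).2, entry aTable 0 (m / 3) (m % 3)))

/-- Whether two vectors agree modulo the image of `amap`. -/
def eqvA (u v : Vec) : Bool :=
  let w := u.add (Vec.smul (-1) v)
  -- Each pivot root occurs in the image of a single monomial, so the only possible coefficients are
  -- read off at the pivots without solving equations.
  w.isZero || Vec.eqv w (aPart w)

/-- The combination of entries of a table. -/
def entryComb (t : List Vec) (l : List (ℤ × ℕ × ℕ × ℕ)) : Vec :=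
  Vec.comb (l.map fun c => (c.1, entry t c.2.1 c.2.2.1 c.2.2.2))

/-- A statement about all `g < n` and `i, j < 3`. -/
def forEl (n : ℕ) (P : ℕ → ℕ → ℕ → Bool) : Bool :=
  (List.range n).all fun g => (List.range 3).all fun i => (List.range 3).all fun j => P g i j

theorem forEl_iff {n : ℕ} {P : ℕ → ℕ → ℕ → Bool} : forEl n P = true ↔
    ∀ g < n, ∀ i < 3, ∀ j < 3, P g i j = true := by
  simp [forEl]

theorem valid_psiTable : psiTable.all Vec.valid = true := by decide +kernel

theorem valid_uTable : uTable.all Vec.valid = true := by decide +kernel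

theorem valid_aTable : aTable.all Vec.valid = true := by decide +kernel

theorem valid_tTable : tTable.all Vec.valid = true := by decide +kernel

theorem valid_tFunTable : tFunTable.all Vec.valid = true := by decide +kernel

/-- Only `g ≤ h` is evaluated; skew symmetry supplies the remaining brackets. -/
theorem psiTable_br : (forEl 5 fun g i j => forEl 5 fun h p q => Nat.blt h g ||
    eqvA (Vec.br (entry psiTable g i j) (entry psiTable h p q))
      (entryComb psiTable (elBr g i j h p q))) = true := by
  decide +kernel

theorem psiTable_br_aTable : (forEl 5 fun g i j => forEl 1 fun h p q =>
    eqvA (Vec.br (entry psiTable g i j) (entry aTable h p q)) Vec.zero) = true := by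
  decide +kernel

theorem aTable_br_aTable : (forEl 1 fun g i j => forEl 1 fun h p q =>
    (Vec.br (entry aTable g i j) (entry aTable h p q)).isZero) = true := by
  decide +kernel

/-- The right side is the divergence: zero on `sl(2) ⊗ O(2;1)`, and a partial derivative of the
monomial for `∂₁` and `∂₂`. -/
theorem psiTable_br_e : (forEl 5 fun g i j =>
    Vec.eqv (Vec.br (entry psiTable g i j) (entry aTable 0 0 0))
      (if g < 3 then Vec.zero else if g = 3 then Vec.smul i (entry aTable 0 (i - 1) j)
        else Vec.smul j (entry aTable 0 i (j - 1)))) = true := by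
  decide +kernel

theorem uTable_br_e : (forEl 5 fun g i j =>
    Vec.eqv (Vec.br (entry uTable g i j) (entry aTable 0 0 0)) (entry psiTable g i j)) = true := by
  decide +kernel

theorem tTable_br_e : (forEl 3 fun g i j =>
    Vec.eqv (Vec.br (entry tTable g i j) (entry aTable 0 0 0)) (entry uTable g i j)) = true := by
  decide +kernel

/-- The combination comes from the Hamiltonian field `j x₁^i x₂^(j-1) ∂₁ - i x₁^(i-1) x₂^j ∂₂` of
the monomial. -/
theorem tFunTable_br_e : (forEl 1 fun g i j =>
    Vec.eqv (Vec.br (entry tFunTable g i j) (entry aTable 0 0 0))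
      (Vec.comb [(j, entry uTable 3 i (j - 1)), (-i, entry uTable 4 (i - 1) j)])) = true := by
  decide +kernel

/-- Eight pivots against nine monomials: the coefficient matrix is diagonal apart from a zero column
for `x₁² x₂²`. -/
theorem coeff_aTable : ((List.range 8).all fun m => (List.range 9).all fun n =>
    (entry aTable 0 (n / 3) (n % 3)).coeff (pivot m).2 ==
      if m = n then (pivot m).1 else 0) = true := by
  decide +kernel

theorem pivot_valid : ((List.range 8).all fun m => R7.form (pivot m).2 (pivot m).2 == 2 &&
    ((pivot m).1 == 1 || (pivot m).1 == -1)) = true := by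
  decide +kernel

/-- The tables of which `initTable` speaks. -/
def initVec (g n : ℕ) : Vec := (if g = 0 then psiTable else if g = 1 then aTable else uTable).getD n Vec.zero

theorem initTable_spec : ((List.range 28).all fun m =>
    let t := initTable.getD m (0, 0, 0)
    -- The bound `27` keeps to `U` on `sl(2) ⊗ O(2;1)`, the only values of `U` available in the
    -- generation argument.
    t.1 < 3 && (if t.1 = 0 then t.2.1 < 45 else if t.1 = 1 then t.2.1 < 9 else t.2.1 < 27) &&
    (t.2.2 == 1 || t.2.2 == -1) &&
    Vec.eqv (initVec t.1 t.2.1) ⟨R7.zero, [(t.2.2, rootTable.getD m R7.zero)]⟩) = true := by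
  decide +kernel

/-- Root number `28` is produced from `U (1 ⊗ e)` and `U (1 ⊗ h)`, neither of which is a multiple of
a root vector. -/
theorem br_uTable_spec : Vec.eqv (Vec.br (entry uTable 0 0 0) (entry uTable 1 0 0))
    ⟨R7.zero, [(-1, rootTable.getD 28 R7.zero)]⟩ = true := by
  decide +kernel

/-- The remaining `97 = 126 - 29` roots are each a sum of two roots that precede them in the list.
-/
theorem stepTable_spec : ((List.range 97).all fun m =>
    let t := stepTable.getD m (0, 0)
    t.1 < m + 29 && t.2 < m + 29 &&
    R7.form (rootTable.getD t.1 R7.zero) (rootTable.getD t.2 R7.zero) == -1 &&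
    (rootTable.getD (m + 29) R7.zero).beq
      ((rootTable.getD t.1 R7.zero).add (rootTable.getD t.2 R7.zero))) = true := by
  decide +kernel

theorem valid_rootTable : (rootTable.all fun r => R7.form r r == 2) = true := by decide +kernel

/-- The possible coefficients of roots. -/
def coeffRange : List ℤ := [-4, -3, -2, -1, 0, 1, 2, 3, 4]

/-- By `ip_self_sum_sq` a root makes a sum of weighted squares equal to `24`. Each new coordinate
after the first completes one more square, and a partial sum above `24` prunes the search. -/
theorem mem_rootTable : (coeffRange.all fun a3 => coeffRange.all fun a4 =>
    let s1 := a3 ^ 2 + (4 * a4 - 3 * a3) ^ 2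
    24 < s1 || coeffRange.all fun a5 =>
    let s2 := s1 + 2 * (3 * a5 - 2 * a4) ^ 2
    24 < s2 || coeffRange.all fun a6 =>
    let s3 := s2 + 6 * (2 * a6 - a5) ^ 2
    24 < s3 || coeffRange.all fun a1 =>
    let s4 := s3 + 6 * (2 * a1 - a3) ^ 2
    24 < s4 || coeffRange.all fun a2 =>
    let s5 := s4 + 2 * (3 * a2 - 2 * a3) ^ 2
    24 < s5 || coeffRange.all fun a0 =>
    let s6 := s5 + 6 * (2 * a0 - a2) ^ 2
    s6 != 24 || rootTable.any fun r => r.beq ⟨a0, a1, a2, a3, a4, a5, a6⟩) = true := by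
  decide +kernel

end Tables


/-! ### Completeness of the list of roots, and the dimension bound. -/

section Roots

namespace R7

theorem beq_iff {r s : R7} : r.beq s = true ↔ r.toLat = s.toLat := by
  refine ⟨fun h => by rw [eq_of_beq h], fun h => ?_⟩
  have h' : ∀ i, r.toLat i = s.toLat i := fun i => congrFun h i
  have h0 : r.a0 = s.a0 := h' 0
  have h1 : r.a1 = s.a1 := h' 1
  have h2 : r.a2 = s.a2 := h' 2
  have h3 : r.a3 = s.a3 := h' 3
  have h4 : r.a4 = s.a4 := h' 4
  have h5 : r.a5 = s.a5 := h' 5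
  have h6 : r.a6 = s.a6 := h' 6
  simp [beq, h0, h1, h2, h3, h4, h5, h6]

end R7

theorem mem_coeffRange {a : ℤ} (h : -4 ≤ a) (h' : a ≤ 4) : a ∈ coeffRange := by
  interval_cases a <;> decide

theorem le_of_sq_le {x n m : ℤ} (hm : 0 ≤ m) (h : x ^ 2 ≤ n) (hn : n < (m + 1) ^ 2) :
    -m ≤ x ∧ x ≤ m := by
  have := abs_lt_of_sq_lt_sq' (h.trans_lt hn) (by omega)
  omega

theorem exists_mem_rootTable {v : Lat} (hv : ip v v = 2) : ∃ r ∈ rootTable, r.toLat = v := by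
  have h := ip_self_sum_sq v
  rw [hv] at h
  have q1 := sq_nonneg (2 * v 0 - v 2)
  have q2 := sq_nonneg (3 * v 2 - 2 * v 3)
  have q3 := sq_nonneg (2 * v 1 - v 3)
  have q4 := sq_nonneg (2 * v 6 - v 5)
  have q5 := sq_nonneg (3 * v 5 - 2 * v 4)
  have q6 := sq_nonneg (4 * v 4 - 3 * v 3)
  have q7 := sq_nonneg (v 3)
  have b1 := le_of_sq_le (x := 2 * v 0 - v 2) (n := 4) (m := 2) (by norm_num) (by linarith) (by norm_num)
  have b2 := le_of_sq_le (x := 3 * v 2 - 2 * v 3) (n := 12) (m := 3) (by norm_num) (by linarith)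
    (by norm_num)
  have b3 := le_of_sq_le (x := 2 * v 1 - v 3) (n := 4) (m := 2) (by norm_num) (by linarith) (by norm_num)
  have b4 := le_of_sq_le (x := 2 * v 6 - v 5) (n := 4) (m := 2) (by norm_num) (by linarith) (by norm_num)
  have b5 := le_of_sq_le (x := 3 * v 5 - 2 * v 4) (n := 12) (m := 3) (by norm_num) (by linarith)
    (by norm_num)
  have b6 := le_of_sq_le (x := 4 * v 4 - 3 * v 3) (n := 24) (m := 4) (by norm_num) (by linarith)
    (by norm_num)
  have b7 := le_of_sq_le (x := v 3) (n := 24) (m := 4) (by norm_num) (by linarith) (by norm_num)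
  -- The bounds on the squares propagate from `v 3` to its neighbours along the diagram and keep
  -- every coordinate within `4`.
  have m3 := mem_coeffRange (a := v 3) (by omega) (by omega)
  have m4 := mem_coeffRange (a := v 4) (by omega) (by omega)
  have m5 := mem_coeffRange (a := v 5) (by omega) (by omega)
  have m6 := mem_coeffRange (a := v 6) (by omega) (by omega)
  have m1 := mem_coeffRange (a := v 1) (by omega) (by omega)
  have m2 := mem_coeffRange (a := v 2) (by omega) (by omega)
  have m0 := mem_coeffRange (a := v 0) (by omega) (by omega)
  have step : ∀ {s : ℤ} {P : ℤ → Bool} {a : ℤ}, (decide (24 < s) || coeffRange.all P) = true →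
      s ≤ 24 → a ∈ coeffRange → P a = true := by
    intro s P a h1 h2 h3
    rw [decide_eq_false (not_lt.2 h2), Bool.false_or] at h1
    exact List.all_eq_true.1 h1 a h3
  have t := List.all_eq_true.1 (List.all_eq_true.1 mem_rootTable (v 3) m3) (v 4) m4
  have t := step t (by linarith) m5
  have t := step t (by linarith) m6
  have t := step t (by linarith) m1
  have t := step t (by linarith) m2
  have t := step t (by linarith) m0
  rcases (Bool.or_eq_true _ _).mp t with t | t
  · exact absurd (show _ = (24 : ℤ) by linarith) (bne_iff_ne.1 t)
  · obtain ⟨r, hr, hb⟩ := List.any_eq_true.1 t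
    refine ⟨r, hr, ?_⟩
    rw [R7.eq_of_beq hb]
    funext i
    fin_cases i <;> rfl

/-- The entries of `rootTable`. -/
def rt (m : ℕ) : R7 := rootTable.getD m R7.zero

theorem exists_rt {v : Lat} (hv : ip v v = 2) : ∃ m < 126, (rt m).toLat = v := by
  obtain ⟨r, hr, rfl⟩ := exists_mem_rootTable hv
  obtain ⟨m, hm, rfl⟩ := List.getElem_of_mem hr
  exact ⟨m, hm, by rw [rt, List.getD_eq_getElem _ _ hm]⟩

theorem ip_rt {m : ℕ} (hm : m < 126) : ip (rt m).toLat (rt m).toLat = 2 := by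
  have hm' : m < rootTable.length := hm
  rw [R7.ip_toLat, rt, List.getD_eq_getElem _ _ hm']
  exact beq_iff_eq.1 (List.all_eq_true.1 valid_rootTable _ (List.getElem_mem hm'))

theorem rt_surjective : Function.Surjective fun m : Fin 126 => (⟨(rt m).toLat, ip_rt m.2⟩ : Root) := by
  rintro ⟨v, hv⟩
  obtain ⟨m, hm, h⟩ := exists_rt hv
  exact ⟨⟨m, hm⟩, Subtype.ext h⟩

instance : Finite Root := Finite.of_surjective _ rt_surjective

instance (k : Type*) [Field k] : FiniteDimensional k (LieE7 k) :=
  (chevalleyBasis k).finiteDimensional_of_finite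

/-- Only the upper bound `7 + 126` is required, so repetitions in the list need not be excluded. -/
theorem finrank_lieE7_le (k : Type*) [Field k] : Module.finrank k (LieE7 k) ≤ 133 := by
  have : Nat.card Root ≤ Nat.card (Fin 126) := Nat.card_le_card_of_surjective _ rt_surjective
  rw [Nat.card_fin] at this
  rw [Module.finrank_eq_nat_card_basis (chevalleyBasis k), Nat.card_sum, Nat.card_fin]
  omega

end Roots

/-! ### Linear maps defined by the tables. -/

section Maps

variable (k : Type*) [Field k]

theorem valid_entry {t : List Vec} (h : t.all Vec.valid = true) (g i j : ℕ) :
    (entry t g i j).valid = true := by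
  rw [entry]
  split_ifs
  · rcases lt_or_ge (9 * g + 3 * i + j) t.length with hn | hn
    · rw [List.getD_eq_getElem _ _ hn]
      exact List.all_eq_true.1 h _ (List.getElem_mem hn)
    · rw [List.getD_eq_default _ _ hn]
      rfl
  · rfl

theorem getD_eq_entry (t : List Vec) (n : ℕ) :
    t.getD n Vec.zero = entry t (n / 9) (n / 3 % 3) (n % 3) := by
  rw [entry, if_pos ⟨by omega, by omega⟩]
  congr 1
  omega

/-- The linear map on `O(2;1)` that is described by a table. -/
noncomputable def funMap (t : List Vec) : TruncPoly k →ₗ[k] LieE7 k :=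
  (tmonBasis k).constr k fun p => Vec.den k (entry t 0 p.1 p.2)

variable {k}

theorem funMap_tmon (t : List Vec) (i j : ℕ) :
    funMap k t (tmon k i j) = Vec.den k (entry t 0 i j) := by
  by_cases h : i < 3 ∧ j < 3
  · have := (tmonBasis k).constr_basis k (fun p => Vec.den k (entry t 0 p.1 p.2))
      (⟨i, h.1⟩, ⟨j, h.2⟩)
    rwa [tmonBasis_apply] at this
  · rw [entry, if_neg h, Vec.den_zero]
    have : tmon k i j = 0 := by
      rcases lt_or_ge i 3 with hi | hi
      · exact tmon_eq_zero_right _ (by omega)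
      · exact tmon_eq_zero_left hi _
    rw [this, map_zero]

theorem tmon_induction {P : TruncPoly k → Prop} (h0 : P 0) (ha : ∀ x y, P x → P y → P (x + y))
    (hs : ∀ (c : k) x, P x → P (c • x)) (hb : ∀ i < 3, ∀ j < 3, P (tmon k i j))
    (x : TruncPoly k) : P x := by
  have hx := (tmonBasis k).mem_span x
  induction hx using Submodule.span_induction with
  | mem x hx =>
    obtain ⟨p, rfl⟩ := hx
    rw [tmonBasis_apply]
    exact hb _ p.1.2 _ p.2.2
  | zero => exact h0
  | add x y _ _ hx hy => exact ha x y hx hy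
  | smul c x _ hx => exact hs c x hx

theorem rootCoord_evec (r : R7) (hr : ip r.toLat r.toLat = 2) (s : R7)
    (hs : R7.form s s = 2) :
    (chevalleyBasis k).coord (Sum.inr ⟨r.toLat, hr⟩) (evec k s.toLat) =
      if s.beq r then 1 else 0 := by
  have hs' : ip s.toLat s.toLat = 2 := by rw [R7.ip_toLat, hs]
  have hb : ∀ i, bv k i = chevalleyBasis k i := fun i =>
    (Finsupp.coe_basisSingleOne (R := k) ▸ rfl)
  rw [evec_root ⟨s.toLat, hs'⟩, hb, Module.Basis.coord_apply, Module.Basis.repr_self,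
    Finsupp.single_apply]
  congr 1
  simp [R7.beq_iff]

theorem rootCoord_den (r : R7) (hr : ip r.toLat r.toLat = 2) {v : Vec} (hv : v.valid = true) :
    (chevalleyBasis k).coord (Sum.inr ⟨r.toLat, hr⟩) (Vec.den k v) = (v.coeff r : k) := by
  have hb : ∀ i, bv k i = chevalleyBasis k i := fun i =>
    (Finsupp.coe_basisSingleOne (R := k) ▸ rfl)
  have hh : (chevalleyBasis k).coord (Sum.inr ⟨r.toLat, hr⟩) (hvec k v.h.toLat) = 0 := by
    simp [hvec, hb]
  have hv' : ∀ q ∈ v.es, R7.form q.2 q.2 = 2 := by simpa [Vec.valid] using hv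
  rw [Vec.den, map_add, hh, zero_add, Vec.coeff]
  generalize v.es = l at hv'
  induction l with
  | nil => simp
  | cons q l ih =>
    simp only [List.map_cons, List.sum_cons, map_add, map_smul, Int.cast_add]
    rw [ih fun q hq => hv' q (List.mem_cons_of_mem _ hq),
      rootCoord_evec r hr q.2 (hv' q List.mem_cons_self)]
    congr 1
    split_ifs <;> simp

theorem den_aPart_mem (v : Vec) : Vec.den k (aPart v) ∈ LinearMap.range (funMap k aTable) := by
  rw [aPart, Vec.den_comb, List.map_map]
  refine list_sum_mem ?_
  simp only [List.mem_map]
  rintro _ ⟨m, -, rfl⟩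
  refine Submodule.smul_mem _ _ ⟨tmon k (m / 3) (m % 3), funMap_tmon _ _ _⟩

theorem den_entry_aTable : Vec.den k (entry aTable 0 0 0) = nilRep k := by
  have h : entry aTable 0 0 0 = ⟨R7.zero, [(1, ⟨0, 0, 0, 0, 0, 1, 0⟩), (1, ⟨0, 0, 0, 0, 1, 0, 0⟩),
    (1, ⟨0, 0, 1, 0, 0, 0, 0⟩), (1, ⟨0, 1, 0, 0, 0, 0, 0⟩), (1, ⟨1, 0, 0, 0, 0, 0, 0⟩)]⟩ := rfl
  have e : ∀ (r : R7) (i : Fin 7), r.toLat = simpleRoot i → evec k r.toLat = evec k (simpleRoot i) :=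
    fun r i h => by rw [h]
  rw [h, Vec.den, nilRep]
  simp only [List.map_cons, List.map_nil, List.sum_cons, List.sum_nil, Int.cast_one, one_smul,
    R7.toLat_zero, Vec.hvec_zero]
  rw [e _ 5 (by decide), e _ 4 (by decide), e _ 2 (by decide), e _ 1 (by decide), e _ 0 (by decide)]
  abel

/-- The coordinate at each pivot root isolates one coefficient of `f` up to sign; only the
coefficient of `x₁² x₂²` has no pivot. -/
theorem funMap_aTable_ker {f : TruncPoly k} (hf : funMap k aTable f = 0) :
    f ∈ Submodule.span k {tmon k 2 2} := by
  have hz : ∀ p : Fin 3 × Fin 3, 3 * p.1.val + p.2.val < 8 → (tmonBasis k).repr f p = 0 := by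
    intro p hp
    set m := 3 * p.1.val + p.2.val with hm
    have hv := List.all_eq_true.1 pivot_valid m (List.mem_range.2 hp)
    rw [Bool.and_eq_true, Bool.or_eq_true, beq_iff_eq, beq_iff_eq, beq_iff_eq] at hv
    have hr : ip (pivot m).2.toLat (pivot m).2.toLat = 2 := by rw [R7.ip_toLat, hv.1]
    have hc := congrArg ((chevalleyBasis k).coord (Sum.inr ⟨_, hr⟩)) hf
    rw [← (tmonBasis k).sum_repr f, map_sum, map_sum, map_zero, Finset.sum_eq_single p] at hc
    · rw [tmonBasis_apply, map_smul, funMap_tmon, map_smul,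
        rootCoord_den _ hr (valid_entry valid_aTable _ _ _)] at hc
      have h := List.all_eq_true.1 (List.all_eq_true.1 coeff_aTable m (List.mem_range.2 hp)) m
        (List.mem_range.2 (by omega))
      have e1 : m / 3 = p.1 := by omega
      have e2 : m % 3 = p.2 := by omega
      rw [beq_iff_eq, if_pos rfl, e1, e2] at h
      rw [h] at hc
      rcases hv.2 with h1 | h1 <;> simpa [h1] using hc
    · intro q _ hq
      rw [tmonBasis_apply, map_smul, funMap_tmon, map_smul,
        rootCoord_den _ hr (valid_entry valid_aTable _ _ _)]
      set n := 3 * q.1.val + q.2.val with hn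
      have h := List.all_eq_true.1 (List.all_eq_true.1 coeff_aTable m (List.mem_range.2 hp)) n
        (List.mem_range.2 (by omega))
      have e1 : n / 3 = q.1 := by omega
      have e2 : n % 3 = q.2 := by omega
      have hmn : m ≠ n := fun h => hq (Prod.ext (Fin.ext (by omega)) (Fin.ext (by omega)))
      rw [beq_iff_eq, if_neg hmn, e1, e2] at h
      rw [h, Int.cast_zero, smul_zero]
    · simp
  rw [← (tmonBasis k).sum_repr f, Finset.sum_eq_single (2, 2)]
  · rw [tmonBasis_apply]
    exact Submodule.smul_mem _ _ (Submodule.mem_span_singleton_self _)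
  · rintro p - hp
    rw [hz p, zero_smul]
    by_contra h
    exact hp (Prod.ext (Fin.ext (by simp; omega)) (Fin.ext (by simp; omega)))
  · simp

variable (k) [CharP k 3]

/-- The linear map on `(sl(2) ⊗ O(2;1)) ⋊ W(2;1)` that is described by a table. -/
noncomputable def tableMap (t : List Vec) : SlTruncWitt k →ₗ[k] LieE7 k :=
  (elBasis k).constr k fun p => Vec.den k (entry t p.1 p.2.1 p.2.2)

variable {k}

theorem tableMap_el (t : List Vec) {g : ℕ} (hg : g < 5) (i j : ℕ) :
    tableMap k t (el k g i j) = Vec.den k (entry t g i j) := by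
  by_cases h : i < 3 ∧ j < 3
  · have := (elBasis k).constr_basis k (fun p => Vec.den k (entry t p.1 p.2.1 p.2.2))
      (⟨g, hg⟩, ⟨i, h.1⟩, ⟨j, h.2⟩)
    rwa [elBasis_apply] at this
  · rw [entry, if_neg h, Vec.den_zero, el_eq_zero g (by omega), map_zero]

theorem el_induction {P : SlTruncWitt k → Prop} (h0 : P 0) (ha : ∀ x y, P x → P y → P (x + y))
    (hs : ∀ (c : k) x, P x → P (c • x)) (hb : ∀ g < 5, ∀ i < 3, ∀ j < 3, P (el k g i j))
    (x : SlTruncWitt k) : P x := by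
  have hx := (elBasis k).mem_span x
  induction hx using Submodule.span_induction with
  | mem x hx =>
    obtain ⟨p, rfl⟩ := hx
    rw [elBasis_apply]
    exact hb _ p.1.2 _ p.2.1.2 _ p.2.2.2
  | zero => exact h0
  | add x y _ _ hx hy => exact ha x y hx hy
  | smul c x _ hx => exact hs c x hx

theorem den_sub_mem {u v : Vec} (h : eqvA u v = true) :
    Vec.den k u - Vec.den k v ∈ LinearMap.range (funMap k aTable) := by
  have e : Vec.den k u - Vec.den k v = Vec.den k (u.add (Vec.smul (-1) v)) := by
    rw [Vec.den_add, Vec.den_smul]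
    simp [sub_eq_add_neg]
  rw [e]
  rcases (Bool.or_eq_true _ _).mp h with h | h
  · rw [Vec.den_eq_zero h]
    exact zero_mem _
  · rw [Vec.den_eq_of_eqv h]
    exact den_aPart_mem _

end Maps

/-! ### From identities on basis elements to identities of linear maps. -/

section Data

variable {k : Type*} [Field k] [CharP k 3]

theorem elBr_lt {g h : ℕ} (hg : g < 5) (hh : h < 5) (i j p q : ℕ) {t : ℤ × ℕ × ℕ × ℕ}
    (ht : t ∈ elBr g i j h p q) : t.2.1 < 5 := by
  rw [elBr, List.mem_append] at ht
  rcases ht with ht | ht <;> split_ifs at ht <;> simp at ht <;> subst ht <;> simp <;> omega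

theorem den_entryComb {g h : ℕ} (hg : g < 5) (hh : h < 5) (i j p q : ℕ) (t : List Vec) :
    Vec.den k (entryComb t (elBr g i j h p q)) = tableMap k t ⁅el k g i j, el k h p q⁆ := by
  rw [el_lie hg hh, map_list_sum, entryComb, Vec.den_comb, List.map_map, List.map_map]
  congr 1
  refine List.map_congr_left fun c hc => ?_
  simp only [Function.comp_apply, map_smul]
  rw [tableMap_el _ (elBr_lt hg hh i j p q hc)]

theorem lie_psiMap (X Y : SlTruncWitt k) :
    ⁅tableMap k psiTable X, tableMap k psiTable Y⁆ - tableMap k psiTable ⁅X, Y⁆ ∈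
      LinearMap.range (funMap k aTable) := by
  have key : ∀ g < 5, ∀ i < 3, ∀ j < 3, ∀ h < 5, ∀ p < 3, ∀ q < 3, g ≤ h →
      ⁅tableMap k psiTable (el k g i j), tableMap k psiTable (el k h p q)⁆ -
        tableMap k psiTable ⁅el k g i j, el k h p q⁆ ∈ LinearMap.range (funMap k aTable) := by
    intro g hg i hi j hj h hh p hp q hq hgh
    have hb := forEl_iff.1 (forEl_iff.1 psiTable_br g hg i hi j hj) h hh p hp q hq
    have hlt : Nat.blt h g = false := by
      rw [Bool.eq_false_iff, Ne, Nat.blt_eq]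
      omega
    rw [hlt, Bool.false_or] at hb
    have := den_sub_mem (k := k) hb
    rwa [Vec.den_br (valid_entry valid_psiTable _ _ _) (valid_entry valid_psiTable _ _ _),
      den_entryComb hg hh, ← tableMap_el _ hg, ← tableMap_el _ hh] at this
  induction X using el_induction with
  | h0 =>
    rw [map_zero, zero_lie, zero_lie, map_zero, sub_zero]
    exact zero_mem _
  | ha X X' h h' =>
    rw [map_add, add_lie, add_lie, map_add, add_sub_add_comm]
    exact add_mem h h'
  | hs c X h =>
    rw [map_smul, smul_lie, smul_lie, map_smul, ← smul_sub]
    exact Submodule.smul_mem _ _ h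
  | hb g hg i hi j hj =>
    induction Y using el_induction with
    | h0 =>
      rw [map_zero, lie_zero, lie_zero, map_zero, sub_zero]
      exact zero_mem _
    | ha X X' h h' =>
      rw [map_add, lie_add, lie_add, map_add, add_sub_add_comm]
      exact add_mem h h'
    | hs c X h =>
      rw [map_smul, lie_smul, lie_smul, map_smul, ← smul_sub]
      exact Submodule.smul_mem _ _ h
    | hb h hh p hp q hq =>
      rcases le_total g h with hgh | hgh
      · exact key g hg i hi j hj h hh p hp q hq hgh
      · rw [← lie_skew, ← lie_skew (el k g i j), map_neg, ← neg_sub', neg_mem_iff]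
        exact key h hh p hp q hq g hg i hi j hj hgh

theorem lie_psiMap_funMap (X : SlTruncWitt k) (f : TruncPoly k) :
    ⁅tableMap k psiTable X, funMap k aTable f⁆ ∈ LinearMap.range (funMap k aTable) := by
  induction X using el_induction with
  | h0 =>
    rw [map_zero, zero_lie]
    exact zero_mem _
  | ha X X' h h' =>
    rw [map_add, add_lie]
    exact add_mem h h'
  | hs c X h =>
    rw [map_smul, smul_lie]
    exact Submodule.smul_mem _ _ h
  | hb g hg i hi j hj =>
    induction f using tmon_induction with
    | h0 => simp
    | ha X X' h h' =>
      rw [map_add, lie_add]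
      exact add_mem h h'
    | hs c X h =>
      rw [map_smul, lie_smul]
      exact Submodule.smul_mem _ _ h
    | hb p hp q hq =>
      have := den_sub_mem (k := k) (forEl_iff.1 (forEl_iff.1 psiTable_br_aTable g hg i hi j hj)
        0 one_pos p hp q hq)
      rwa [Vec.den_br (valid_entry valid_psiTable _ _ _) (valid_entry valid_aTable _ _ _),
        Vec.den_zero, sub_zero, ← tableMap_el _ hg, ← funMap_tmon] at this

theorem lie_funMap (f g : TruncPoly k) : ⁅funMap k aTable f, funMap k aTable g⁆ = 0 := by
  induction f using tmon_induction with
  | h0 => simp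
  | ha f f' h h' => rw [map_add, add_lie, h, h', add_zero]
  | hs c f h => rw [map_smul, smul_lie, h, smul_zero]
  | hb i hi j hj =>
    induction g using tmon_induction with
    | h0 => simp
    | ha f f' h h' => rw [map_add, lie_add, h, h', add_zero]
    | hs c f h => rw [map_smul, lie_smul, h, smul_zero]
    | hb p hp q hq =>
      have := Vec.den_eq_zero (k := k) (forEl_iff.1 (forEl_iff.1 aTable_br_aTable 0 one_pos i hi j hj)
        0 one_pos p hp q hq)
      rwa [Vec.den_br (valid_entry valid_aTable _ _ _) (valid_entry valid_aTable _ _ _),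
        ← funMap_tmon, ← funMap_tmon] at this

theorem lie_psiMap_nilRep (X : SlTruncWitt k) :
    ⁅tableMap k psiTable X, nilRep k⁆ = funMap k aTable (divergence k X.right) := by
  induction X using el_induction with
  | h0 =>
    have : (0 : SlTruncWitt k).right = 0 := rfl
    rw [this, map_zero, map_zero, map_zero, zero_lie]
  | ha X X' h h' =>
    have : (X + X').right = X.right + X'.right := rfl
    rw [map_add, add_lie, h, h', this, map_add, map_add]
  | hs c X h =>
    have : (c • X).right = c • X.right := rfl
    rw [map_smul, smul_lie, h, this, map_smul, map_smul]
  | hb g hg i hi j hj =>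
    have hb := Vec.den_eq_of_eqv (k := k) (forEl_iff.1 psiTable_br_e g hg i hi j hj)
    rw [Vec.den_br (valid_entry valid_psiTable _ _ _) (valid_entry valid_aTable _ _ _),
      ← tableMap_el _ hg, den_entry_aTable] at hb
    rw [hb]
    split_ifs with h3 h4
    · rw [Vec.den_zero, el_lt h3]
      simp
    · subst h4
      rw [Vec.den_smul, ← funMap_tmon, el_three]
      simp [divergence, pd_tx, pd_tmon_zero]
    · obtain rfl : g = 4 := by omega
      rw [Vec.den_smul, ← funMap_tmon, el_four]
      simp [divergence, pd_tx, pd_tmon_one]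

theorem lie_uMap (X : SlTruncWitt k) : ⁅tableMap k uTable X, nilRep k⁆ = tableMap k psiTable X := by
  induction X using el_induction with
  | h0 => rw [map_zero, map_zero, zero_lie]
  | ha X X' h h' => rw [map_add, add_lie, h, h', map_add]
  | hs c X h => rw [map_smul, smul_lie, h, map_smul]
  | hb g hg i hi j hj =>
    have hb := Vec.den_eq_of_eqv (k := k) (forEl_iff.1 uTable_br_e g hg i hi j hj)
    rwa [Vec.den_br (valid_entry valid_uTable _ _ _) (valid_entry valid_aTable _ _ _),
      ← tableMap_el _ hg, ← tableMap_el _ hg, den_entry_aTable] at hb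

/-- Phrasing this through `X.left` permits induction over the full basis `el`; for the derivations
both sides vanish. -/
theorem lie_tMap (X : SlTruncWitt k) :
    ⁅tableMap k tTable ⟨X.left, 0⟩, nilRep k⁆ = tableMap k uTable ⟨X.left, 0⟩ := by
  induction X using el_induction with
  | h0 =>
    have : (⟨(0 : SlTruncWitt k).left, 0⟩ : SlTruncWitt k) = 0 := rfl
    rw [this, map_zero, map_zero, zero_lie]
  | ha X X' h h' =>
    have : (⟨(X + X').left, 0⟩ : SlTruncWitt k) = ⟨X.left, 0⟩ + ⟨X'.left, 0⟩ := by simp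
    rw [this, map_add, add_lie, h, h', map_add]
  | hs c X h =>
    have : (⟨(c • X).left, 0⟩ : SlTruncWitt k) = c • ⟨X.left, 0⟩ := by simp
    rw [this, map_smul, smul_lie, h, map_smul]
  | hb g hg i hi j hj =>
    by_cases h3 : g < 3
    · have e : (⟨(el k g i j).left, 0⟩ : SlTruncWitt k) = el k g i j := by rw [el_lt h3]
      have hb := Vec.den_eq_of_eqv (k := k) (forEl_iff.1 tTable_br_e g h3 i hi j hj)
      rwa [Vec.den_br (valid_entry valid_tTable _ _ _) (valid_entry valid_aTable _ _ _),
        ← tableMap_el _ hg, ← tableMap_el _ hg, den_entry_aTable, ← e] at hb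
    · have e : (⟨(el k g i j).left, 0⟩ : SlTruncWitt k) = 0 := by
        have : g = 3 ∨ g = 4 := by omega
        rcases this with rfl | rfl <;> rfl
      rw [e, map_zero, map_zero, zero_lie]

theorem lie_tFunMap (f : TruncPoly k) :
    ⁅funMap k tFunTable f, nilRep k⁆ = tableMap k uTable ⟨0, hamField k f⟩ := by
  induction f using tmon_induction with
  | h0 =>
    rw [map_zero, map_zero, zero_lie]
    exact (map_zero _).symm
  | ha f f' h h' =>
    have : (⟨0, hamField k (f + f')⟩ : SlTruncWitt k) = ⟨0, hamField k f⟩ + ⟨0, hamField k f'⟩ := by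
      simp
    rw [this, map_add, add_lie, h, h', map_add]
  | hs c f h =>
    have : (⟨0, hamField k (c • f)⟩ : SlTruncWitt k) = c • ⟨0, hamField k f⟩ := by simp
    rw [this, map_smul, smul_lie, h, map_smul]
  | hb i hi j hj =>
    have e : (⟨0, hamField k (tmon k i j)⟩ : SlTruncWitt k) =
        (j : k) • el k 3 i (j - 1) + (-(i : k)) • el k 4 (i - 1) j := by
      rw [el_three, el_four]
      simp [hamField, pd_tmon_zero, pd_tmon_one, sub_eq_add_neg, smul_assoc]
    have hb := Vec.den_eq_of_eqv (k := k) (forEl_iff.1 tFunTable_br_e 0 one_pos i hi j hj)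
    rw [Vec.den_br (valid_entry valid_tFunTable _ _ _) (valid_entry valid_aTable _ _ _),
      ← funMap_tmon, den_entry_aTable, Vec.den_comb] at hb
    rw [hb, e, map_add, map_smul, map_smul, tableMap_el _ (by norm_num), tableMap_el _ (by norm_num)]
    simp

/-- The root with coordinates `0112221` occurs in `psi (1 ⊗ e)` with coefficient `1` and in no image
of a monomial under `amap`. -/
theorem psiMap_notMem :
    tableMap k psiTable ⟨1 ⊗ₜ slGen k 0, 0⟩ ∉ LinearMap.range (funMap k aTable) := by
  have hc : ((aTable.all fun v => v.coeff ⟨0, 1, 1, 2, 2, 2, 1⟩ == 0) &&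
      (entry psiTable 0 0 0).coeff ⟨0, 1, 1, 2, 2, 2, 1⟩ == 1) = true := by decide +kernel
  rw [Bool.and_eq_true, List.all_eq_true, beq_iff_eq] at hc
  have hr : ip (R7.toLat ⟨0, 1, 1, 2, 2, 2, 1⟩) (R7.toLat ⟨0, 1, 1, 2, 2, 2, 1⟩) = 2 := by
    rw [R7.ip_toLat]; rfl
  have he : (⟨1 ⊗ₜ slGen k 0, 0⟩ : SlTruncWitt k) = el k 0 0 0 := by
    rw [el_lt (by norm_num), tmon_zero]
  have h0 : ∀ f, (chevalleyBasis k).coord (Sum.inr ⟨_, hr⟩) (funMap k aTable f) = 0 := by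
    intro f
    induction f using tmon_induction with
    | h0 => rw [map_zero, map_zero]
    | ha f f' h h' => rw [map_add, map_add, h, h', add_zero]
    | hs c f h => rw [map_smul, map_smul, h, smul_zero]
    | hb i hi j hj =>
      have hn : 9 * 0 + 3 * i + j < aTable.length := by
        change _ < 9
        omega
      have hm := hc.1 _ (List.getElem_mem hn)
      rw [beq_iff_eq, ← List.getD_eq_getElem _ Vec.zero hn] at hm
      rw [funMap_tmon, rootCoord_den _ hr (valid_entry valid_aTable _ _ _), entry,
        if_pos ⟨hi, hj⟩, hm, Int.cast_zero]
  rintro ⟨f, hf⟩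
  have h1 := h0 f
  rw [hf, he, tableMap_el _ (by norm_num), rootCoord_den _ hr (valid_entry valid_psiTable _ _ _),
    hc.2] at h1
  simp at h1

end Data

/-! ### Generation of the Lie algebra by `w` and `U (sl(2) ⊗ O(2;1))`. -/

section Generation

variable {k : Type*} [Field k]

theorem evec_rt_mem_of_smul {M : Submodule k (LieE7 k)} {c : ℤ} (hc : c = 1 ∨ c = -1) {r : R7}
    (h : Vec.den k ⟨R7.zero, [(c, r)]⟩ ∈ M) : evec k r.toLat ∈ M := by
  rw [Vec.den] at h
  rcases hc with rfl | rfl <;> simpa [R7.toLat_zero, Vec.hvec_zero] using h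

theorem evec_add_mem {M : LieSubalgebra k (LieE7 k)} {v w : Lat} (hv : ip v v = 2)
    (hw : ip w w = 2) (hvw : ip v w = -1) (h : evec k v ∈ M) (h' : evec k w ∈ M) :
    evec k (v + w) ∈ M := by
  have hs : ip (v + w) (v + w) = 2 := by rw [ip_add_self, hv, hw, hvw]; rfl
  have hne : v + w ≠ 0 := by
    intro h0
    rw [h0] at hs
    simp [ip] at hs
  have hm : lieBr k (evec k v) (evec k w) ∈ M := M.lie_mem h h'
  rw [lieBr_evec_evec hv hw, if_neg hne] at hm
  rcases Int.even_or_odd (cocycleForm v w) with hc | hc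
  · rwa [sgn_even hc, one_smul] at hm
  · rw [sgn_odd hc, neg_smul, one_smul] at hm
    exact M.neg_mem_iff.1 hm

/-- The Cartan part comes for free, since `hᵢ` is minus the bracket of the root vectors for `αᵢ` and
`-αᵢ`. -/
theorem eq_top_of_evec_mem {M : LieSubalgebra k (LieE7 k)}
    (h : ∀ v, ip v v = 2 → evec k v ∈ M) : M = ⊤ := by
  rw [eq_top_iff]
  rintro x -
  induction x using ind with
  | h0 => exact M.zero_mem
  | ha x y hx hy => exact M.add_mem hx hy
  | hs c i =>
    refine M.smul_mem c ?_
    rcases i with i | α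
    · have h1 : ip (simpleRoot i) (simpleRoot i) = 2 := by
        revert i; decide
      have h2 : ip (-simpleRoot i) (-simpleRoot i) = 2 := by
        rw [ip_neg_left, ip_neg_right, neg_neg, h1]
      have hm : lieBr k (evec k (simpleRoot i)) (evec k (-simpleRoot i)) ∈ M :=
        M.lie_mem (h _ h1) (h _ h2)
      rw [lieBr_evec_evec h1 h2, if_pos (add_neg_cancel _)] at hm
      have hb : hvec k (simpleRoot i) = bv k (Sum.inl i) := by
        rw [hvec, Finset.sum_eq_single i]
        · simp [simpleRoot]
        · intro j _ hj
          simp [simpleRoot, hj]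
        · simp
      rw [hb] at hm
      exact M.neg_mem_iff.1 hm
    · rw [← evec_root]
      exact h _ α.2

variable [CharP k 3]

/-- The order of `rootTable` encodes the derivation: positions below `28` are table entries up to
sign, position `28` is a bracket of two values of `U`, and later roots are sums of earlier ones. -/
theorem evec_rt_mem {M : LieSubalgebra k (LieE7 k)} (h1 : ∀ X, tableMap k psiTable X ∈ M)
    (h2 : ∀ f, funMap k aTable f ∈ M) (h3 : ∀ s, tableMap k uTable ⟨s, 0⟩ ∈ M) (m : ℕ)
    (hm : m < 126) : evec k (rt m).toLat ∈ M := by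
  have hu : ∀ g < 3, ∀ i j, Vec.den k (entry uTable g i j) ∈ M := by
    intro g hg i j
    rw [← tableMap_el _ (by omega), el_lt hg]
    exact h3 _
  induction m using Nat.strong_induction_on with
  | _ m ih =>
    rcases lt_trichotomy m 28 with h | rfl | h
    · have hi := List.all_eq_true.1 initTable_spec m (List.mem_range.2 h)
      simp only [Bool.and_eq_true, Bool.or_eq_true, beq_iff_eq, decide_eq_true_eq] at hi
      obtain ⟨⟨⟨ha, hb⟩, hc⟩, hd⟩ := hi
      refine evec_rt_mem_of_smul (M := M.toSubmodule) hc ?_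
      rw [rt, ← Vec.den_eq_of_eqv hd, initVec, getD_eq_entry]
      split_ifs at hb ⊢ <;> rw [decide_eq_true_eq] at hb
      · rw [← tableMap_el _ (by omega)]
        exact h1 _
      · rw [Nat.div_eq_of_lt hb, ← funMap_tmon]
        exact h2 _
      · exact hu _ (by omega) _ _
    · refine evec_rt_mem_of_smul (M := M.toSubmodule) (Or.inr rfl) ?_
      rw [rt, ← Vec.den_eq_of_eqv br_uTable_spec,
        Vec.den_br (valid_entry valid_uTable _ _ _) (valid_entry valid_uTable _ _ _)]
      exact M.lie_mem (hu _ (by norm_num) _ _) (hu _ (by norm_num) _ _)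
    · have hs := List.all_eq_true.1 stepTable_spec (m - 29) (List.mem_range.2 (by omega))
      simp only [Bool.and_eq_true, beq_iff_eq, decide_eq_true_eq] at hs
      obtain ⟨⟨⟨ha, hb⟩, hc⟩, hd⟩ := hs
      have e : m - 29 + 29 = m := by omega
      rw [e] at ha hb hd
      have hd' := R7.eq_of_beq hd
      rw [rt, hd', R7.toLat_add]
      refine evec_add_mem (ip_rt (by omega)) (ip_rt (by omega)) ?_ (ih _ ha (by omega))
        (ih _ hb (by omega))
      rw [R7.ip_toLat]
      exact hc

end Generation

/-! ### The data at the representative, its transport along the orbit, and the conclusion. -/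

theorem nonempty_wittData (k : Type*) [Field k] [CharP k 3] :
    Nonempty (WittData k (nilRep k)) :=
  ⟨{  psi := tableMap k psiTable
      U := tableMap k uTable
      amap := funMap k aTable
      T := (tableMap k tTable ∘ₗ
        (LieAlgebra.SemiDirectSum.inl (wittAction k) : SlTrunc k →ₗ[k] SlTruncWitt k)).coprod
          (funMap k tFunTable)
      amap_one := by rw [← tmon_zero, funMap_tmon, den_entry_aTable]
      amap_top := by
        rw [funMap_tmon]
        exact Vec.den_eq_zero rfl
      amap_ker := fun _ => funMap_aTable_ker
      lie_amap := lie_funMap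
      lie_psi_amap := lie_psiMap_funMap
      lie_psi := lie_psiMap
      lie_psi_e := lie_psiMap_nilRep
      psi_notMem := psiMap_notMem
      lie_U := lie_uMap
      lie_T := fun z => by
        have h1 := lie_tMap (k := k) ⟨z.1, 0⟩
        have h2 := lie_tFunMap z.2
        have h3 : (⟨z.1, hamField k z.2⟩ : SlTruncWitt k) = ⟨z.1, 0⟩ + ⟨0, hamField k z.2⟩ := by
          simp
        rw [h3, map_add, ← h1, ← h2, ← add_lie]
        rfl
      T_one := by
        rw [LinearMap.coprod_apply, map_zero, zero_add, ← tmon_zero, funMap_tmon]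
        exact Vec.den_eq_zero rfl
      finrank_le := finrank_lieE7_le k
      eq_top := fun M h1 h2 h3 => eq_top_of_evec_mem fun v hv => by
        obtain ⟨m, hm, rfl⟩ := exists_rt hv
        exact evec_rt_mem h1 h2 h3 m hm }⟩


theorem exists_wittData (k : Type*) [Field k] [CharP k 3] {e : LieE7 k} (he : e ∈ nilOrbit k) :
    Nonempty (WittData k e) := by
  obtain ⟨g, hg, rfl⟩ := he
  have key : ∀ g ∈ adjointGroup k, ∀ x : LieE7 k, Nonempty (WittData k x) →
      Nonempty (WittData k (g x)) := by
    intro g hg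
    induction hg using Subgroup.closure_induction'' with
    | mem g hg =>
      obtain ⟨p, rfl⟩ := hg
      rintro x ⟨D⟩
      exact D.nonempty_map (rootElement (two_ne_zero_of_char_three k) p.1 p.2)
    | inv_mem g hg =>
      obtain ⟨p, rfl⟩ := hg
      rintro x ⟨D⟩
      exact D.nonempty_map (rootElement (two_ne_zero_of_char_three k) p.1 p.2).symm
    | one => exact fun x hx => hx
    | mul g h _ _ hg hh => exact fun x hx => hg _ (hh x hx)
  exact key g hg _ (nonempty_wittData k)

end ExcE7

theorem mainTheorem7 (k : Type*) [Field k] [IsAlgClosed k] [CharP k 3]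
    (e : ExcE7.LieE7 k) (he : e ∈ ExcE7.nilOrbit k) :
    -- `A = rad(n_e)` is abelian of dimension `8`
    IsLieAbelian (ExcE7.radA e) ∧ Module.finrank k (ExcE7.radA e) = 8 ∧
    -- `A = rad(g_e)` and `A = rad(w)`
    ExcE7.radicalOf (ExcE7.elemCentralizer e) = ExcE7.radA e ∧
    ExcE7.radicalOf (ExcE7.wE7 e) = ExcE7.radA e ∧
    -- `w` is a maximal subalgebra of `g`
    IsCoatom (ExcE7.wE7 e) ∧
    ∃ (hc : ExcE7.elemCentralizer e ≤ ExcE7.wE7 e) (hn : ExcE7.elemNormalizer e ≤ ExcE7.wE7 e)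
      (I : LieIdeal k (ExcE7.wE7 e)),
      -- `A ⊆ I ⊆ g_e` and `dim I = 35`
      ExcE7.idealOfNormalizer (ExcE7.radA e) ≤ I ∧
      (∀ x ∈ I, (x : ExcE7.LieE7 k) ∈ ExcE7.elemCentralizer (k := k) e) ∧
      Module.finrank k I = 35 ∧
      -- `g_e / I ≅ H(2;1)` and `n_e / I ≅ CH(2;1)`
      Nonempty ((ExcE7.elemCentralizer e ⧸ I.comap (LieSubalgebra.inclusion hc)) ≃ₗ⁅k⁆
        ExcE7.ham k) ∧
      Nonempty ((ExcE7.elemNormalizer e ⧸ I.comap (LieSubalgebra.inclusion hn)) ≃ₗ⁅k⁆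
        ExcE7.confHam k) ∧
      -- `w / A ≅ (sl(2) ⊗ O(2;1)) ⋊ (1 ⊗ W(2;1))`, with `I / A` corresponding to `sl(2) ⊗ O(2;1)`
      ∃ φ : (ExcE7.wE7 e ⧸ ExcE7.idealOfNormalizer (ExcE7.radA e)) ≃ₗ⁅k⁆ ExcE7.SlTruncWitt k,
        ∀ x : ExcE7.wE7 e, x ∈ I ↔ (φ (LieSubmodule.Quotient.mk x)).right = 0 := by
  obtain ⟨D⟩ := ExcE7.exists_wittData k he
  have hA : ExcE7.radA e = D.A := D.radicalOf_elemNormalizer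
  unfold ExcE7.wE7
  rw [hA]
  refine ⟨D.isLieAbelian, D.finrank_A, D.radicalOf_elemCentralizer, D.radicalOf_normalizer,
    D.isCoatom_normalizer, D.elemCentralizer_le, D.elemNormalizer_le, D.ideal, ?_, ?_,
    D.finrank_ideal, D.nonempty_quotient_equiv _ _ D.mem_elemCentralizer_iff,
    D.nonempty_quotient_equiv _ _ D.mem_elemNormalizer_iff, ?_⟩
  · intro x hx
    rw [D.mem_ideal, (D.phi_eq_zero_iff x).2 hx]
    rfl
  · intro x hx
    rw [D.mem_elemCentralizer_iff, (D.mem_ideal x).1 hx]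
    exact zero_mem _
  -- The formula for `φ` on classes is what matches `I / A` with the vanishing of the `W(2;1)`
  -- component.
  · obtain ⟨φ, hφ⟩ := ExcE7.exists_quotient_equiv D.phi D.phi_surjective
      (ExcE7.idealOfNormalizer D.A) fun x => (D.phi_eq_zero_iff x).symm
    exact ⟨φ, fun x => by rw [hφ, D.mem_ideal]⟩
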